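/- Let $F$ be an infinite field and let $A$ be a central simple $F$-algebra of degree $n$ (so $\dim_F A=n^2$). For an integer $0\le k<n$, let $V_k(A)$ denote the $k$-th generalized Severi--Brauer variety of $A$, i.e. the $F$-scheme representing the functor on commutative $F$-algebras $$R\longmapsto \{\, I\subseteq A_R=A\otimes_F R \;:\; I \text{ is a left ideal and } A_R/I \text{ is a (finitely generated) projective } R\text{-module of constant rank } kn \,\},$$ where a homomorphism $R\to S$ acts by $I\mapsto I\otimes_R S\subseteq A_S$. (Equivalently, by passing to right annihilators, $V_k(A)$ parametrizes right ideals of $A$ of dimension $kn$.) Let $A^{op}$ be the opposite algebra, which has degree $n$ and represents $-[A]$ in the Brauer group. Then the schemes $V_k(A)$ and $V_k(A^{op})$ exist, and they are birational over $F$: there is an isomorphism of $F$-schemes between a dense open subscheme of $V_k(A)$ and a dense open subscheme of $V_k(A^{op})$. Moreover both schemes are integral, and their function fields are isomorphic as extensions of $F$: $$F\big(V_k(A)\big)\;\cong_F\; F\big(V_k(A^{op})\big).$$ -/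

import Mathlib

open CategoryTheory AlgebraicGeometry TensorProduct

universe u v w

section Functor

variable (F : Type u) [Field F] (A : Type v) [Ring A] [Algebra F A] (n k : ℕ)

/-- The `R`-points of the `k`-th generalized Severi-Brauer variety of an algebra `A` of degree `n`
over `F`: the left ideals `I` of `A_R = R ⊗[F] A` such that `A_R / I` is a finitely generated
projective `R`-module of constant rank `k * n`
(so that `I` is locally a direct summand of rank `n ^ 2 - k * n`). -/
def GSBPoints (R : Type w) [CommRing R] [Algebra F R] : Type (max v w) :=
  {I : Module.Grassmannian R (R ⊗[F] A) (k * n) //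
    ∀ a x : R ⊗[F] A, x ∈ I.toSubmodule → a * x ∈ I.toSubmodule}

variable {F A n k}

/-- The submodule `I ⊗_R S` of `A_S` (the base change of `I` in the Grassmannian)
is the `S`-span of the image of `I`. -/
theorem grassmannian_map_eq_span {R S : Type w} [CommRing R] [Algebra F R] [CommRing S]
    [Algebra F S] (f : R →ₐ[F] S) {m : ℕ} (I : Module.Grassmannian R (R ⊗[F] A) m) :
    (Module.Grassmannian.map f I).toSubmodule =
      Submodule.span S (Algebra.TensorProduct.map f (AlgHom.id F A) '' (I.toSubmodule : Set _)) := by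
  let : Algebra R S := f.toAlgebra
  have : IsScalarTower F R S :=
    IsScalarTower.of_algebraMap_eq' (f.comp_algebraMap).symm
  rw [Module.Grassmannian.map_toSubmodule]
  have key : ∀ y : R ⊗[F] A,
      AlgebraTensorModule.cancelBaseChange F R S S A ((1 : S) ⊗ₜ[R] y) =
        Algebra.TensorProduct.map f (AlgHom.id F A) y := by
    intro y
    induction y with
    | zero => simp
    | tmul r a =>
      rw [AlgebraTensorModule.cancelBaseChange_tmul, Algebra.TensorProduct.map_tmul,
        Algebra.smul_def, mul_one]
      rfl
    | add y z hy hz => rw [tmul_add, map_add, map_add, hy, hz]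
  have hker : ∀ z : S ⊗[R] (R ⊗[F] A), I.toSubmodule.mkQ.baseChange S z = 0 →
      z ∈ Submodule.span S (I.toSubmodule.map (TensorProduct.mk R S (R ⊗[F] A) 1) : Set _) := by
    intro z hz
    obtain ⟨w, rfl⟩ := (lTensor_exact S (LinearMap.exact_subtype_mkQ I.toSubmodule)
      I.toSubmodule.mkQ_surjective z).1 hz
    induction w with
    | zero => simp
    | tmul s y =>
      have h1 : LinearMap.lTensor S I.toSubmodule.subtype (s ⊗ₜ[R] y) =
          s • ((1 : S) ⊗ₜ[R] (y : R ⊗[F] A)) := by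
        simp [TensorProduct.smul_tmul']
      rw [h1]
      exact Submodule.smul_mem _ _ (Submodule.subset_span ⟨y, y.2, rfl⟩)
    | add w w' hw hw' =>
      rw [map_add]
      have hall : ∀ v, I.toSubmodule.mkQ.baseChange S
          (LinearMap.lTensor S I.toSubmodule.subtype v) = 0 := fun v =>
        (lTensor_exact S (LinearMap.exact_subtype_mkQ I.toSubmodule)
          I.toSubmodule.mkQ_surjective _).2 ⟨v, rfl⟩
      exact Submodule.add_mem _ (hw (hall w)) (hw' (hall w'))
  apply le_antisymm
  · intro x hx
    have hx' := hker ((AlgebraTensorModule.cancelBaseChange F R S S A).symm x) hx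
    have h2 := Submodule.mem_map_of_mem
      (f := (AlgebraTensorModule.cancelBaseChange F R S S A).toLinearMap) hx'
    rw [LinearEquiv.coe_coe, LinearEquiv.apply_symm_apply, Submodule.map_span] at h2
    refine Submodule.span_mono ?_ h2
    rintro _ ⟨_, ⟨y, hy, rfl⟩, rfl⟩
    exact ⟨y, hy, (key y).symm⟩
  · rw [Submodule.span_le]
    rintro _ ⟨y, hy, rfl⟩
    change I.toSubmodule.mkQ.baseChange S
      ((AlgebraTensorModule.cancelBaseChange F R S S A).symm _) = 0
    rw [← key y, LinearEquiv.symm_apply_apply, LinearMap.baseChange_tmul,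
      (Submodule.Quotient.mk_eq_zero _).2 hy |> fun h => (h : I.toSubmodule.mkQ y = 0), tmul_zero]

/-- Base change of points along a homomorphism `R → S` of commutative `F`-algebras:
`I ↦ I ⊗_R S ⊆ A_S`. -/
noncomputable def GSBPoints.map {R S : Type w} [CommRing R] [Algebra F R] [CommRing S] [Algebra F S]
    (f : R →ₐ[F] S) (I : GSBPoints F A n k R) : GSBPoints F A n k S :=
  ⟨Module.Grassmannian.map f I.1, by
    intro a x hx
    rw [grassmannian_map_eq_span] at hx ⊢
    induction a with
    | zero => rw [zero_mul]; exact Submodule.zero_mem _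
    | add a b ha hb => rw [add_mul]; exact Submodule.add_mem _ ha hb
    | tmul s b =>
      induction hx using Submodule.span_induction with
      | zero => rw [mul_zero]; exact Submodule.zero_mem _
      | add x y _ _ hx hy => rw [mul_add]; exact Submodule.add_mem _ hx hy
      | smul t x _ hx => rw [mul_smul_comm]; exact Submodule.smul_mem _ _ hx
      | mem x hx =>
        obtain ⟨y, hy, rfl⟩ := hx
        have h : (s ⊗ₜ[F] b : S ⊗[F] A) * Algebra.TensorProduct.map f (AlgHom.id F A) y =
            s • Algebra.TensorProduct.map f (AlgHom.id F A) ((1 ⊗ₜ[F] b) * y) := by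
          rw [map_mul, Algebra.TensorProduct.map_tmul, map_one, AlgHom.id_apply,
            ← smul_mul_assoc, TensorProduct.smul_tmul', smul_eq_mul, mul_one]
        rw [h]
        exact Submodule.smul_mem _ _ (Submodule.subset_span ⟨_, I.2 _ y hy, rfl⟩)⟩

end Functor

section Scheme

variable {F : Type u} [Field F]

/-- The `R`-points of a scheme `X` over `F`: the morphisms `Spec R ⟶ X` over `Spec F`. -/
def SchemePoints {X : Scheme.{u}} (sX : X ⟶ Spec (.of F))
    (R : Type u) [CommRing R] [Algebra F R] : Type u :=
  {x : Spec (.of R) ⟶ X // x ≫ sX = Spec.map (CommRingCat.ofHom (algebraMap F R))}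

/-- The map `X(R) → X(S)` induced by a homomorphism `R → S` of commutative `F`-algebras. -/
noncomputable def SchemePoints.map {X : Scheme.{u}} {sX : X ⟶ Spec (.of F)}
    {R S : Type u} [CommRing R] [Algebra F R] [CommRing S] [Algebra F S]
    (f : R →ₐ[F] S) (x : SchemePoints sX R) : SchemePoints sX S :=
  ⟨Spec.map (CommRingCat.ofHom (f : R →+* S)) ≫ x.1, by
    rw [Category.assoc, x.2, ← Spec.map_comp, ← CommRingCat.ofHom_comp, AlgHom.comp_algebraMap]⟩

/-- The scheme `X` over `F` is the `k`-th generalized Severi-Brauer variety `V_k(A)` of the algebra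
`A` of degree `n`: it represents the functor `GSBPoints F A n k` on commutative `F`-algebras. -/
def IsGenSeveriBrauer (A : Type v) [Ring A] [Algebra F A] (n k : ℕ)
    {X : Scheme.{u}} (sX : X ⟶ Spec (.of F)) : Prop :=
  ∃ φ : ∀ (R : Type u) [CommRing R] [Algebra F R], SchemePoints sX R ≃ GSBPoints F A n k R,
    ∀ (R S : Type u) [CommRing R] [Algebra F R] [CommRing S] [Algebra F S]
      (f : R →ₐ[F] S) (x : SchemePoints sX R), φ S (x.map f) = (φ R x).map f

/-- The structure map `F → F(X)` of the function field of an integral scheme `X` over `F`. -/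
noncomputable def functionFieldStructureMap {X : Scheme.{u}} [IsIntegral X]
    (sX : X ⟶ Spec (.of F)) : F →+* X.functionField :=
  (Spec.preimage (X.fromSpecStalk (genericPoint X) ≫ sX)).hom

/-- The function fields of two integral schemes over `F` are isomorphic as extensions of `F`. -/
def FunctionFieldsIsomorphic {X Y : Scheme.{u}} [IsIntegral X] [IsIntegral Y]
    (sX : X ⟶ Spec (.of F)) (sY : Y ⟶ Spec (.of F)) : Prop :=
  letI := (functionFieldStructureMap sX).toAlgebra
  letI := (functionFieldStructureMap sY).toAlgebra
  Nonempty (X.functionField ≃ₐ[F] Y.functionField)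

end Scheme

/-!
Write `r = k * n`. A tuple `x` of `r` elements of `A` defines a chart of the functor `GSBPoints`:
the left ideals `I` of `A_R` such that the `x j` form a basis of `A_R / I`. Such an ideal is the
kernel of a coordinate map `π : A → R ^ r`, and the conditions on `π` are polynomial equations
(`IsChartPoint`), so a chart is affine of finite type. Every point lies locally in a chart, and the
functor is a Zariski sheaf; gluing the charts gives a representing scheme
(`isGenSeveriBrauer_gluedScheme`), which is unique up to isomorphism over `F`
(`IsGenSeveriBrauer.exists_iso`).

*Integrality.* Let `K` be a field splitting `A`. Over a local `K`-algebra every point is the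
annihilator of an `n × k` matrix (`exists_eq_columnCoord`). Hence the coordinate ring of a nonempty
chart embeds into the rational function field in the entries of a generic `n × k` matrix
(`IsUniversalChart.injective_columnField`), and all nonempty charts have the same generic point,
the annihilator of the generic matrix (`isIntegral_gluedScheme`).

*The birational map.* Let `W` be the span of the `x j`, so that `A_R = W_R ⊕ I` for a point `I` of
the chart, and let `X ∈ I` be the projection of `1` along `W_R` (`projOne`). Generically
`I = A_R X`. The map sends `I` to the right ideal `X A_R`, that is, to a left ideal of the opposite algebra.
In a matrix algebra over a field, `A X` and `X A` have the same dimension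
(`Matrix.finrank_range_mulLeft_eq`), so generically `X A_R` is again a complement of `W_R`, and it
is a point of the chart for the opposite algebra given by the same tuple. Since `X ∈ X A_R` and
`1 - X ∈ W_R`, the projection of `1` to `X A_R` along `W_R` is again `X` (`projOne_reverse`), so the
same construction in the opposite direction returns `A_R X = I` (`reverse_reverse`). This gives an
isomorphism between principal open subschemes of the two charts
(`IsUniversalChart.exists_algEquiv`).

It remains to find a chart on which these open subschemes are nonempty. Over a splitting field an
explicit family of matrices does it (`scaledReversalLocus_standardFamily`); as the condition on the
family is the non-vanishing of a polynomial and `F` is infinite, some family in `A` satisfies it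
too (`exists_reversalLocus_ne_zero`). A nonempty open subscheme common to two integral schemes over
`F` is dense in both and has the function field of both (`birationalOver_of_openImmersions`).
-/

/-! ### Charts of the generalized Severi-Brauer functor -/

section ChartPoints

variable {F : Type u} [Field F] {A : Type v} [Ring A] [Algebra F A]

/-- The base change homomorphism `A_R → A_S` attached to `f : R → S`. -/
noncomputable abbrev baseChangeHom (A : Type v) [Ring A] [Algebra F A] {R S : Type*} [CommRing R]
    [Algebra F R] [CommRing S] [Algebra F S] (f : R →ₐ[F] S) : R ⊗[F] A →ₐ[F] S ⊗[F] A :=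
  Algebra.TensorProduct.map f (AlgHom.id F A)

variable {r : ℕ} {R : Type*} [CommRing R] [Algebra F R] {S : Type*} [CommRing S] [Algebra F S]

/-- An `R`-point of the chart attached to a tuple `x` of elements of `A`: a left ideal `I` of `A_R`
such that the `x j` form a basis of `A_R / I` is encoded by the coordinate map
`A → A_R / I ≃ R ^ r`. -/
structure IsChartPoint (x : Fin r → A) (π : A →ₗ[F] (Fin r → R)) : Prop where
  apply_self : ∀ j, π (x j) = Pi.single j 1
  apply_mul : ∀ a b, π (a * b) = ∑ j, π b j • π (a * x j)

/-- The kernel of the `R`-linear extension `A_R → R ^ r` of an `F`-linear map `A → R ^ r`. -/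
noncomputable def chartKer (π : A →ₗ[F] (Fin r → R)) : Submodule R (R ⊗[F] A) :=
  LinearMap.ker (π.liftBaseChange R)

lemma mem_chartKer {π : A →ₗ[F] (Fin r → R)} {y : R ⊗[F] A} :
    y ∈ chartKer π ↔ π.liftBaseChange R y = 0 := Iff.rfl

lemma liftBaseChange_one_tmul (π : A →ₗ[F] (Fin r → R)) (a : A) :
    π.liftBaseChange R (1 ⊗ₜ[F] a) = π a := by
  simp

/-- The base change of a coordinate map along `f : R → S`. -/
noncomputable def chartMap (f : R →ₐ[F] S) (π : A →ₗ[F] (Fin r → R)) : A →ₗ[F] (Fin r → S) :=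
  (LinearMap.pi fun i => f.toLinearMap ∘ₗ LinearMap.proj i) ∘ₗ π

@[simp]
lemma chartMap_apply (f : R →ₐ[F] S) (π : A →ₗ[F] (Fin r → R)) (a : A) (i : Fin r) :
    chartMap f π a i = f (π a i) := rfl

lemma chartMap_liftBaseChange (f : R →ₐ[F] S) (π : A →ₗ[F] (Fin r → R)) (y : R ⊗[F] A)
    (i : Fin r) :
    (chartMap f π).liftBaseChange S (baseChangeHom A f y) i = f (π.liftBaseChange R y i) := by
  induction y with
  | zero => simp
  | tmul s a => simp
  | add y z hy hz => simp only [map_add, Pi.add_apply, hy, hz]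

namespace IsChartPoint

variable {x : Fin r → A} {π : A →ₗ[F] (Fin r → R)}

lemma map (h : IsChartPoint x π) (f : R →ₐ[F] S) : IsChartPoint x (chartMap f π) where
  apply_self j := by
    ext i
    simp [h.apply_self, Pi.single_apply, apply_ite f]
  apply_mul a b := by
    ext i
    simp [h.apply_mul a b]

lemma lift_sum (h : IsChartPoint x π) (v : Fin r → R) :
    π.liftBaseChange R (∑ j, v j • (1 ⊗ₜ[F] x j)) = v := by
  ext i
  simp [h.apply_self, Finset.sum_apply, Pi.single_apply]

lemma surjective (h : IsChartPoint x π) : Function.Surjective (π.liftBaseChange R) :=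
  fun v => ⟨_, h.lift_sum v⟩

lemma sub_mem (h : IsChartPoint x π) (y : R ⊗[F] A) :
    y - ∑ j, π.liftBaseChange R y j • (1 ⊗ₜ[F] x j) ∈ chartKer π := by
  rw [mem_chartKer, map_sub, h.lift_sum, sub_self]

lemma lift_mul (h : IsChartPoint x π) (a : A) (y : R ⊗[F] A) :
    π.liftBaseChange R ((1 ⊗ₜ[F] a) * y) = ∑ j, π.liftBaseChange R y j • π (a * x j) := by
  induction y with
  | zero => simp
  | tmul s b =>
    simp only [Algebra.TensorProduct.tmul_mul_tmul, one_mul, LinearMap.liftBaseChange_tmul,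
      Pi.smul_apply, smul_eq_mul, h.apply_mul a b, Finset.smul_sum, mul_smul]
  | add y z hy hz => simp only [mul_add, map_add, hy, hz, Pi.add_apply, add_smul,
      Finset.sum_add_distrib]

lemma mul_mem (h : IsChartPoint x π) (a : R ⊗[F] A) {y : R ⊗[F] A} (hy : y ∈ chartKer π) :
    a * y ∈ chartKer π := by
  rw [mem_chartKer] at hy ⊢
  induction a with
  | zero => simp
  | tmul s b =>
    have : (s ⊗ₜ[F] b : R ⊗[F] A) * y = s • ((1 ⊗ₜ[F] b) * y) := by
      rw [← smul_mul_assoc, TensorProduct.smul_tmul', smul_eq_mul, mul_one]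
    rw [this, map_smul, h.lift_mul, hy]
    simp
  | add a b ha hb => rw [add_mul, map_add, ha, hb, add_zero]

/-- A coordinate map is determined by its kernel. -/
lemma eq_of_le (h : IsChartPoint x π) {π' : A →ₗ[F] (Fin r → R)}
    (h' : ∀ j, π' (x j) = Pi.single j 1) (hle : chartKer π ≤ chartKer π') : π = π' := by
  ext a i
  have := hle (h.sub_mem (1 ⊗ₜ a))
  rw [mem_chartKer, map_sub, sub_eq_zero] at this
  simp only [map_sum, map_smul, liftBaseChange_one_tmul, h'] at this
  rw [this]
  simp [Finset.sum_apply, Pi.single_apply]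

/-- The quotient of `A_R` by the left ideal of a chart point is free with basis `x`. -/
noncomputable def quotEquiv (h : IsChartPoint x π) :
    ((R ⊗[F] A) ⧸ chartKer π) ≃ₗ[R] (Fin r → R) :=
  (π.liftBaseChange R).quotKerEquivOfSurjective h.surjective

/-- The point of the Grassmannian defined by a chart point. -/
noncomputable def toGrassmannian (h : IsChartPoint x π) :
    Module.Grassmannian R (R ⊗[F] A) r where
  toSubmodule := chartKer π
  finite_quotient := Module.Finite.equiv h.quotEquiv.symm
  projective_quotient := Module.Projective.of_equiv h.quotEquiv.symm
  rankAtStalk_eq p := by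
    have : Nontrivial R := p.nontrivial
    rw [Module.rankAtStalk_eq_of_equiv h.quotEquiv, Module.rankAtStalk_eq_finrank_of_free]
    simp

/-- Base change of the left ideal of a chart point is given by base change of the coordinates. -/
lemma span_image_chartKer (h : IsChartPoint x π) (f : R →ₐ[F] S) :
    Submodule.span S (baseChangeHom A f '' (chartKer π : Set (R ⊗[F] A))) =
      chartKer (chartMap f π) := by
  apply le_antisymm
  · rw [Submodule.span_le]
    rintro _ ⟨y, hy, rfl⟩
    have hy' := mem_chartKer.1 hy
    change baseChangeHom A f y ∈ chartKer (chartMap f π)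
    rw [mem_chartKer]
    ext i
    rw [chartMap_liftBaseChange, hy']
    simp
  · intro y hy
    have key : ∀ z : S ⊗[F] A, z - ∑ j, (chartMap f π).liftBaseChange S z j • (1 ⊗ₜ[F] x j) ∈
        Submodule.span S (baseChangeHom A f '' (chartKer π : Set (R ⊗[F] A))) := by
      intro z
      induction z with
      | zero => simp
      | tmul s a =>
        have h1 : (s ⊗ₜ[F] a : S ⊗[F] A) -
            ∑ j, (chartMap f π).liftBaseChange S (s ⊗ₜ[F] a) j • (1 ⊗ₜ[F] x j) =
            s • baseChangeHom A f
              (1 ⊗ₜ a - ∑ j, π.liftBaseChange R (1 ⊗ₜ a) j • (1 ⊗ₜ[F] x j)) := by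
          simp [smul_sub, Finset.smul_sum, TensorProduct.smul_tmul', map_sub, map_sum]
        rw [h1]
        exact Submodule.smul_mem _ _ (Submodule.subset_span ⟨_, h.sub_mem _, rfl⟩)
      | add z z' hz hz' =>
        convert Submodule.add_mem _ hz hz' using 1
        simp only [map_add, Pi.add_apply, add_smul, Finset.sum_add_distrib]
        abel
    have := key y
    rw [mem_chartKer.1 hy] at this
    simpa using this

end IsChartPoint

end ChartPoints

section PointsInCharts

variable {F : Type u} [Field F] {A : Type v} [Ring A] [Algebra F A] {n k : ℕ}
  {R S : Type w} [CommRing R] [Algebra F R] [CommRing S] [Algebra F S]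

/-- The left ideal underlying a point of the generalized Severi-Brauer functor. -/
abbrev GSBPoints.ideal (I : GSBPoints F A n k R) : Submodule R (R ⊗[F] A) := I.1.toSubmodule

@[ext]
lemma GSBPoints.ext {I J : GSBPoints F A n k R} (h : I.ideal = J.ideal) : I = J :=
  Subtype.ext (Module.Grassmannian.ext h)

lemma GSBPoints.map_ideal (f : R →ₐ[F] S) (I : GSBPoints F A n k R) :
    (I.map f).ideal = Submodule.span S (baseChangeHom A f '' (I.ideal : Set (R ⊗[F] A))) :=
  grassmannian_map_eq_span f I.1

lemma GSBPoints.map_comp {T : Type w} [CommRing T] [Algebra F T] (f : R →ₐ[F] S) (g : S →ₐ[F] T)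
    (I : GSBPoints F A n k R) : I.map (g.comp f) = (I.map f).map g :=
  Subtype.ext (Module.Grassmannian.map_comp _ f g I.1)

lemma GSBPoints.map_id (I : GSBPoints F A n k R) : I.map (AlgHom.id F R) = I :=
  Subtype.ext (Module.Grassmannian.map_id _ (CommAlgCat.of F R) I.1)

/-- The point of the generalized Severi-Brauer functor given by a chart point. -/
noncomputable def IsChartPoint.toPoint {x : Fin (k * n) → A} {π : A →ₗ[F] (Fin (k * n) → R)}
    (h : IsChartPoint x π) : GSBPoints F A n k R :=
  ⟨h.toGrassmannian, fun a _ hy => h.mul_mem a hy⟩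

lemma IsChartPoint.toPoint_ideal {x : Fin (k * n) → A} {π : A →ₗ[F] (Fin (k * n) → R)}
    (h : IsChartPoint x π) : (h.toPoint : GSBPoints F A n k R).ideal = chartKer π := rfl

lemma IsChartPoint.toPoint_map {x : Fin (k * n) → A} {π : A →ₗ[F] (Fin (k * n) → R)}
    (h : IsChartPoint x π) (f : R →ₐ[F] S) : h.toPoint.map f = (h.map f).toPoint := by
  ext1
  rw [GSBPoints.map_ideal, toPoint_ideal, toPoint_ideal, h.span_image_chartKer]

/-- The point `I` lies in the chart of the tuple `x`: the `x j` form a basis of `A_R / I`. -/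
def GSBPoints.InChart (x : Fin (k * n) → A) (I : GSBPoints F A n k R) : Prop :=
  ∃ (π : A →ₗ[F] (Fin (k * n) → R)) (h : IsChartPoint x π), h.toPoint = I

namespace GSBPoints

variable {x y : Fin (k * n) → A} {I : GSBPoints F A n k R}

/-- The coordinate map of a point lying in the chart of `x`. -/
noncomputable def InChart.coord (h : I.InChart x) : A →ₗ[F] (Fin (k * n) → R) := h.choose

lemma InChart.isChartPoint (h : I.InChart x) : IsChartPoint x h.coord := h.choose_spec.choose

lemma InChart.toPoint_eq (h : I.InChart x) : h.isChartPoint.toPoint = I := h.choose_spec.choose_spec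

lemma InChart.ideal_eq (h : I.InChart x) : I.ideal = chartKer h.coord := by
  conv_lhs => rw [← h.toPoint_eq]
  rfl

lemma InChart.coord_eq (h : I.InChart x) {π : A →ₗ[F] (Fin (k * n) → R)} (h' : IsChartPoint x π)
    (e : h'.toPoint = I) : h.coord = π :=
  h.isChartPoint.eq_of_le h'.apply_self (by rw [← h.ideal_eq, ← e, h'.toPoint_ideal])

lemma InChart.map (h : I.InChart x) (f : R →ₐ[F] S) : (I.map f).InChart x := by
  obtain ⟨π, h', rfl⟩ := h
  exact ⟨_, h'.map f, (h'.toPoint_map f).symm⟩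

lemma InChart.coord_map (h : I.InChart x) (f : R →ₐ[F] S) :
    (h.map f).coord = chartMap f h.coord :=
  (h.map f).coord_eq (h.isChartPoint.map f) (by rw [← h.isChartPoint.toPoint_map, h.toPoint_eq])

/-- A point lies in the chart of `x` as soon as the `x j` form a basis of the quotient. -/
lemma inChart_of_bijective
    (h : Function.Bijective fun v : Fin (k * n) → R => I.ideal.mkQ (∑ j, v j • (1 ⊗ₜ[F] x j))) :
    I.InChart x := by
  let g : (Fin (k * n) → R) →ₗ[R] (R ⊗[F] A) ⧸ I.ideal :=
    I.ideal.mkQ ∘ₗ Fintype.linearCombination R (fun j => (1 ⊗ₜ[F] x j : R ⊗[F] A))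
  have hg : Function.Bijective g := h
  let e := (LinearEquiv.ofBijective g hg).symm
  let p : R ⊗[F] A →ₗ[R] (Fin (k * n) → R) := e.toLinearMap ∘ₗ I.ideal.mkQ
  have hker : ∀ y, p y = 0 ↔ y ∈ I.ideal := by
    intro y
    simp [p]
  have hx : ∀ j, p (1 ⊗ₜ x j) = Pi.single j 1 := by
    intro j
    simp only [p, LinearMap.comp_apply, LinearEquiv.coe_coe, e]
    rw [LinearEquiv.symm_apply_eq]
    simp [g, Fintype.linearCombination_apply, Pi.single_apply, ite_smul]
  have hsub : ∀ y, y - ∑ j, p y j • (1 ⊗ₜ[F] x j) ∈ I.ideal := by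
    intro y
    rw [← hker, map_sub, sub_eq_zero]
    ext i
    simp [map_sum, hx, Finset.sum_apply, Pi.single_apply]
  let π : A →ₗ[F] (Fin (k * n) → R) :=
    (p.restrictScalars F) ∘ₗ (Algebra.TensorProduct.includeRight : A →ₐ[F] R ⊗[F] A).toLinearMap
  have hπ : ∀ a, π a = p (1 ⊗ₜ a) := fun a => rfl
  have hlift : π.liftBaseChange R = p := by
    ext a : 3
    simp [hπ]
  refine ⟨π, ⟨hx, fun a b => ?_⟩, ?_⟩
  · have h1 := I.2 (1 ⊗ₜ a) _ (hsub (1 ⊗ₜ b))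
    rw [← hker, mul_sub, map_sub, sub_eq_zero, Finset.mul_sum, map_sum] at h1
    simpa [mul_smul_comm, hπ] using h1
  · ext y
    rw [IsChartPoint.toPoint_ideal, mem_chartKer, hlift, hker]

lemma InChart.bijective (h : I.InChart x) :
    Function.Bijective fun v : Fin (k * n) → R => I.ideal.mkQ (∑ j, v j • (1 ⊗ₜ[F] x j)) := by
  constructor
  · intro v w hvw
    simp only [Submodule.mkQ_apply] at hvw
    rw [Submodule.Quotient.eq, h.ideal_eq, mem_chartKer, map_sub,
      h.isChartPoint.lift_sum, h.isChartPoint.lift_sum, sub_eq_zero] at hvw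
    exact hvw
  · intro z
    obtain ⟨y, rfl⟩ := I.ideal.mkQ_surjective z
    refine ⟨h.coord.liftBaseChange R y, ?_⟩
    have := h.isChartPoint.sub_mem y
    rw [← h.ideal_eq] at this
    simp only [Submodule.mkQ_apply]
    exact ((Submodule.Quotient.eq _).2 this).symm

/-- The transition matrix from the chart of `y` to the chart of `x`. -/
noncomputable def InChart.transition (h : I.InChart x) (y : Fin (k * n) → A) :
    Matrix (Fin (k * n)) (Fin (k * n)) R :=
  Matrix.of fun i j => h.coord (y j) i

lemma InChart.transition_map (h : I.InChart x) (f : R →ₐ[F] S) :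
    ((h.map f).transition y).det = f (h.transition y).det := by
  rw [AlgHom.map_det]
  congr 1
  ext i j
  simp [transition, h.coord_map]

/-- Inside the chart of `x`, the chart of `y` is the locus where the transition determinant is
invertible. -/
lemma InChart.inChart_iff (h : I.InChart x) : I.InChart y ↔ IsUnit (h.transition y).det := by
  have key : ∀ v : Fin (k * n) → R, I.ideal.mkQ (∑ j, v j • (1 ⊗ₜ[F] y j)) =
      I.ideal.mkQ (∑ j, ((h.transition y).mulVec v) j • (1 ⊗ₜ[F] x j)) := by
    intro v
    simp only [Submodule.mkQ_apply]
    rw [Submodule.Quotient.eq, h.ideal_eq, mem_chartKer, map_sub, h.isChartPoint.lift_sum,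
      sub_eq_zero]
    ext i
    simp [transition, Matrix.mulVec, dotProduct, mul_comm]
  have hcomp : (fun v : Fin (k * n) → R => I.ideal.mkQ (∑ j, v j • (1 ⊗ₜ[F] y j))) =
      (fun v : Fin (k * n) → R => I.ideal.mkQ (∑ j, v j • (1 ⊗ₜ[F] x j))) ∘
        (h.transition y).mulVec := funext key
  have hiff : Function.Bijective (h.transition y).mulVec ↔ IsUnit (h.transition y).det := by
    rw [← Matrix.isUnit_iff_isUnit_det]
    constructor
    · intro hb
      have : Function.Bijective (Matrix.toLin' (h.transition y)) := hb
      have := (Module.End.isUnit_iff _).2 this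
      rwa [← Matrix.isUnit_toLin'_iff]
    · intro hu
      exact ⟨Matrix.mulVec_injective_of_isUnit hu, Matrix.mulVec_surjective_iff_isUnit.2 hu⟩
  rw [← hiff]
  constructor
  · intro hy
    have := hy.bijective
    rwa [hcomp, h.bijective.of_comp_iff'] at this
  · intro hy
    exact inChart_of_bijective (by rw [hcomp]; exact h.bijective.comp hy)

end GSBPoints

end PointsInCharts

/-! ### The functor is a Zariski sheaf, covered by charts -/

section Localization

variable {F : Type u} [Field F] {A : Type v} [Ring A] [Algebra F A]
  {R : Type w} [CommRing R] [Algebra F R]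

/-- The localization homomorphism `R → R_a` over `F`. -/
noncomputable abbrev awayHom (F : Type u) [Field F] {R : Type w} [CommRing R] [Algebra F R]
    (a : R) : R →ₐ[F] Localization.Away a :=
  IsScalarTower.toAlgHom F R (Localization.Away a)

/-- The base change homomorphism `A_R → A_{R_a}` as an `R`-linear map. -/
noncomputable def awayLinearMap (A : Type v) [Ring A] [Algebra F A] (a : R) :
    R ⊗[F] A →ₗ[R] Localization.Away a ⊗[F] A :=
  (AlgebraTensorModule.cancelBaseChange F R (Localization.Away a) (Localization.Away a) A
    ).toLinearMap.restrictScalars R ∘ₗ TensorProduct.mk R (Localization.Away a) (R ⊗[F] A) 1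

lemma awayLinearMap_apply (a : R) (y : R ⊗[F] A) :
    awayLinearMap A a y = baseChangeHom A (awayHom F a) y := by
  induction y with
  | zero => simp
  | tmul r b => simp [awayLinearMap, Algebra.smul_def]
  | add y z hy hz => rw [map_add, map_add, hy, hz]

instance (a : R) : IsLocalizedModule (Submonoid.powers a) (awayLinearMap (F := F) A a) := by
  rw [isLocalizedModule_iff_isBaseChange (Submonoid.powers a) (Localization.Away a)]
  exact IsBaseChange.of_equiv (AlgebraTensorModule.cancelBaseChange F R (Localization.Away a)
    (Localization.Away a) A) fun y => rfl

lemma baseChangeHom_comp_apply {R S T : Type*} [CommRing R] [Algebra F R] [CommRing S]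
    [Algebra F S] [CommRing T] [Algebra F T] (g : S →ₐ[F] T) (f : R →ₐ[F] S) (y : R ⊗[F] A) :
    baseChangeHom A (g.comp f) y = baseChangeHom A g (baseChangeHom A f y) := by
  induction y with
  | zero => simp
  | tmul r b => simp
  | add y z hy hz => simp only [map_add, hy, hz]

/-- The extension to `R_a` of a homomorphism over `F` inverting `a`. -/
noncomputable def awayLift {S : Type*} [CommRing S] [Algebra F S] (a : R) (f : R →ₐ[F] S)
    (h : IsUnit (f a)) : Localization.Away a →ₐ[F] S where
  __ := IsLocalization.Away.lift (g := f.toRingHom) a h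
  commutes' c := by
    have := IsLocalization.Away.lift_eq (S := Localization.Away a) (g := f.toRingHom) a h
      (algebraMap F R c)
    rw [← IsScalarTower.algebraMap_apply] at this
    exact this.trans (f.commutes c)

lemma awayLift_comp {S : Type*} [CommRing S] [Algebra F S] (a : R) (f : R →ₐ[F] S)
    (h : IsUnit (f a)) : (awayLift a f h).comp (awayHom F a) = f := by
  ext c
  exact IsLocalization.Away.lift_eq a h c

lemma awayLift_apply {S : Type*} [CommRing S] [Algebra F S] (a : R) (f : R →ₐ[F] S)
    (h : IsUnit (f a)) (c : R) : awayLift a f h (algebraMap R _ c) = f c :=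
  IsLocalization.Away.lift_eq a h c

lemma away_algHom_ext {S : Type*} [CommRing S] [Algebra F S] (a : R)
    {f g : Localization.Away a →ₐ[F] S} (h : f.comp (awayHom F a) = g.comp (awayHom F a)) :
    f = g := by
  apply AlgHom.coe_ringHom_injective
  apply IsLocalization.ringHom_ext (Submonoid.powers a)
  ext c
  exact congr($h c)

lemma exists_prime_notMem_of_span_eq_top {t : Set R} (ht : Ideal.span t = ⊤)
    (p : PrimeSpectrum R) : ∃ a ∈ t, a ∉ p.asIdeal := by
  by_contra! h
  exact p.2.ne_top (top_le_iff.1 (ht ▸ Ideal.span_le.2 h))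

lemma exists_finset_span_eq_top {Q : R → Prop}
    (h : ∀ p : PrimeSpectrum R, ∃ a ∉ p.asIdeal, Q a) :
    ∃ t : Finset R, Ideal.span (t : Set R) = ⊤ ∧ ∀ a ∈ t, Q a := by
  have : Ideal.span {a | Q a} = ⊤ := by
    by_contra hne
    obtain ⟨m, hm, hle⟩ := Ideal.exists_le_maximal _ hne
    obtain ⟨a, ha, hQ⟩ := h ⟨m, hm.isPrime⟩
    exact ha (hle (Ideal.subset_span hQ))
  obtain ⟨t, ht, h'⟩ := (Ideal.span_eq_top_iff_finite _).1 this
  exact ⟨t, h', ht⟩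

lemma mem_ideal_of_forall_prime {M : Type*} [AddCommGroup M] [Module R M] (N : Submodule R M)
    (y : M) (h : ∀ p : PrimeSpectrum R, ∃ a ∉ p.asIdeal, a • y ∈ N) : y ∈ N := by
  let J : Ideal R := N.comap (LinearMap.toSpanSingleton R M y)
  have : J = ⊤ := by
    by_contra hne
    obtain ⟨m, hm, hle⟩ := Ideal.exists_le_maximal _ hne
    obtain ⟨a, ha, hQ⟩ := h ⟨m, hm.isPrime⟩
    exact ha (hle hQ)
  have h1 : (1 : R) ∈ J := this ▸ Submodule.mem_top
  simpa [J] using h1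

namespace GSBPoints

variable {n k : ℕ}

lemma map_awayHom_ideal (a : R) (I : GSBPoints F A n k R) :
    (I.map (awayHom F a)).ideal =
      I.ideal.localized' (Localization.Away a) (Submonoid.powers a) (awayLinearMap A a) := by
  rw [map_ideal, Submodule.localized'_eq_span]
  congr 2
  ext y
  exact (awayLinearMap_apply a y).symm

/-- The inverse image in `A_R` of the restriction of an ideal to `R_a` consists of the elements that
some power of `a` multiplies into the ideal. -/
lemma mem_map_awayHom (a : R) (I : GSBPoints F A n k R) (y : R ⊗[F] A) :
    baseChangeHom A (awayHom F a) y ∈ (I.map (awayHom F a)).ideal ↔ ∃ N, a ^ N • y ∈ I.ideal := by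
  rw [map_awayHom_ideal, ← awayLinearMap_apply, Submodule.mem_localized']
  constructor
  · rintro ⟨m, hm, ⟨_, N, rfl⟩, h⟩
    rw [IsLocalizedModule.mk'_eq_iff, Submonoid.smul_def, ← map_smul] at h
    obtain ⟨⟨_, N', rfl⟩, hc⟩ := IsLocalizedModule.exists_of_eq (S := Submonoid.powers a) h
    refine ⟨N' + N, ?_⟩
    simp only [Submonoid.smul_def] at hc
    rw [pow_add, mul_smul]
    exact hc ▸ I.ideal.smul_mem _ hm
  · rintro ⟨N, hN⟩
    refine ⟨_, hN, ⟨_, N, rfl⟩, ?_⟩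
    rw [IsLocalizedModule.mk'_eq_iff, map_smul, Submonoid.smul_def]

/-- Points agreeing on a Zariski covering are equal. -/
lemma eq_of_locally_eq {I J : GSBPoints F A n k R}
    (h : ∀ p : PrimeSpectrum R, ∃ a ∉ p.asIdeal, I.map (awayHom F a) = J.map (awayHom F a)) :
    I = J := by
  have key : ∀ I J : GSBPoints F A n k R, (∀ p : PrimeSpectrum R, ∃ a ∉ p.asIdeal,
      I.map (awayHom F a) = J.map (awayHom F a)) → I.ideal ≤ J.ideal := by
    intro I J h y hy
    refine mem_ideal_of_forall_prime _ _ fun p => ?_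
    obtain ⟨a, ha, e⟩ := h p
    have h1 : baseChangeHom A (awayHom F a) y ∈ (I.map (awayHom F a)).ideal :=
      (mem_map_awayHom a I y).2 ⟨0, by simpa using hy⟩
    rw [e, mem_map_awayHom] at h1
    obtain ⟨N, hN⟩ := h1
    exact ⟨a ^ N, fun h => ha (p.2.mem_of_pow_mem _ h), hN⟩
  ext1
  exact le_antisymm (key I J h) (key J I fun p => (h p).imp fun a ha => ⟨ha.1, ha.2.symm⟩)

/-- The `R`-submodule of `A_R` of all elements restricting to members of the given left ideals. -/
noncomputable def glueIdeal (t : Finset R)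
    (I : ∀ a : t, GSBPoints F A n k (Localization.Away a.1)) :
    Submodule R (R ⊗[F] A) :=
  ⨅ a : t, ((I a).ideal.restrictScalars R).comap (awayLinearMap A a.1)

lemma mem_glueIdeal {t : Finset R} {I : ∀ a : t, GSBPoints F A n k (Localization.Away a.1)}
    {y : R ⊗[F] A} :
    y ∈ glueIdeal t I ↔ ∀ a : t, baseChangeHom A (awayHom F a.1) y ∈ (I a).ideal := by
  simp only [glueIdeal, Submodule.mem_iInf, Submodule.mem_comap, Submodule.restrictScalars_mem,
    awayLinearMap_apply]

/-- On the overlap of two members of the covering, membership in the second ideal holds up to a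
power of the equation of the first. -/
lemma exists_pow_smul_mem_of_compatible {a b : R} (I : GSBPoints F A n k (Localization.Away a))
    (J : GSBPoints F A n k (Localization.Away b))
    (hI : ∀ (S : Type w) [CommRing S] [Algebra F S]
      (g : Localization.Away a →ₐ[F] S) (h : Localization.Away b →ₐ[F] S),
      g.comp (awayHom F a) = h.comp (awayHom F b) → I.map g = J.map h)
    {y : R ⊗[F] A} (hy : baseChangeHom A (awayHom F a) y ∈ I.ideal) :
    ∃ M, a ^ M • baseChangeHom A (awayHom F b) y ∈ J.ideal := by
  let a' := algebraMap R (Localization.Away b) a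
  let h : Localization.Away b →ₐ[F] Localization.Away a' := awayHom F a'
  have hu : IsUnit ((h.comp (awayHom F b)) a) := IsLocalization.Away.algebraMap_isUnit a'
  have h3 := hI _ (awayLift a (h.comp (awayHom F b)) hu) h (awayLift_comp _ _ _)
  have h4 : baseChangeHom A (awayLift a (h.comp (awayHom F b)) hu)
      (baseChangeHom A (awayHom F a) y) = baseChangeHom A h (baseChangeHom A (awayHom F b) y) := by
    rw [← baseChangeHom_comp_apply, ← baseChangeHom_comp_apply, awayLift_comp]
  have h5 : baseChangeHom A h (baseChangeHom A (awayHom F b) y) ∈ (J.map h).ideal := by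
    rw [← h3, map_ideal, ← h4]
    exact Submodule.subset_span ⟨_, hy, rfl⟩
  rw [mem_map_awayHom] at h5
  obtain ⟨M, hM⟩ := h5
  refine ⟨M, ?_⟩
  rwa [← algebraMap_smul (Localization.Away b) (a ^ M), _root_.map_pow]

/-- The glued submodule restricts to the given ideals. -/
lemma glueIdeal_localized (t : Finset R) (I : ∀ a : t, GSBPoints F A n k (Localization.Away a.1))
    (hI : ∀ (a b : t) (S : Type w) [CommRing S] [Algebra F S]
      (g : Localization.Away a.1 →ₐ[F] S) (h : Localization.Away b.1 →ₐ[F] S),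
      g.comp (awayHom F a.1) = h.comp (awayHom F b.1) → (I a).map g = (I b).map h) (a : t) :
    (glueIdeal t I).localized' (Localization.Away a.1) (Submonoid.powers a.1)
      (awayLinearMap A a.1) = (I a).ideal := by
  classical
  apply le_antisymm
  · rw [Submodule.localized'_eq_span, Submodule.span_le]
    rintro _ ⟨y, hy, rfl⟩
    rw [awayLinearMap_apply]
    exact mem_glueIdeal.1 hy a
  · intro z hz
    obtain ⟨⟨y, ⟨_, M, rfl⟩⟩, rfl⟩ :=
      IsLocalizedModule.mk'_surjective (Submonoid.powers a.1) (awayLinearMap A a.1) z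
    simp only [Function.uncurry_apply_pair] at hz ⊢
    have h2 := IsLocalizedModule.mk'_cancel' (awayLinearMap (F := F) A a.1) y
      (⟨_, M, rfl⟩ : Submonoid.powers a.1)
    rw [Submonoid.smul_def] at h2
    have hy : baseChangeHom A (awayHom F a.1) y ∈ (I a).ideal := by
      have := (I a).ideal.smul_mem (algebraMap R _ (a.1 ^ M)) hz
      rwa [algebraMap_smul, h2, awayLinearMap_apply] at this
    have hb : ∀ b : t, ∃ M', a.1 ^ M' • baseChangeHom A (awayHom F b.1) y ∈ (I b).ideal :=
      fun b => exists_pow_smul_mem_of_compatible (I a) (I b) (hI a b) hy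
    choose M' hM' using hb
    have hmem : a.1 ^ (∑ b, M' b) • y ∈ glueIdeal t I := by
      rw [mem_glueIdeal]
      intro b
      obtain ⟨c, hc⟩ := Nat.exists_eq_add_of_le' (Finset.single_le_sum (f := M')
        (fun _ _ => Nat.zero_le _) (Finset.mem_univ b))
      rw [hc, pow_add, mul_smul, ← awayLinearMap_apply, _root_.map_smul, _root_.map_smul,
        awayLinearMap_apply, ← algebraMap_smul (Localization.Away b.1)]
      exact (I b).ideal.smul_mem _ (hM' b)
    refine (Submodule.mem_localized' ..).2 ⟨_, hmem, ⟨_, M + ∑ b, M' b, rfl⟩, ?_⟩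
    rw [IsLocalizedModule.mk'_eq_iff, _root_.map_smul, Submonoid.smul_def, ← h2]
    simp only [pow_add]
    rw [mul_comm, mul_smul]

/-- Compatible points on a Zariski covering glue. -/
lemma exists_glue [FiniteDimensional F A] (t : Finset R) (ht : Ideal.span (t : Set R) = ⊤)
    (I : ∀ a : t, GSBPoints F A n k (Localization.Away a.1))
    (hI : ∀ (a b : t) (S : Type w) [CommRing S] [Algebra F S]
      (g : Localization.Away a.1 →ₐ[F] S) (h : Localization.Away b.1 →ₐ[F] S),
      g.comp (awayHom F a.1) = h.comp (awayHom F b.1) → (I a).map g = (I b).map h) :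
    ∃ J : GSBPoints F A n k R, ∀ a : t, J.map (awayHom F a.1) = I a := by
  set N := glueIdeal t I with hNdef
  have hNa := glueIdeal_localized t I hI
  rw [← hNdef] at hNa
  -- The glued submodule is finitely generated, because its localizations are: the quotients by the
  -- given ideals are finitely presented.
  have hker : N.FG := by
    refine Submodule.of_localizationSpan' (t : Set R) ht
      (Rₚ := fun a => Localization.Away a.1) (fun a => awayLinearMap A a.1) fun a => ?_
    have e := hNa a
    rw [e]
    have : Module.FinitePresentation (Localization.Away a.1)
        ((Localization.Away a.1 ⊗[F] A) ⧸ (I a).ideal) :=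
      Module.finitePresentation_of_projective _ _
    have h := Module.FinitePresentation.fg_ker (I a).ideal.mkQ (I a).ideal.mkQ_surjective
    rwa [Submodule.ker_mkQ] at h
  have hfp : Module.FinitePresentation R ((R ⊗[F] A) ⧸ N) :=
    have : Module.FinitePresentation R (R ⊗[F] A) := Module.finitePresentation_of_projective _ _
    Module.finitePresentation_of_surjective N.mkQ N.mkQ_surjective (by rwa [Submodule.ker_mkQ])
  have hproj : ∀ a : t, Module.Projective (Localization.Away a.1)
      ((Localization.Away a.1 ⊗[F] A) ⧸ N.localized' (Localization.Away a.1)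
        (Submonoid.powers a.1) (awayLinearMap A a.1)) := by
    intro a
    rw [hNa]
    infer_instance
  have hP : Module.Projective R ((R ⊗[F] A) ⧸ N) := by
    rw [← Module.freeLocus_eq_univ_iff, Set.eq_univ_iff_forall]
    intro p
    obtain ⟨a, ha, hap⟩ := exists_prime_notMem_of_span_eq_top ht p
    refine (Module.basicOpen_subset_freeLocus_iff (f := a)).2 ?_ hap
    have := hproj ⟨a, ha⟩
    exact Module.Projective.of_equiv ((IsLocalizedModule.linearEquiv (Submonoid.powers a)
      (N.toLocalizedQuotient' (Localization.Away a) (Submonoid.powers a) (awayLinearMap A a))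
      (LocalizedModule.mkLinearMap (Submonoid.powers a) _)).extendScalarsOfIsLocalization
        (Submonoid.powers a) (Localization.Away a))
  have hrank : ∀ p : PrimeSpectrum R, Module.rankAtStalk (R := R) ((R ⊗[F] A) ⧸ N) p = k * n := by
    intro p
    obtain ⟨a, ha, hap⟩ := exists_prime_notMem_of_span_eq_top ht p
    have hp : p ∈ Set.range (PrimeSpectrum.comap (algebraMap R (Localization.Away a))) := by
      rw [PrimeSpectrum.localization_away_comap_range _ a]
      exact hap
    obtain ⟨q, rfl⟩ := hp
    rw [← Module.rankAtStalk_isBaseChange (IsLocalizedModule.isBaseChange (Submonoid.powers a)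
      (Localization.Away a) (N.toLocalizedQuotient' (Localization.Away a) (Submonoid.powers a)
        (awayLinearMap A a)))]
    have e := hNa ⟨a, ha⟩
    simp only at e
    rw [e]
    exact (I ⟨a, ha⟩).1.rankAtStalk_eq q
  let J : GSBPoints F A n k R := ⟨⟨N, inferInstance, hP, hrank⟩, by
    intro b y hy
    change b * y ∈ N
    rw [hNdef, mem_glueIdeal]
    intro a
    rw [map_mul]
    exact (I a).2 _ _ (mem_glueIdeal.1 hy a)⟩
  exact ⟨J, fun a => by ext1; rw [map_awayHom_ideal]; exact hNa a⟩

/-- Locally on the base, every point lies in some chart. -/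
lemma exists_inChart [FiniteDimensional F A] (I : GSBPoints F A n k R) (p : PrimeSpectrum R) :
    ∃ a ∉ p.asIdeal, ∃ x : Fin (k * n) → A, (I.map (awayHom F a)).InChart x := by
  let κ := p.asIdeal.ResidueField
  let Q := (R ⊗[F] A) ⧸ I.ideal
  let ev : A → κ ⊗[R] Q := fun a => 1 ⊗ₜ I.ideal.mkQ (1 ⊗ₜ a)
  have hspan : Submodule.span κ (Set.range ev) = ⊤ := by
    rw [eq_top_iff]
    rintro z -
    induction z with
    | zero => simp
    | add z z' hz hz' => exact Submodule.add_mem _ hz hz'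
    | tmul c y =>
      obtain ⟨y, rfl⟩ := I.ideal.mkQ_surjective y
      have : c ⊗ₜ[R] I.ideal.mkQ y = c • ((1 : κ) ⊗ₜ[R] I.ideal.mkQ y) := by
        rw [TensorProduct.smul_tmul', smul_eq_mul, mul_one]
      rw [this]
      refine Submodule.smul_mem _ _ ?_
      induction y with
      | zero => simp
      | add y y' hy hy' => rw [map_add, tmul_add]; exact Submodule.add_mem _ (hy (by
          rw [TensorProduct.smul_tmul', smul_eq_mul, mul_one])) (hy' (by
          rw [TensorProduct.smul_tmul', smul_eq_mul, mul_one]))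
      | tmul s b =>
        have : (1 : κ) ⊗ₜ[R] I.ideal.mkQ (s ⊗ₜ[F] b) = algebraMap R κ s • ev b := by
          have h1 : (s ⊗ₜ[F] b : R ⊗[F] A) = s • (1 ⊗ₜ b) := by
            rw [TensorProduct.smul_tmul', smul_eq_mul, mul_one]
          rw [h1, map_smul, tmul_smul, algebraMap_smul]
        rw [this]
        exact Submodule.smul_mem _ _ (Submodule.subset_span ⟨b, rfl⟩)
  have hfin : Module.finrank κ (κ ⊗[R] Q) = k * n :=
    (Ideal.finrank_fiber_eq_rankAtStalk (M := Q) p.asIdeal).trans (I.1.rankAtStalk_eq p)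
  obtain ⟨f, hf, hfspan, -⟩ := Submodule.exists_fun_fin_finrank_span_eq κ (Set.range ev)
  have hcard : Module.finrank κ (Submodule.span κ (Set.range ev)) = k * n := by
    rw [hspan, finrank_top, hfin]
  choose x' hx' using hf
  let x : Fin (k * n) → A := fun j => x' (Fin.cast hcard.symm j)
  have hxspan : Submodule.span κ (Set.range fun j => ev (x j)) = ⊤ := by
    rw [← hspan, ← hfspan]
    congr 1
    ext z
    constructor
    · rintro ⟨j, rfl⟩; exact ⟨_, (hx' _).symm⟩
    · rintro ⟨j, rfl⟩; exact ⟨Fin.cast hcard j, hx' _⟩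
  -- The cokernel of the map defined by `x` vanishes near `p` by Nakayama's lemma
  let g : (Fin (k * n) → R) →ₗ[R] Q :=
    I.ideal.mkQ ∘ₗ Fintype.linearCombination R (fun j => (1 ⊗ₜ[F] x j : R ⊗[F] A))
  have hsupp : p ∉ Module.support R (Q ⧸ LinearMap.range g) := by
    rw [Module.mem_support_iff_nontrivial_residueField_tensorProduct,
      not_nontrivial_iff_subsingleton, ← Submodule.subsingleton_iff κ]
    rw [← subsingleton_iff_bot_eq_top]
    let l : κ ⊗[R] Q →ₗ[κ] κ ⊗[R] (Q ⧸ LinearMap.range g) := (LinearMap.range g).mkQ.baseChange κ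
    have hl : Function.Surjective l :=
      LinearMap.baseChange_surjective κ (LinearMap.range g).mkQ_surjective
    refine Eq.trans (Eq.symm ?_) (LinearMap.range_eq_top.2 hl)
    rw [LinearMap.range_eq_map l, ← hxspan, Submodule.map_span, Submodule.span_eq_bot]
    rintro _ ⟨_, ⟨j, rfl⟩, rfl⟩
    have : (LinearMap.range g).mkQ (I.ideal.mkQ (1 ⊗ₜ x j)) = 0 := by
      rw [Submodule.mkQ_apply, Submodule.Quotient.mk_eq_zero]
      refine ⟨Pi.single j 1, ?_⟩
      simp only [g, LinearMap.comp_apply, Fintype.linearCombination_apply_single, one_smul]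
    change (1 : κ) ⊗ₜ[R] _ = 0
    rw [this, tmul_zero]
  rw [Module.mem_support_iff_of_finite, SetLike.not_le_iff_exists] at hsupp
  obtain ⟨a, ha, hap⟩ := hsupp
  refine ⟨a, hap, x, inChart_of_bijective ?_⟩
  let Ra := Localization.Away a
  let Ia := I.map (awayHom F a)
  let ga : (Fin (k * n) → Ra) →ₗ[Ra] (Ra ⊗[F] A) ⧸ Ia.ideal :=
    Ia.ideal.mkQ ∘ₗ Fintype.linearCombination Ra (fun j => (1 ⊗ₜ[F] x j : Ra ⊗[F] A))
  have hgen : ∀ y : R ⊗[F] A, Ia.ideal.mkQ (baseChangeHom A (awayHom F a) y) ∈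
      LinearMap.range ga := by
    intro y
    have h1 := Module.mem_annihilator.1 ha ((LinearMap.range g).mkQ (I.ideal.mkQ y))
    rw [← map_smul, ← map_smul, Submodule.mkQ_apply, Submodule.Quotient.mk_eq_zero] at h1
    obtain ⟨v, hv⟩ := h1
    have h2 : a • y - ∑ j, v j • (1 ⊗ₜ[F] x j) ∈ I.ideal := by
      rw [← Submodule.Quotient.eq]
      simp only [g, LinearMap.comp_apply, Fintype.linearCombination_apply] at hv
      exact hv.symm
    have h3 : baseChangeHom A (awayHom F a) (a • y - ∑ j, v j • (1 ⊗ₜ[F] x j)) ∈ Ia.ideal := by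
      rw [GSBPoints.map_ideal]
      exact Submodule.subset_span ⟨_, h2, rfl⟩
    rw [← awayLinearMap_apply, map_sub, map_smul, map_sum] at h3
    have hu := IsLocalization.Away.algebraMap_isUnit (S := Ra) a
    have h4 : algebraMap R Ra a • Ia.ideal.mkQ (awayLinearMap A a y) ∈ LinearMap.range ga := by
      refine ⟨fun j => algebraMap R Ra (v j), ?_⟩
      rw [algebraMap_smul, ← LinearMap.map_smul_of_tower]
      refine ((Submodule.Quotient.eq _).2 ?_).symm
      convert h3 using 2
      rw [Fintype.linearCombination_apply]
      refine Finset.sum_congr rfl fun j _ => ?_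
      rw [map_smul, awayLinearMap_apply, algebraMap_smul]
      simp
    rw [← awayLinearMap_apply]
    obtain ⟨c, hc⟩ := hu.exists_left_inv
    have := (LinearMap.range ga).smul_mem c h4
    rwa [smul_smul, hc, one_smul] at this
  have hsurj : Function.Surjective ga := by
    rw [← LinearMap.range_eq_top, eq_top_iff]
    rintro z -
    obtain ⟨z, rfl⟩ := Ia.ideal.mkQ_surjective z
    induction z with
    | zero => simp
    | add z z' hz hz' => rw [map_add]; exact Submodule.add_mem _ hz hz'
    | tmul c b =>
      have h1 : (c ⊗ₜ[F] b : Ra ⊗[F] A) = c • baseChangeHom A (awayHom F a) (1 ⊗ₜ b) := by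
        simp [TensorProduct.smul_tmul']
      rw [h1, map_smul]
      exact Submodule.smul_mem _ _ (hgen _)
  refine Module.bijective_of_surjective_of_rankAtStalk_eq (φ := ga) hsurj fun m hm => ?_
  have : Nontrivial Ra := (⟨m, inferInstance⟩ : PrimeSpectrum Ra).nontrivial
  rw [Ia.1.rankAtStalk_eq, Module.rankAtStalk_eq_finrank_of_free]
  simp

end GSBPoints

end Localization

/-! ### Coordinate rings of intersections of charts -/

section ChartRing

variable {F : Type u} [Field F] {A : Type v} [Ring A] [Algebra F A] {r : ℕ} {ι : Type u}

/-- A point lying in all the charts `x i`, `i ∈ s`, encoded by its coordinate maps in these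
charts. -/
structure IsMultiChartPoint {R : Type*} [CommRing R] [Algebra F R] (x : ι → Fin r → A)
    (s : Finset ι) (π : s → A →ₗ[F] (Fin r → R)) : Prop where
  isChartPoint : ∀ i : s, IsChartPoint (x i) (π i)
  apply_eq : ∀ (i j : s) (a : A), π j a = ∑ l, π i a l • π j (x i l)

lemma IsMultiChartPoint.chartKer_le {R : Type*} [CommRing R] [Algebra F R] {x : ι → Fin r → A}
    {s : Finset ι} {π : s → A →ₗ[F] (Fin r → R)} (h : IsMultiChartPoint x s π) (i j : s) :
    chartKer (π i) ≤ chartKer (π j) := by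
  have key : ∀ y : R ⊗[F] A, (π j).liftBaseChange R y =
      ∑ l, (π i).liftBaseChange R y l • π j (x i l) := by
    intro y
    induction y with
    | zero => simp
    | tmul c a =>
      simp only [LinearMap.liftBaseChange_tmul, Pi.smul_apply, smul_eq_mul]
      rw [h.apply_eq i j a, Finset.smul_sum]
      simp only [mul_smul]
    | add y z hy hz =>
      rw [map_add, map_add, hy, hz, ← Finset.sum_add_distrib]
      simp only [Pi.add_apply, add_smul]
  intro y hy
  rw [mem_chartKer] at hy ⊢
  rw [key, hy]
  simp

variable [FiniteDimensional F A]

/-- The polynomial ring in the coefficients of a family of coordinate maps indexed by `s`. -/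
abbrev CoordPolynomial (F : Type u) [Field F] (A : Type v) [Ring A] [Algebra F A] (r : ℕ)
    (s : Finset ι) : Type u :=
  MvPolynomial (s × Fin (Module.finrank F A) × Fin r) F

/-- The generic family of linear maps `A → R ^ r`. -/
noncomputable def genericCoord (F : Type u) [Field F] (A : Type v) [Ring A] [Algebra F A]
    [FiniteDimensional F A] (r : ℕ) (s : Finset ι) (i : s) :
    A →ₗ[F] (Fin r → CoordPolynomial F A r s) :=
  (Module.finBasis F A).constr F fun l j => MvPolynomial.X (i, l, j)

lemma genericCoord_basis (s : Finset ι) (i : s) (l : Fin (Module.finrank F A)) :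
    genericCoord F A r s i (Module.finBasis F A l) = fun j => MvPolynomial.X (i, l, j) :=
  Module.Basis.constr_basis ..

/-- The ideal generated by the equations expressing that the generic family is the family of
coordinate maps of a point lying in all the charts `x i`, `i ∈ s`. -/
noncomputable def chartRelations (F : Type u) [Field F] {A : Type v} [Ring A] [Algebra F A]
    [FiniteDimensional F A] {r : ℕ} (x : ι → Fin r → A) (s : Finset ι) :
    Ideal (CoordPolynomial F A r s) :=
  Ideal.span ({p | ∃ i l m, p = genericCoord F A r s i (x i l) m - (Pi.single l 1 : Fin r → _) m} ∪
    {p | ∃ i a b m, p = genericCoord F A r s i (a * b) m -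
      (∑ l, genericCoord F A r s i b l • genericCoord F A r s i (a * x i l)) m} ∪
    {p | ∃ i j a m, p = genericCoord F A r s j a m -
      (∑ l, genericCoord F A r s i a l • genericCoord F A r s j (x i l)) m})

/-- The coordinate ring of the intersection of the charts `x i`, `i ∈ s`. -/
abbrev ChartRing (F : Type u) [Field F] {A : Type v} [Ring A] [Algebra F A]
    [FiniteDimensional F A] {r : ℕ} (x : ι → Fin r → A) (s : Finset ι) : Type u :=
  CoordPolynomial F A r s ⧸ chartRelations F x s

/-- The universal family of coordinate maps. -/
noncomputable def univCoord (F : Type u) [Field F] {A : Type v} [Ring A] [Algebra F A]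
    [FiniteDimensional F A] {r : ℕ} (x : ι → Fin r → A) (s : Finset ι) (i : s) :
    A →ₗ[F] (Fin r → ChartRing F x s) :=
  chartMap (Ideal.Quotient.mkₐ F (chartRelations F x s)) (genericCoord F A r s i)

lemma isMultiChartPoint_univCoord (x : ι → Fin r → A) (s : Finset ι) :
    IsMultiChartPoint x s (univCoord F x s) := by
  have key : ∀ p ∈ chartRelations F x s, Ideal.Quotient.mkₐ F (chartRelations F x s) p = 0 :=
    fun p hp => Ideal.Quotient.eq_zero_iff_mem.2 hp
  constructor
  · intro i
    constructor
    · intro l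
      ext m
      have := key _ (Ideal.subset_span (Or.inl (Or.inl ⟨i, l, m, rfl⟩)))
      rw [map_sub, sub_eq_zero] at this
      simp only [univCoord, chartMap_apply, this, Pi.single_apply,
        apply_ite (Ideal.Quotient.mkₐ F _),
        map_one, map_zero]
    · intro a b
      ext m
      have := key _ (Ideal.subset_span (Or.inl (Or.inr ⟨i, a, b, m, rfl⟩)))
      rw [map_sub, sub_eq_zero] at this
      simp only [univCoord, chartMap_apply, this, Finset.sum_apply, Pi.smul_apply, smul_eq_mul,
        map_sum, map_mul]
  · intro i j a
    ext m
    have := key _ (Ideal.subset_span (Or.inr ⟨i, j, a, m, rfl⟩))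
    rw [map_sub, sub_eq_zero] at this
    simp only [univCoord, chartMap_apply, this, Finset.sum_apply, Pi.smul_apply, smul_eq_mul,
      map_sum, map_mul]

section lift

variable {R : Type*} [CommRing R] [Algebra F R]

/-- The homomorphism from the polynomial ring classifying a family of linear maps. -/
noncomputable def coordLift (s : Finset ι) (π : s → A →ₗ[F] (Fin r → R)) :
    CoordPolynomial F A r s →ₐ[F] R :=
  MvPolynomial.aeval fun t => π t.1 (Module.finBasis F A t.2.1) t.2.2

lemma chartMap_coordLift (s : Finset ι) (π : s → A →ₗ[F] (Fin r → R)) (i : s) :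
    chartMap (coordLift s π) (genericCoord F A r s i) = π i := by
  refine (Module.finBasis F A).ext fun l => ?_
  ext m
  rw [chartMap_apply, genericCoord_basis]
  simp [coordLift]

lemma coordLift_genericCoord (s : Finset ι) (π : s → A →ₗ[F] (Fin r → R)) (i : s) (a : A)
    (m : Fin r) : coordLift s π (genericCoord F A r s i a m) = π i a m := by
  rw [← chartMap_apply, chartMap_coordLift]

/-- The homomorphism from the chart ring classifying a point in the intersection of charts. -/
noncomputable def chartLift {x : ι → Fin r → A} {s : Finset ι} {π : s → A →ₗ[F] (Fin r → R)}
    (h : IsMultiChartPoint x s π) : ChartRing F x s →ₐ[F] R :=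
  Ideal.Quotient.liftₐ _ (coordLift s π) fun p hp => by
    have : chartRelations F x s ≤ RingHom.ker (coordLift s π) := by
      rw [chartRelations, Ideal.span_le]
      rintro p ((⟨i, l, m, rfl⟩ | ⟨i, a, b, m, rfl⟩) | ⟨i, j, a, m, rfl⟩) <;>
      rw [SetLike.mem_coe, RingHom.mem_ker, map_sub, sub_eq_zero]
      · simp only [coordLift_genericCoord, (h.isChartPoint i).apply_self, Pi.single_apply,
          apply_ite (coordLift s π), map_one, map_zero]
      · simp only [coordLift_genericCoord, (h.isChartPoint i).apply_mul a b, Finset.sum_apply,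
          Pi.smul_apply, smul_eq_mul, map_sum, map_mul]
      · simp only [coordLift_genericCoord, h.apply_eq i j a, Finset.sum_apply,
          Pi.smul_apply, smul_eq_mul, map_sum, map_mul]
    exact this hp

lemma chartMap_chartLift {x : ι → Fin r → A} {s : Finset ι} {π : s → A →ₗ[F] (Fin r → R)}
    (h : IsMultiChartPoint x s π) (i : s) : chartMap (chartLift h) (univCoord F x s i) = π i := by
  ext a m
  exact coordLift_genericCoord s π i a m

lemma chartRing_hom_ext {x : ι → Fin r → A} {s : Finset ι} {f g : ChartRing F x s →ₐ[F] R}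
    (h : ∀ i, chartMap f (univCoord F x s i) = chartMap g (univCoord F x s i)) : f = g := by
  apply Ideal.Quotient.algHom_ext
  apply MvPolynomial.algHom_ext
  rintro ⟨i, l, m⟩
  have := congr($(h i) (Module.finBasis F A l) m)
  simp only [univCoord, chartMap_apply, genericCoord_basis] at this
  exact this

end lift

end ChartRing

section ChartRingPoints

/-- The coordinate maps of a point lying in several charts. -/
lemma GSBPoints.isMultiChartPoint_coord {F : Type u} [Field F] {A : Type v} [Ring A] [Algebra F A]
    {n k : ℕ} {ι : Type u} {x : ι → Fin (k * n) → A} {R : Type u} [CommRing R] [Algebra F R]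
    {s : Finset ι} {I : GSBPoints F A n k R}
    (h : ∀ i ∈ s, I.InChart (x i)) : IsMultiChartPoint x s fun i => (h i i.2).coord := by
  refine ⟨fun i => (h i i.2).isChartPoint, fun i j a => ?_⟩
  have h1 := (h i i.2).isChartPoint.sub_mem (1 ⊗ₜ a)
  rw [← (h i i.2).ideal_eq, (h j j.2).ideal_eq, mem_chartKer, map_sub, sub_eq_zero] at h1
  simpa [map_sum] using h1

variable {F : Type u} [Field F] {A : Type v} [Ring A] [Algebra F A] [FiniteDimensional F A]
  {n k : ℕ} {ι : Type u} (x : ι → Fin (k * n) → A)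

/-- The universal point in the intersection of the charts `x i`, `i ∈ s`. -/
noncomputable def univPoint (s : {s : Finset ι // s.Nonempty}) :
    GSBPoints F A n k (ChartRing F x s.1) :=
  ((isMultiChartPoint_univCoord x s.1).isChartPoint ⟨_, s.2.choose_spec⟩).toPoint

lemma toPoint_univCoord (s : {s : Finset ι // s.Nonempty}) (i : s.1) :
    ((isMultiChartPoint_univCoord x s.1).isChartPoint i).toPoint = univPoint (F := F) x s := by
  ext1
  exact le_antisymm ((isMultiChartPoint_univCoord x s.1).chartKer_le _ _)
    ((isMultiChartPoint_univCoord x s.1).chartKer_le _ _)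

lemma univPoint_inChart (s : {s : Finset ι // s.Nonempty}) {i : ι} (hi : i ∈ s.1) :
    (univPoint (F := F) x s).InChart (x i) :=
  ⟨_, _, toPoint_univCoord x s ⟨i, hi⟩⟩

variable {x} {R : Type u} [CommRing R] [Algebra F R]

/-- Every point lying in all the charts `x i`, `i ∈ s`, is the image of the universal point under a
unique homomorphism. -/
lemma univPoint_map_eq_iff (s : {s : Finset ι // s.Nonempty}) {I : GSBPoints F A n k R}
    (h : ∀ i ∈ s.1, I.InChart (x i)) (f : ChartRing F x s.1 →ₐ[F] R) :
    (univPoint x s).map f = I ↔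
      f = chartLift (GSBPoints.isMultiChartPoint_coord h) := by
  have key : ∀ g : ChartRing F x s.1 →ₐ[F] R, (univPoint x s).map g = I →
      ∀ i : s.1, chartMap g (univCoord F x s.1 i) = (h i i.2).coord := by
    intro g hg i
    refine ((h i i.2).coord_eq
      (((isMultiChartPoint_univCoord x s.1).isChartPoint i).map g) ?_).symm
    exact (((isMultiChartPoint_univCoord x s.1).isChartPoint i).toPoint_map g).symm.trans
      (by rw [toPoint_univCoord, hg])
  constructor
  · intro hf
    refine chartRing_hom_ext fun i => ?_
    rw [key f hf, chartMap_chartLift]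
  · rintro rfl
    obtain ⟨i, hi⟩ := s.2
    rw [← toPoint_univCoord x s ⟨i, hi⟩, IsChartPoint.toPoint_map]
    refine Eq.trans ?_ (h i hi).toPoint_eq
    ext1
    rw [IsChartPoint.toPoint_ideal, IsChartPoint.toPoint_ideal, chartMap_chartLift]

/-- The chart ring classifies the points lying in all the given charts. -/
noncomputable def classify (s : {s : Finset ι // s.Nonempty}) {I : GSBPoints F A n k R}
    (h : ∀ i ∈ s.1, I.InChart (x i)) : ChartRing F x s.1 →ₐ[F] R :=
  chartLift (GSBPoints.isMultiChartPoint_coord h)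

lemma univPoint_map_classify (s : {s : Finset ι // s.Nonempty}) {I : GSBPoints F A n k R}
    (h : ∀ i ∈ s.1, I.InChart (x i)) : (univPoint x s).map (classify s h) = I :=
  (univPoint_map_eq_iff s h _).2 rfl

lemma univPoint_map_injective (s : {s : Finset ι // s.Nonempty})
    {f g : ChartRing F x s.1 →ₐ[F] R} (h : (univPoint x s).map f = (univPoint x s).map g) :
    f = g := by
  have h' : ∀ i ∈ s.1, ((univPoint x s).map g).InChart (x i) :=
    fun i hi => (univPoint_inChart x s hi).map g
  exact ((univPoint_map_eq_iff s h' f).1 h).trans ((univPoint_map_eq_iff s h' g).1 rfl).symm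

end ChartRingPoints

/-! ### Gluing the charts -/

section GluedScheme

variable {F : Type u} [Field F] {A : Type v} [Ring A] [Algebra F A] [FiniteDimensional F A]
  {n k : ℕ} {ι : Type u} (x : ι → Fin (k * n) → A)

/-- The restriction homomorphism from an intersection of charts to a smaller one. -/
noncomputable def chartRestrict {s t : {s : Finset ι // s.Nonempty}} (h : s ≤ t) :
    ChartRing F x s.1 →ₐ[F] ChartRing F x t.1 :=
  classify s fun _ hi => univPoint_inChart x t (h hi)

lemma univPoint_map_chartRestrict {s t : {s : Finset ι // s.Nonempty}} (h : s ≤ t) :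
    (univPoint (F := F) x s).map (chartRestrict x h) = univPoint x t :=
  univPoint_map_classify s _

lemma chartRestrict_refl (s : {s : Finset ι // s.Nonempty}) :
    chartRestrict (F := F) x (le_refl s) = AlgHom.id F _ :=
  univPoint_map_injective s (by rw [univPoint_map_chartRestrict, GSBPoints.map_id])

lemma chartRestrict_trans {s t r : {s : Finset ι // s.Nonempty}} (h : s ≤ t) (h' : t ≤ r) :
    (chartRestrict (F := F) x h').comp (chartRestrict x h) = chartRestrict x (h.trans h') :=
  univPoint_map_injective s (by
    rw [GSBPoints.map_comp, univPoint_map_chartRestrict, univPoint_map_chartRestrict,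
      univPoint_map_chartRestrict])

/-- The product of the transition determinants whose non-vanishing cuts out the intersection of
the charts in `t` inside the intersection of the charts in `s`. -/
noncomputable def chartEquation (s t : {s : Finset ι // s.Nonempty}) : ChartRing F x s.1 :=
  ∏ i ∈ t.1, ((univPoint_inChart x s s.2.choose_spec).transition (x i)).det

lemma isUnit_chartEquation_iff {R : Type u} [CommRing R] [Algebra F R]
    (s t : {s : Finset ι // s.Nonempty}) (f : ChartRing F x s.1 →ₐ[F] R) :
    IsUnit (f (chartEquation x s t)) ↔ ∀ i ∈ t.1, ((univPoint x s).map f).InChart (x i) := by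
  rw [chartEquation, map_prod, IsUnit.prod_iff]
  refine forall₂_congr fun i _ => ?_
  rw [← GSBPoints.InChart.transition_map, GSBPoints.InChart.inChart_iff
    ((univPoint_inChart x s s.2.choose_spec).map f)]

/-- The homomorphism of chart rings `O_s → O_t` for `s ⊆ t` is a localization. -/
lemma isLocalization_chartRestrict {s t : {s : Finset ι // s.Nonempty}} (h : s ≤ t) :
    letI := (chartRestrict (F := F) x h).toRingHom.toAlgebra
    IsLocalization.Away (chartEquation (F := F) x s t) (ChartRing F x t.1) := by
  let := (chartRestrict (F := F) x h).toRingHom.toAlgebra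
  let d := chartEquation (F := F) x s t
  have hu : IsUnit (chartRestrict (F := F) x h d) := by
    rw [isUnit_chartEquation_iff, univPoint_map_chartRestrict]
    exact fun i hi => univPoint_inChart x t hi
  have hin : ∀ i ∈ t.1, ((univPoint x s).map (awayHom F d)).InChart (x i) := by
    rw [← isUnit_chartEquation_iff]
    exact IsLocalization.Away.algebraMap_isUnit d
  -- The localization of `O_s` and the ring `O_t` represent the same functor.
  let f : Localization.Away d →ₐ[F] ChartRing F x t.1 := awayLift d (chartRestrict x h) hu
  let g : ChartRing F x t.1 →ₐ[F] Localization.Away d := classify t hin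
  have hf : f.comp (awayHom F d) = chartRestrict x h := awayLift_comp _ _ _
  have hg : g.comp (chartRestrict x h) = awayHom F d := univPoint_map_injective s (by
    rw [GSBPoints.map_comp, univPoint_map_chartRestrict, univPoint_map_classify])
  have hfg : f.comp g = AlgHom.id F _ := univPoint_map_injective t (by
    rw [GSBPoints.map_comp, univPoint_map_classify, ← GSBPoints.map_comp, hf,
      univPoint_map_chartRestrict, GSBPoints.map_id])
  have hgf : g.comp f = AlgHom.id F _ := away_algHom_ext d (by
    rw [AlgHom.comp_assoc, hf, hg, AlgHom.id_comp])
  let e : Localization.Away d ≃ₐ[ChartRing F x s.1] ChartRing F x t.1 :=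
    AlgEquiv.ofRingEquiv (f := RingEquiv.ofRingHom f.toRingHom g.toRingHom
      (RingHom.ext fun z => congr($hfg z)) (RingHom.ext fun z => congr($hgf z)))
      (fun z => congr($hf z))
  exact IsLocalization.isLocalization_of_algEquiv _ e

lemma isOpenImmersion_chartRestrict {s t : {s : Finset ι // s.Nonempty}} (h : s ≤ t) :
    IsOpenImmersion (Spec.map (CommRingCat.ofHom (chartRestrict (F := F) x h).toRingHom)) := by
  let := (chartRestrict (F := F) x h).toRingHom.toAlgebra
  have := isLocalization_chartRestrict (F := F) x h
  exact IsOpenImmersion.of_isLocalization (S := ChartRing F x t.1) (chartEquation (F := F) x s t)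

lemma range_chartRestrict {s t : {s : Finset ι // s.Nonempty}} (h : s ≤ t) :
    Set.range (Spec.map (CommRingCat.ofHom (chartRestrict (F := F) x h).toRingHom)) =
      ((PrimeSpectrum.basicOpen (chartEquation (F := F) x s t) :
        TopologicalSpace.Opens (PrimeSpectrum (ChartRing F x s.1))) :
        Set (PrimeSpectrum (ChartRing F x s.1))) := by
  let := (chartRestrict (F := F) x h).toRingHom.toAlgebra
  have := isLocalization_chartRestrict (F := F) x h
  exact PrimeSpectrum.localization_away_comap_range (ChartRing F x t.1) _

/-- The diagram of all the finite intersections of charts, with their inclusions. Its index set is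
ordered by reversed inclusion of sets of charts. -/
noncomputable def chartDiagram (F : Type u) [Field F] {A : Type v} [Ring A] [Algebra F A]
    [FiniteDimensional F A] {n k : ℕ} {ι : Type u} (x : ι → Fin (k * n) → A) :
    {s : Finset ι // s.Nonempty}ᵒᵈ ⥤ Scheme.{u} where
  obj s := Spec (.of (ChartRing F x (OrderDual.ofDual s).1))
  map {s t} h := Spec.map (CommRingCat.ofHom
    (chartRestrict (F := F) x (OrderDual.ofDual_le_ofDual.2 h.le)).toRingHom)
  map_id s := by
    rw [chartRestrict_refl]
    exact Spec.map_id _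
  map_comp {s t r} h h' := by
    rw [← Spec.map_comp, ← CommRingCat.ofHom_comp]
    congr 2
    rw [← chartRestrict_trans x (OrderDual.ofDual_le_ofDual.2 h'.le)
      (OrderDual.ofDual_le_ofDual.2 h.le)]
    rfl

instance {s t : {s : Finset ι // s.Nonempty}ᵒᵈ} (f : s ⟶ t) :
    IsOpenImmersion ((chartDiagram F x).map f) :=
  isOpenImmersion_chartRestrict x _

/-- The union of two nonempty finite sets of charts. -/
def chartUnion [DecidableEq ι] (t t' : {s : Finset ι // s.Nonempty}) :
    {s : Finset ι // s.Nonempty} :=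
  ⟨t.1 ∪ t'.1, t.2.inl⟩

lemma mem_basicOpen_chartEquation_union [DecidableEq ι] (s t t' : {s : Finset ι // s.Nonempty})
    (p : PrimeSpectrum (ChartRing F x s.1)) (h : p ∈ PrimeSpectrum.basicOpen (chartEquation x s t))
    (h' : p ∈ PrimeSpectrum.basicOpen (chartEquation x s t')) :
    p ∈ PrimeSpectrum.basicOpen (chartEquation x s (chartUnion t t')) := by
  rw [PrimeSpectrum.mem_basicOpen] at *
  intro hmem
  rw [chartEquation, Ideal.IsPrime.prod_mem_iff] at hmem
  obtain ⟨i, hi, him⟩ := hmem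
  rcases Finset.mem_union.1 (show i ∈ t.1 ∪ t'.1 from hi) with hi | hi
  · exact h (Ideal.IsPrime.prod_mem_iff.2 ⟨i, hi, him⟩)
  · exact h' (Ideal.IsPrime.prod_mem_iff.2 ⟨i, hi, him⟩)

instance : (chartDiagram F x ⋙ Scheme.forget).IsLocallyDirected where
  cond {i j l} fi fj xi xj e := by
    classical
    have e' : (chartDiagram F x).map fi xi = (chartDiagram F x).map fj xj := e
    -- A point common to two intersections of charts lies in the intersection of all these charts.
    let m : {s : Finset ι // s.Nonempty}ᵒᵈ := OrderDual.toDual (chartUnion (i.ofDual) (j.ofDual))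
    let fmi : m ⟶ i := homOfLE (show i.ofDual.1 ⊆ (chartUnion i.ofDual j.ofDual).1 from
      Finset.subset_union_left)
    let fmj : m ⟶ j := homOfLE (show j.ofDual.1 ⊆ (chartUnion i.ofDual j.ofDual).1 from
      Finset.subset_union_right)
    have h1 : (chartDiagram F x).map fi xi ∈ Set.range ((chartDiagram F x).map (fmi ≫ fi)) := by
      refine (range_chartRestrict (F := F) x
        (OrderDual.ofDual_le_ofDual.2 (fmi ≫ fi).le)).ge ?_
      refine mem_basicOpen_chartEquation_union x _ _ _ _ ?_ ?_
      · exact (range_chartRestrict (F := F) x (OrderDual.ofDual_le_ofDual.2 fi.le)).le ⟨xi, rfl⟩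
      · rw [e']
        exact (range_chartRestrict (F := F) x (OrderDual.ofDual_le_ofDual.2 fj.le)).le ⟨xj, rfl⟩
    obtain ⟨z, hz⟩ := h1
    refine ⟨m, fmi, fmj, z, ?_, ?_⟩
    · apply ((chartDiagram F x).map fi).isOpenEmbedding.injective
      rw [← hz, Functor.map_comp]
      rfl
    · apply ((chartDiagram F x).map fj).isOpenEmbedding.injective
      rw [← e', ← hz, Subsingleton.elim (fmi ≫ fi) (fmj ≫ fj), Functor.map_comp]
      rfl

open Limits

/-- The scheme obtained by gluing the charts. -/
noncomputable def gluedScheme (F : Type u) [Field F] {A : Type v} [Ring A] [Algebra F A]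
    [FiniteDimensional F A] {n k : ℕ} {ι : Type u} (x : ι → Fin (k * n) → A) : Scheme.{u} :=
  colimit (chartDiagram F x)

/-- The inclusion of an intersection of charts. -/
noncomputable def chartι (s : {s : Finset ι // s.Nonempty}) :
    Spec (.of (ChartRing F x s.1)) ⟶ gluedScheme F x :=
  colimit.ι (chartDiagram F x) (OrderDual.toDual s)

instance (s : {s : Finset ι // s.Nonempty}) : IsOpenImmersion (chartι (F := F) x s) :=
  inferInstanceAs (IsOpenImmersion (colimit.ι (chartDiagram F x) (OrderDual.toDual s)))

lemma chartRestrict_chartι {s t : {s : Finset ι // s.Nonempty}} (h : s ≤ t) :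
    Spec.map (CommRingCat.ofHom (chartRestrict (F := F) x h).toRingHom) ≫ chartι x s =
      chartι x t :=
  colimit.w (chartDiagram F x)
    (homOfLE (OrderDual.toDual_le_toDual.2 h) : OrderDual.toDual t ⟶ OrderDual.toDual s)

lemma exists_chartι_eq (z : gluedScheme F x) : ∃ s y, chartι (F := F) x s y = z := by
  obtain ⟨s, y, h⟩ := Scheme.IsLocallyDirected.ι_jointly_surjective (chartDiagram F x) z
  exact ⟨OrderDual.ofDual s, y, h⟩

/-- Two charts meet in the glued scheme only along their intersection. -/
lemma chartι_eq_iff {s t : {s : Finset ι // s.Nonempty}} {y : Spec (.of (ChartRing F x s.1))}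
    {z : Spec (.of (ChartRing F x t.1))} (h : chartι x s y = chartι x t z) :
    ∃ (r : {s : Finset ι // s.Nonempty}) (_ : s ≤ r) (_ : t ≤ r) (c : _),
      chartι (F := F) x r c = chartι x s y := by
  obtain ⟨r, fs, ft, c, h1, h2⟩ := (Scheme.IsLocallyDirected.ι_eq_ι_iff (chartDiagram F x)).1 h
  refine ⟨OrderDual.ofDual r, OrderDual.ofDual_le_ofDual.2 fs.le,
    OrderDual.ofDual_le_ofDual.2 ft.le, c, ?_⟩
  rw [← h1, ← chartRestrict_chartι x (OrderDual.ofDual_le_ofDual.2 fs.le)]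
  rfl

/-- The structure morphism of the glued scheme. -/
noncomputable def gluedStructure (F : Type u) [Field F] {A : Type v} [Ring A] [Algebra F A]
    [FiniteDimensional F A] {n k : ℕ} {ι : Type u} (x : ι → Fin (k * n) → A) :
    gluedScheme F x ⟶ Spec (.of F) :=
  colimit.desc (chartDiagram F x)
    { pt := Spec (.of F)
      ι := { app := fun s => Spec.map (CommRingCat.ofHom
               (algebraMap F (ChartRing F x (OrderDual.ofDual s).1)))
             naturality := fun s t f => by
              change Spec.map _ ≫ Spec.map _ = _ ≫ 𝟙 _
              rw [Category.comp_id, ← Spec.map_comp, ← CommRingCat.ofHom_comp]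
              congr 2
              exact (chartRestrict (F := F) x (OrderDual.ofDual_le_ofDual.2 f.le)).comp_algebraMap } }

lemma chartι_structure (s : {s : Finset ι // s.Nonempty}) :
    chartι x s ≫ gluedStructure F x =
      Spec.map (CommRingCat.ofHom (algebraMap F (ChartRing F x s.1))) :=
  colimit.ι_desc _ _

end GluedScheme

/-! ### The glued scheme represents the functor -/

section SchemePointsSheaf

open Limits

variable {F : Type u} [Field F] {X : Scheme.{u}} {sX : X ⟶ Spec (.of F)}
  {R : Type u} [CommRing R] [Algebra F R]

namespace SchemePoints

@[ext]
lemma ext {x y : SchemePoints sX R} (h : x.1 = y.1) : x = y := Subtype.ext h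

lemma map_comp {S T : Type u} [CommRing S] [Algebra F S] [CommRing T] [Algebra F T] (f : R →ₐ[F] S)
    (g : S →ₐ[F] T) (x : SchemePoints sX R) : x.map (g.comp f) = (x.map f).map g := by
  ext1
  change Spec.map (CommRingCat.ofHom ((g : S →+* T).comp (f : R →+* S))) ≫ x.1 = _
  rw [CommRingCat.ofHom_comp, Spec.map_comp, Category.assoc]
  rfl

/-- Morphisms from an affine scheme that agree on a Zariski covering are equal. -/
lemma eq_of_locally_eq {x y : SchemePoints sX R}
    (h : ∀ p : PrimeSpectrum R, ∃ a ∉ p.asIdeal, x.map (awayHom F a) = y.map (awayHom F a)) :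
    x = y := by
  obtain ⟨t, ht, hQ⟩ := exists_finset_span_eq_top h
  ext1
  refine Scheme.Cover.hom_ext (Scheme.affineOpenCoverOfSpanRangeEqTop (R := .of R)
    (fun a : t => a.1) (by simpa using ht)).openCover _ _ fun a => ?_
  exact congrArg Subtype.val (hQ a.1 a.2)

/-- Compatible morphisms on a Zariski covering of an affine scheme glue. -/
lemma exists_glue (t : Finset R) (ht : Ideal.span (t : Set R) = ⊤)
    (x : ∀ a : t, SchemePoints sX (Localization.Away a.1))
    (hx : ∀ (a b : t) (S : Type u) [CommRing S] [Algebra F S]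
      (g : Localization.Away a.1 →ₐ[F] S) (h : Localization.Away b.1 →ₐ[F] S),
      g.comp (awayHom F a.1) = h.comp (awayHom F b.1) → (x a).map g = (x b).map h) :
    ∃ y : SchemePoints sX R, ∀ a : t, y.map (awayHom F a.1) = x a := by
  let 𝒰 := (Scheme.affineOpenCoverOfSpanRangeEqTop (R := .of R)
    (fun a : t => a.1) (by simpa using ht)).openCover
  have hc : ∀ a b : t, pullback.fst (𝒰.f a) (𝒰.f b) ≫ (x a).1 =
      pullback.snd (𝒰.f a) (𝒰.f b) ≫ (x b).1 := by
    intro a b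
    let g := (Algebra.TensorProduct.includeLeft (R := R) (S := R) (A := Localization.Away a.1)
      (B := Localization.Away b.1)).restrictScalars F
    let h := (Algebra.TensorProduct.includeRight (R := R) (A := Localization.Away a.1)
      (B := Localization.Away b.1)).restrictScalars F
    have e := congrArg Subtype.val (hx a b _ g h (by
      ext r
      exact (AlgHom.commutes (Algebra.TensorProduct.includeLeft (R := R) (S := R)
        (A := Localization.Away a.1) (B := Localization.Away b.1)) r).trans
        (AlgHom.commutes (Algebra.TensorProduct.includeRight (R := R)
        (A := Localization.Away a.1) (B := Localization.Away b.1)) r).symm))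
    refine (cancel_epi (pullbackSpecIso R (Localization.Away a.1) (Localization.Away b.1)).inv).1 ?_
    have h1 := pullbackSpecIso_inv_fst R (Localization.Away a.1) (Localization.Away b.1)
    have h2 := pullbackSpecIso_inv_snd R (Localization.Away a.1) (Localization.Away b.1)
    refine ((Category.assoc _ _ _).symm.trans (congrArg (· ≫ (x a).1) h1)).trans (Eq.trans e
      ((Category.assoc _ _ _).symm.trans (congrArg (· ≫ (x b).1) h2)).symm)
  refine ⟨⟨𝒰.glueMorphisms (fun a => (x a).1) hc, ?_⟩, fun a => ?_⟩
  · refine Scheme.Cover.hom_ext 𝒰 _ _ fun a => ?_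
    refine ((Category.assoc _ _ _).symm.trans
      (congrArg (· ≫ sX) (Scheme.Cover.ι_glueMorphisms 𝒰 _ hc a))).trans ((x a).2.trans ?_)
    change _ = Spec.map (CommRingCat.ofHom _) ≫ _
    rw [← Spec.map_comp, ← CommRingCat.ofHom_comp]
  · ext1
    exact Scheme.Cover.ι_glueMorphisms 𝒰 _ hc a

end SchemePoints

end SchemePointsSheaf

section Representability

variable {F : Type u} [Field F] {A : Type v} [Ring A] [Algebra F A] [FiniteDimensional F A]
  {n k : ℕ} {ι : Type u} (x : ι → Fin (k * n) → A) {R : Type u} [CommRing R] [Algebra F R]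
  {S : Type u} [CommRing S] [Algebra F S]

/-- The point of the glued scheme given by a point of a chart. -/
noncomputable def chartSchemePoint (s : {s : Finset ι // s.Nonempty})
    (f : ChartRing F x s.1 →ₐ[F] R) : SchemePoints (gluedStructure F x) R :=
  ⟨Spec.map (CommRingCat.ofHom (f : _ →+* R)) ≫ chartι x s, by
    rw [Category.assoc, chartι_structure, ← Spec.map_comp, ← CommRingCat.ofHom_comp,
      AlgHom.comp_algebraMap]⟩

lemma chartSchemePoint_map (s : {s : Finset ι // s.Nonempty})
    (f : ChartRing F x s.1 →ₐ[F] R) (g : R →ₐ[F] S) :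
    (chartSchemePoint x s f).map g = chartSchemePoint x s (g.comp f) := by
  ext1
  change Spec.map _ ≫ Spec.map _ ≫ _ = Spec.map _ ≫ _
  rw [← Category.assoc, ← Spec.map_comp]
  rfl

lemma chartSchemePoint_restrict {s t : {s : Finset ι // s.Nonempty}} (h : s ≤ t)
    (f : ChartRing F x t.1 →ₐ[F] R) :
    chartSchemePoint x s (f.comp (chartRestrict x h)) = chartSchemePoint x t f := by
  have e : Spec.map (CommRingCat.ofHom (f.comp (chartRestrict x h)).toRingHom) =
      Spec.map (CommRingCat.ofHom f.toRingHom) ≫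
        Spec.map (CommRingCat.ofHom (chartRestrict (F := F) x h).toRingHom) := by
    rw [← Spec.map_comp, ← CommRingCat.ofHom_comp]
    rfl
  exact SchemePoints.ext ((congrArg (· ≫ chartι x s) e).trans ((Category.assoc _ _ _).trans
    (congrArg (Spec.map (CommRingCat.ofHom f.toRingHom) ≫ ·) (chartRestrict_chartι x h))))

lemma chartSchemePoint_injective (s : {s : Finset ι // s.Nonempty})
    {f g : ChartRing F x s.1 →ₐ[F] R} (h : chartSchemePoint x s f = chartSchemePoint x s g) :
    f = g := by
  have h1 := congrArg Subtype.val h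
  have h2 := congrArg CommRingCat.Hom.hom (Spec.map_injective ((cancel_mono (chartι x s)).1 h1))
  exact AlgHom.ext fun y => congr($h2 y)

/-- A morphism over `F` to the glued scheme whose image lies in a chart is a point of the chart. -/
lemma exists_eq_chartSchemePoint (s : {s : Finset ι // s.Nonempty})
    (z : SchemePoints (gluedStructure F x) R)
    (h : Set.range z.1 ⊆ Set.range (chartι (F := F) x s)) :
    ∃ f, z = chartSchemePoint x s f := by
  let l := IsOpenImmersion.lift (chartι x s) z.1 h
  have hl : l ≫ chartι x s = z.1 := IsOpenImmersion.lift_fac _ _ _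
  let f := (Spec.preimage l).hom
  have hf : Spec.map (CommRingCat.ofHom f) = l := Spec.map_preimage l
  have hc : f.comp (algebraMap F (ChartRing F x s.1)) = algebraMap F R := by
    have h1 := z.2
    rw [← hl, Category.assoc, chartι_structure, ← hf, ← Spec.map_comp,
      ← CommRingCat.ofHom_comp] at h1
    exact congrArg CommRingCat.Hom.hom (Spec.map_injective h1)
  refine ⟨{ f with commutes' := fun c => congr($hc c) }, ?_⟩
  ext1
  rw [← hl, ← hf]
  rfl

/-- A point of the glued scheme and a point of the functor `GSBPoints` match in a chart if they
are given by the same point of the chart. -/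
def MatchInChart (z : SchemePoints (gluedStructure F x) R) (I : GSBPoints F A n k R) : Prop :=
  ∃ s f, z = chartSchemePoint x s f ∧ I = (univPoint x s).map f

variable {x} in
lemma MatchInChart.map {z : SchemePoints (gluedStructure F x) R} {I : GSBPoints F A n k R}
    (h : MatchInChart x z I) (g : R →ₐ[F] S) : MatchInChart x (z.map g) (I.map g) := by
  obtain ⟨s, f, rfl, rfl⟩ := h
  exact ⟨s, g.comp f, chartSchemePoint_map .., (GSBPoints.map_comp ..).symm⟩

variable {x} in
/-- A point `I` lying in two charts lies in their intersection, so both charts yield the same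
morphism to the glued scheme. -/
lemma MatchInChart.left_unique {z z' : SchemePoints (gluedStructure F x) R}
    {I : GSBPoints F A n k R} (h : MatchInChart x z I) (h' : MatchInChart x z' I) : z = z' := by
  classical
  obtain ⟨s, f, rfl, hf⟩ := h
  obtain ⟨t, g, rfl, hg⟩ := h'
  have hin : ∀ i ∈ (chartUnion s t).1, I.InChart (x i) := by
    intro i hi
    rcases Finset.mem_union.1 hi with hi | hi
    · exact hf ▸ (univPoint_inChart x s hi).map f
    · exact hg ▸ (univPoint_inChart x t hi).map g
  let e := classify (chartUnion s t) hin
  have h1 : s ≤ chartUnion s t := show s.1 ⊆ (chartUnion s t).1 from Finset.subset_union_left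
  have h2 : t ≤ chartUnion s t := show t.1 ⊆ (chartUnion s t).1 from Finset.subset_union_right
  have h1' : f = e.comp (chartRestrict x h1) := univPoint_map_injective s (by
    rw [← hf, GSBPoints.map_comp, univPoint_map_chartRestrict, univPoint_map_classify])
  have h2' : g = e.comp (chartRestrict x h2) := univPoint_map_injective t (by
    rw [← hg, GSBPoints.map_comp, univPoint_map_chartRestrict, univPoint_map_classify])
  rw [h1', h2', chartSchemePoint_restrict, chartSchemePoint_restrict]

variable {x} in
/-- A morphism with image in two charts has its image in their intersection, because the charts of
the glued scheme meet only there; so both charts yield the same left ideal. -/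
lemma MatchInChart.right_unique {z : SchemePoints (gluedStructure F x) R}
    {I J : GSBPoints F A n k R} (h : MatchInChart x z I) (h' : MatchInChart x z J) : I = J := by
  classical
  obtain ⟨s, f, hf, rfl⟩ := h
  obtain ⟨t, g, hg, rfl⟩ := h'
  have h1 : s ≤ chartUnion s t := show s.1 ⊆ (chartUnion s t).1 from Finset.subset_union_left
  have h2 : t ≤ chartUnion s t := show t.1 ⊆ (chartUnion s t).1 from Finset.subset_union_right
  have hr : Set.range z.1 ⊆ Set.range (chartι (F := F) x (chartUnion s t)) := by
    rintro _ ⟨p, rfl⟩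
    have e1 : z.1 p = chartι x s (Spec.map (CommRingCat.ofHom (f : _ →+* R)) p) := by
      rw [hf]; rfl
    have e2 : z.1 p = chartι x t (Spec.map (CommRingCat.ofHom (g : _ →+* R)) p) := by
      rw [hg]; rfl
    obtain ⟨r, hs, ht, c, hc⟩ := chartι_eq_iff x (e1.symm.trans e2)
    have hle : chartUnion s t ≤ r :=
      show (chartUnion s t).1 ⊆ r.1 from Finset.union_subset hs ht
    refine ⟨Spec.map (CommRingCat.ofHom (chartRestrict (F := F) x hle).toRingHom) c, ?_⟩
    rw [e1, ← hc, ← chartRestrict_chartι x hle]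
    rfl
  obtain ⟨e, he⟩ := exists_eq_chartSchemePoint x _ z hr
  have h1' : f = e.comp (chartRestrict x h1) := chartSchemePoint_injective x s (by
    rw [← hf, he, chartSchemePoint_restrict])
  have h2' : g = e.comp (chartRestrict x h2) := chartSchemePoint_injective x t (by
    rw [← hg, he, chartSchemePoint_restrict])
  rw [h1', h2', GSBPoints.map_comp, GSBPoints.map_comp, univPoint_map_chartRestrict,
    univPoint_map_chartRestrict]

/-- A point of the glued scheme and a point of the functor `GSBPoints` match if they do so
Zariski locally. -/
def LocallyMatch (z : SchemePoints (gluedStructure F x) R) (I : GSBPoints F A n k R) : Prop :=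
  ∀ p : PrimeSpectrum R, ∃ a ∉ p.asIdeal,
    MatchInChart x (z.map (awayHom F a)) (I.map (awayHom F a))

/-- The two localizations `R_a` and `R_b` map to `R_ab`. -/
lemma exists_away_mul (a b : R) :
    ∃ (f : Localization.Away a →ₐ[F] Localization.Away (a * b))
      (g : Localization.Away b →ₐ[F] Localization.Away (a * b)),
      f.comp (awayHom F a) = awayHom F (a * b) ∧ g.comp (awayHom F b) = awayHom F (a * b) := by
  have h : IsUnit (awayHom F (a * b) (a * b)) := IsLocalization.Away.algebraMap_isUnit (a * b)
  rw [map_mul, IsUnit.mul_iff] at h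
  exact ⟨awayLift a _ h.1, awayLift b _ h.2, awayLift_comp .., awayLift_comp ..⟩

variable {x}

lemma LocallyMatch.map {z : SchemePoints (gluedStructure F x) R} {I : GSBPoints F A n k R}
    (h : LocallyMatch x z I) (g : R →ₐ[F] S) : LocallyMatch x (z.map g) (I.map g) := by
  intro p
  obtain ⟨a, ha, hm⟩ := h (PrimeSpectrum.comap (g : R →+* S) p)
  refine ⟨g a, ha, ?_⟩
  have hu : IsUnit (((awayHom F (g a)).comp g) a) := IsLocalization.Away.algebraMap_isUnit (g a)
  have := hm.map (awayLift a ((awayHom F (g a)).comp g) hu)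
  rwa [← SchemePoints.map_comp, ← GSBPoints.map_comp, awayLift_comp, SchemePoints.map_comp,
    GSBPoints.map_comp] at this

lemma LocallyMatch.left_unique {z z' : SchemePoints (gluedStructure F x) R}
    {I : GSBPoints F A n k R} (h : LocallyMatch x z I) (h' : LocallyMatch x z' I) : z = z' := by
  refine SchemePoints.eq_of_locally_eq fun p => ?_
  obtain ⟨a, ha, hm⟩ := h p
  obtain ⟨b, hb, hm'⟩ := h' p
  obtain ⟨f, g, hf, hg⟩ := exists_away_mul (F := F) a b
  refine ⟨a * b, fun hab => (p.2.mem_or_mem hab).elim ha hb, ?_⟩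
  have h1 := hm.map f
  have h2 := hm'.map g
  rw [← SchemePoints.map_comp, ← GSBPoints.map_comp, hf] at h1
  rw [← SchemePoints.map_comp, ← GSBPoints.map_comp, hg] at h2
  exact h1.left_unique h2

lemma LocallyMatch.right_unique {z : SchemePoints (gluedStructure F x) R}
    {I J : GSBPoints F A n k R} (h : LocallyMatch x z I) (h' : LocallyMatch x z J) : I = J := by
  refine GSBPoints.eq_of_locally_eq fun p => ?_
  obtain ⟨a, ha, hm⟩ := h p
  obtain ⟨b, hb, hm'⟩ := h' p
  obtain ⟨f, g, hf, hg⟩ := exists_away_mul (F := F) a b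
  refine ⟨a * b, fun hab => (p.2.mem_or_mem hab).elim ha hb, ?_⟩
  have h1 := hm.map f
  have h2 := hm'.map g
  rw [← SchemePoints.map_comp, ← GSBPoints.map_comp, hf] at h1
  rw [← SchemePoints.map_comp, ← GSBPoints.map_comp, hg] at h2
  exact h1.right_unique h2

/-- Every left ideal is given by a morphism to the glued scheme, since it lies locally in a chart.
-/
lemma exists_locallyMatch_left (hx : Function.Surjective x) (I : GSBPoints F A n k R) :
    ∃ z, LocallyMatch x z I := by
  have h : ∀ p : PrimeSpectrum R, ∃ a ∉ p.asIdeal, ∃ z, MatchInChart x z (I.map (awayHom F a)) := by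
    intro p
    obtain ⟨a, ha, y, hy⟩ := I.exists_inChart p
    obtain ⟨i, rfl⟩ := hx y
    have hi : ∀ j ∈ ({i} : Finset ι), (I.map (awayHom F a)).InChart (x j) := by
      intro j hj
      rwa [Finset.mem_singleton.1 hj]
    let s : {s : Finset ι // s.Nonempty} := ⟨{i}, Finset.singleton_nonempty i⟩
    exact ⟨a, ha, chartSchemePoint x s (classify s hi), s, classify s hi, rfl,
      (univPoint_map_classify s hi).symm⟩
  obtain ⟨t, ht, hQ⟩ := exists_finset_span_eq_top h
  choose z hz using fun a : t => hQ a.1 a.2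
  obtain ⟨y, hy⟩ := SchemePoints.exists_glue t ht z fun a b S _ _ g h e => by
    have h1 := (hz a).map g
    have h2 := (hz b).map h
    rw [← GSBPoints.map_comp, e] at h1
    rw [← GSBPoints.map_comp] at h2
    exact h1.left_unique h2
  refine ⟨y, fun p => ?_⟩
  obtain ⟨a, ha, hp⟩ := exists_prime_notMem_of_span_eq_top ht p
  exact ⟨a, hp, (hy ⟨a, ha⟩).symm ▸ hz ⟨a, ha⟩⟩

/-- Every morphism to the glued scheme gives a left ideal, since its image lies locally in a chart.
-/
lemma exists_locallyMatch_right (z : SchemePoints (gluedStructure F x) R) :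
    ∃ I, LocallyMatch x z I := by
  have h : ∀ p : PrimeSpectrum R, ∃ a ∉ p.asIdeal, ∃ I, MatchInChart x (z.map (awayHom F a)) I := by
    intro p
    obtain ⟨s, y, hy⟩ := exists_chartι_eq x (z.1 p)
    obtain ⟨_, ⟨a, rfl⟩, hpa, hle⟩ := (PrimeSpectrum.isTopologicalBasis_basic_opens
      (R := R)).exists_subset_of_mem_open (show p ∈ z.1 ⁻¹' Set.range (chartι x s) from ⟨y, hy⟩)
      ((chartι x s).isOpenEmbedding.isOpen_range.preimage z.1.continuous)
    refine ⟨a, hpa, ?_⟩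
    obtain ⟨f, hf⟩ := exists_eq_chartSchemePoint x s (z.map (awayHom F a)) (by
      rintro _ ⟨q, rfl⟩
      have hq : PrimeSpectrum.comap (algebraMap R (Localization.Away a)) q ∈
          (PrimeSpectrum.basicOpen a : Set (PrimeSpectrum R)) :=
        (PrimeSpectrum.localization_away_comap_range (Localization.Away a) a).le ⟨q, rfl⟩
      exact hle hq)
    exact ⟨_, s, f, hf, rfl⟩
  obtain ⟨t, ht, hQ⟩ := exists_finset_span_eq_top h
  choose I hI using fun a : t => hQ a.1 a.2
  obtain ⟨J, hJ⟩ := GSBPoints.exists_glue t ht I fun a b S _ _ g h e => by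
    have h1 := (hI a).map g
    have h2 := (hI b).map h
    rw [← SchemePoints.map_comp, e] at h1
    rw [← SchemePoints.map_comp] at h2
    exact h1.right_unique h2
  refine ⟨J, fun p => ?_⟩
  obtain ⟨a, ha, hp⟩ := exists_prime_notMem_of_span_eq_top ht p
  exact ⟨a, hp, (hJ ⟨a, ha⟩).symm ▸ hI ⟨a, ha⟩⟩

/-- The glued scheme represents the functor `GSBPoints`. -/
theorem isGenSeveriBrauer_gluedScheme (hx : Function.Surjective x) :
    IsGenSeveriBrauer A n k (gluedStructure F x) := by
  let φ : ∀ (R : Type u) [CommRing R] [Algebra F R],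
      SchemePoints (gluedStructure F x) R ≃ GSBPoints F A n k R := fun R _ _ =>
    { toFun := fun z => (exists_locallyMatch_right z).choose
      invFun := fun I => (exists_locallyMatch_left hx I).choose
      left_inv := fun z => (exists_locallyMatch_left hx _).choose_spec.left_unique
        (exists_locallyMatch_right z).choose_spec
      right_inv := fun I => (exists_locallyMatch_right _).choose_spec.right_unique
        (exists_locallyMatch_left hx I).choose_spec }
  exact ⟨φ, fun R S _ _ _ _ f z => (exists_locallyMatch_right _).choose_spec.right_unique
    ((exists_locallyMatch_right z).choose_spec.map f)⟩

end Representability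

/-! ### Uniqueness of the representing scheme -/

section Uniqueness

open Limits

variable {F : Type u} [Field F] {X Y : Scheme.{u}} {sX : X ⟶ Spec (.of F)} {sY : Y ⟶ Spec (.of F)}

/-- The value of a transformation of functors of points at a morphism from an affine scheme,
regarded as a scheme over `F` through the target of the morphism. -/
noncomputable def pointwiseMap
    (φ : ∀ (R : Type u) [CommRing R] [Algebra F R], SchemePoints sX R → SchemePoints sY R)
    {R : CommRingCat.{u}} (x : Spec R ⟶ X) : Spec R ⟶ Y :=
  letI := (Spec.preimage (x ≫ sX)).hom.toAlgebra
  (φ R ⟨x, (Spec.map_preimage (x ≫ sX)).symm⟩).1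

variable {φ : ∀ (R : Type u) [CommRing R] [Algebra F R], SchemePoints sX R → SchemePoints sY R}

lemma pointwiseMap_eq {R : Type u} [CommRing R] [h : Algebra F R] (x : SchemePoints sX R) :
    pointwiseMap φ x.1 = (φ R x).1 := by
  have : (Spec.preimage (x.1 ≫ sX)).hom.toAlgebra = h := by
    apply Algebra.algebra_ext
    intro c
    have h1 := Spec.map_injective ((Spec.map_preimage (x.1 ≫ sX)).trans x.2)
    exact congr(CommRingCat.Hom.hom $h1 c)
  have key : ∀ (h' : Algebra F R) (_ : h' = h)
      (hx : x.1 ≫ sX = Spec.map (CommRingCat.ofHom (algebraMap F R))),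
      (φ R ⟨x.1, hx⟩).1 = (@φ R _ h x).1 := by
    rintro _ rfl _
    rfl
  exact key _ this _

lemma pointwiseMap_structure {R : CommRingCat.{u}} (x : Spec R ⟶ X) :
    pointwiseMap φ x ≫ sY = x ≫ sX :=
  letI := (Spec.preimage (x ≫ sX)).hom.toAlgebra
  (φ R ⟨x, (Spec.map_preimage (x ≫ sX)).symm⟩).2.trans (Spec.map_preimage (x ≫ sX))

lemma pointwiseMap_comp
    (hφ : ∀ (R S : Type u) [CommRing R] [Algebra F R] [CommRing S] [Algebra F S] (f : R →ₐ[F] S)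
      (x : SchemePoints sX R), φ S (x.map f) = (φ R x).map f)
    {R S : CommRingCat.{u}} (g : Spec S ⟶ Spec R) (x : Spec R ⟶ X) :
    pointwiseMap φ (g ≫ x) = g ≫ pointwiseMap φ x := by
  let algR : Algebra F R := (Spec.preimage (x ≫ sX)).hom.toAlgebra
  let algS : Algebra F S := (Spec.preimage ((g ≫ x) ≫ sX)).hom.toAlgebra
  let y : SchemePoints sX R := ⟨x, (Spec.map_preimage (x ≫ sX)).symm⟩
  let f : R →ₐ[F] S :=
    { (Spec.preimage g).hom with
      commutes' := fun c => by
        have h1 : Spec.preimage (x ≫ sX) ≫ Spec.preimage g = Spec.preimage ((g ≫ x) ≫ sX) := by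
          apply Spec.map_injective
          rw [Spec.map_comp, Spec.map_preimage, Spec.map_preimage, Spec.map_preimage,
            Category.assoc]
        exact congr(CommRingCat.Hom.hom $h1 c) }
  have hf : Spec.map (CommRingCat.ofHom (f : (R : Type u) →+* S)) = g := Spec.map_preimage g
  have h1 : (y.map f).1 = g ≫ x := congrArg (· ≫ x) hf
  have h2 := congrArg Subtype.val (hφ R S f y)
  rw [← pointwiseMap_eq, h1] at h2
  exact h2.trans (congrArg (· ≫ (φ R y).1) hf)

/-- A natural transformation between the functors of points on affine schemes is induced by a
morphism of schemes. -/
lemma exists_hom_of_natural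
    (hφ : ∀ (R S : Type u) [CommRing R] [Algebra F R] [CommRing S] [Algebra F S] (f : R →ₐ[F] S)
      (x : SchemePoints sX R), φ S (x.map f) = (φ R x).map f) :
    ∃ f : X ⟶ Y, f ≫ sY = sX ∧ ∀ (R : CommRingCat.{u}) (x : Spec R ⟶ X),
      x ≫ f = pointwiseMap φ x := by
  let 𝒰 := X.affineOpenCover
  have hc : ∀ i j, pullback.fst (𝒰.openCover.f i) (𝒰.openCover.f j) ≫ pointwiseMap φ (𝒰.f i) =
      pullback.snd (𝒰.openCover.f i) (𝒰.openCover.f j) ≫ pointwiseMap φ (𝒰.f j) := by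
    intro i j
    let P := pullback (𝒰.openCover.f i) (𝒰.openCover.f j)
    refine Scheme.Cover.hom_ext P.affineOpenCover.openCover _ _ fun l => ?_
    let g : Spec (P.affineOpenCover.X l) ⟶ P := P.affineOpenCover.f l
    have h1 := pointwiseMap_comp hφ (g ≫ pullback.fst (𝒰.openCover.f i) (𝒰.openCover.f j)) (𝒰.f i)
    have h2 := pointwiseMap_comp hφ (g ≫ pullback.snd (𝒰.openCover.f i) (𝒰.openCover.f j)) (𝒰.f j)
    have h3 : (g ≫ pullback.fst (𝒰.openCover.f i) (𝒰.openCover.f j)) ≫ 𝒰.f i =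
        (g ≫ pullback.snd (𝒰.openCover.f i) (𝒰.openCover.f j)) ≫ 𝒰.f j :=
      (Category.assoc _ _ _).trans ((congrArg (g ≫ ·) pullback.condition).trans
        (Category.assoc _ _ _).symm)
    exact (Category.assoc _ _ _).symm.trans ((h1.symm.trans
      ((congrArg (pointwiseMap φ) h3).trans h2)).trans (Category.assoc _ _ _))
  let f := 𝒰.openCover.glueMorphisms (fun i => pointwiseMap φ (𝒰.f i)) hc
  have hf : ∀ i, 𝒰.f i ≫ f = pointwiseMap φ (𝒰.f i) :=
    Scheme.Cover.ι_glueMorphisms 𝒰.openCover _ hc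
  refine ⟨f, Scheme.Cover.hom_ext 𝒰.openCover _ _ fun i => ?_, fun R x => ?_⟩
  · exact (Category.assoc _ _ _).symm.trans ((congrArg (· ≫ sY) (hf i)).trans
      (pointwiseMap_structure _))
  · let 𝒱 := 𝒰.openCover.pullback₁ x
    refine Scheme.Cover.hom_ext 𝒱 _ _ fun i => ?_
    refine Scheme.Cover.hom_ext (𝒱.X i).affineOpenCover.openCover _ _ fun l => ?_
    let g : Spec ((𝒱.X i).affineOpenCover.X l) ⟶ 𝒱.X i := (𝒱.X i).affineOpenCover.f l
    let q : 𝒱.X i ⟶ Spec (𝒰.X i) := pullback.snd x (𝒰.openCover.f i)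
    have hq : 𝒱.f i ≫ x = q ≫ 𝒰.f i := pullback.condition
    have h1 := pointwiseMap_comp hφ (g ≫ 𝒱.f i) x
    have h2 := pointwiseMap_comp hφ (g ≫ q) (𝒰.f i)
    have h3 : (g ≫ 𝒱.f i) ≫ x = (g ≫ q) ≫ 𝒰.f i := by
      rw [Category.assoc, hq, Category.assoc]
    have h4 : (g ≫ 𝒱.f i) ≫ x ≫ f = (g ≫ q) ≫ pointwiseMap φ (𝒰.f i) :=
      (Category.assoc _ _ _).symm.trans ((congrArg (· ≫ f) h3).trans
        ((Category.assoc _ _ _).trans (congrArg ((g ≫ q) ≫ ·) (hf i))))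
    exact (Category.assoc _ _ _).symm.trans ((h4.trans (h2.symm.trans
      ((congrArg (pointwiseMap φ) h3).symm.trans h1))).trans (Category.assoc _ _ _))

lemma hom_eq_id_of_forall_spec {f : X ⟶ X}
    (h : ∀ (R : CommRingCat.{u}) (x : Spec R ⟶ X), x ≫ f = x) : f = 𝟙 X :=
  Scheme.Cover.hom_ext X.affineOpenCover.openCover _ _ fun i =>
    (h _ (X.affineOpenCover.f i)).trans (Category.comp_id _).symm

/-- Two schemes over `F` representing the same functor on affine schemes are isomorphic. -/
lemma exists_iso_of_pointwise
    (φ : ∀ (R : Type u) [CommRing R] [Algebra F R], SchemePoints sX R ≃ SchemePoints sY R)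
    (hφ : ∀ (R S : Type u) [CommRing R] [Algebra F R] [CommRing S] [Algebra F S] (f : R →ₐ[F] S)
      (x : SchemePoints sX R), φ S (x.map f) = (φ R x).map f) :
    ∃ e : X ≅ Y, e.hom ≫ sY = sX := by
  obtain ⟨f, hf, hf'⟩ := exists_hom_of_natural (φ := fun R _ _ => φ R) hφ
  obtain ⟨g, hg, hg'⟩ := exists_hom_of_natural (φ := fun R _ _ => (φ R).symm)
    (fun R S _ _ _ _ f x => by rw [Equiv.symm_apply_eq, hφ, Equiv.apply_symm_apply])
  refine ⟨⟨f, g, hom_eq_id_of_forall_spec fun R x => ?_, hom_eq_id_of_forall_spec fun R x => ?_⟩,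
    hf⟩
  · let : Algebra F R := (Spec.preimage (x ≫ sX)).hom.toAlgebra
    let y : SchemePoints sX R := ⟨x, (Spec.map_preimage (x ≫ sX)).symm⟩
    have h1 : x ≫ f = (φ R y).1 := (hf' R x).trans (pointwiseMap_eq y)
    have h2 : (φ R y).1 ≫ g = _ := (hg' R _).trans (pointwiseMap_eq (φ R y))
    rw [← Category.assoc, h1, h2, Equiv.symm_apply_apply]
  · let : Algebra F R := (Spec.preimage (x ≫ sY)).hom.toAlgebra
    let y : SchemePoints sY R := ⟨x, (Spec.map_preimage (x ≫ sY)).symm⟩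
    have h1 : x ≫ g = ((φ R).symm y).1 := (hg' R x).trans (pointwiseMap_eq y)
    have h2 : ((φ R).symm y).1 ≫ f = _ := (hf' R _).trans (pointwiseMap_eq ((φ R).symm y))
    rw [← Category.assoc, h1, h2, Equiv.apply_symm_apply]

/-- The generalized Severi-Brauer variety is unique up to isomorphism over `F`. -/
theorem IsGenSeveriBrauer.exists_iso {A : Type v} [Ring A] [Algebra F A] {n k : ℕ}
    (hX : IsGenSeveriBrauer A n k sX) (hY : IsGenSeveriBrauer A n k sY) :
    ∃ e : X ≅ Y, e.hom ≫ sY = sX := by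
  obtain ⟨φ, hφ⟩ := hX
  obtain ⟨ψ, hψ⟩ := hY
  refine exists_iso_of_pointwise (fun R _ _ => (φ R).trans (ψ R).symm) fun R S _ _ _ _ f x => ?_
  change (ψ S).symm _ = ((ψ R).symm _).map f
  rw [Equiv.symm_apply_eq, hφ, hψ, Equiv.apply_symm_apply]

end Uniqueness

/-! ### Left ideals of matrix algebras as annihilators of columns -/

section Splitting

variable {F : Type u} [Field F] {A : Type v} [Ring A] [Algebra F A] {n k : ℕ} {K : Type u} [Field K]
  [Algebra F K] (ψ : A →ₐ[F] Matrix (Fin n) (Fin n) K)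

/-- The composite `A → M_n(K) → M_n(R)` for a commutative `K`-algebra `R`. -/
noncomputable def splitHom (R : Type*) [CommRing R] [Algebra K R] [Algebra F R]
    [IsScalarTower F K R] : A →ₐ[F] Matrix (Fin n) (Fin n) R :=
  (IsScalarTower.toAlgHom F K R).mapMatrix.comp ψ

section

variable (R : Type*) [CommRing R] [Algebra K R] [Algebra F R] [IsScalarTower F K R]

lemma splitHom_apply (a : A) : splitHom ψ R a = (ψ a).map (algebraMap K R) := rfl

/-- The homomorphism `A_R → M_n(R)` extending `splitHom`. -/
noncomputable def splitLift : R ⊗[F] A →ₐ[R] Matrix (Fin n) (Fin n) R :=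
  Algebra.TensorProduct.lift (Algebra.ofId R _) (splitHom ψ R) fun r _ => Algebra.commutes r _

@[simp]
lemma splitLift_tmul (r : R) (a : A) : splitLift ψ R (r ⊗ₜ a) = r • splitHom ψ R a := by
  exact (Algebra.TensorProduct.lift_tmul _ _ _ r a).trans (Algebra.smul_def r _).symm

variable {ψ}

/-- An algebra split over `K` is split over every commutative `K`-algebra. -/
lemma splitLift_bijective (h : Function.Bijective (splitLift ψ K)) :
    Function.Bijective (splitLift ψ R) := by
  let e₁ : R ⊗[F] A ≃ₗ[R] R ⊗[K] (K ⊗[F] A) :=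
    (AlgebraTensorModule.cancelBaseChange F K R R A).symm
  let e₂ : R ⊗[K] (K ⊗[F] A) ≃ₗ[R] R ⊗[K] Matrix (Fin n) (Fin n) K :=
    (LinearEquiv.ofBijective (splitLift ψ K).toLinearMap h).baseChange K R _ _
  let e₃ : R ⊗[K] Matrix (Fin n) (Fin n) K ≃ Matrix (Fin n) (Fin n) R :=
    (matrixEquivTensor (Fin n) K R).symm.toEquiv
  have : (splitLift ψ R : R ⊗[F] A → _) = e₃ ∘ e₂ ∘ e₁ := by
    ext1 y
    have hadd : ∀ y z, (e₃ ∘ e₂ ∘ e₁) (y + z) = (e₃ ∘ e₂ ∘ e₁) y + (e₃ ∘ e₂ ∘ e₁) z := by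
      intro y z
      simp only [Function.comp_apply, map_add]
      exact map_add (matrixEquivTensor (Fin n) K R).symm _ _
    induction y with
    | zero =>
      have h0 : (e₃ ∘ e₂ ∘ e₁) 0 = 0 := by simpa using hadd 0 0
      rw [map_zero, h0]
    | add y z hy hz => rw [map_add, hadd, hy, hz]
    | tmul r a =>
      have h1 : e₁ (r ⊗ₜ a) = r ⊗ₜ (1 ⊗ₜ a) :=
        AlgebraTensorModule.cancelBaseChange_symm_tmul ..
      have h2 : e₂ (r ⊗ₜ (1 ⊗ₜ a)) = r ⊗ₜ (splitLift ψ K (1 ⊗ₜ a)) := rfl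
      have h3 : ∀ M : Matrix (Fin n) (Fin n) K, e₃ (r ⊗ₜ M) = r • M.map (algebraMap K R) := by
        intro M
        ext i j
        simp [e₃, matrixEquivTensor_apply_symm]
      rw [Function.comp_apply, Function.comp_apply, h1, h2, h3, splitLift_tmul, splitLift_tmul,
        one_smul]
      rfl
  rw [this]
  exact e₃.bijective.comp (e₂.bijective.comp e₁.bijective)

/-- The isomorphism `A_R ≃ M_n(R)` over a commutative algebra over a splitting field. -/
noncomputable def splitEquiv (h : Function.Bijective (splitLift ψ K)) :
    R ⊗[F] A ≃ₐ[R] Matrix (Fin n) (Fin n) R :=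
  AlgEquiv.ofBijective (splitLift ψ R) (splitLift_bijective R h)

end

end Splitting

section ColumnPoints

variable {F : Type u} [Field F] {A : Type v} [Ring A] [Algebra F A] {n k : ℕ} {K : Type u} [Field K]
  [Algebra F K] (ψ : A →ₐ[F] Matrix (Fin n) (Fin n) K) (x : Fin (k * n) → A)
  {R : Type*} [CommRing R] [Algebra K R] [Algebra F R] [IsScalarTower F K R]
  {S : Type*} [CommRing S] [Algebra K S] [Algebra F S] [IsScalarTower F K S]

/-- The entries of an `n × k` matrix, as a vector of length `k * n`. -/
def entries (R : Type*) [CommRing R] (n k : ℕ) :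
    Matrix (Fin n) (Fin k) R ≃ₗ[R] (Fin (k * n) → R) where
  toFun M l := M (finProdFinEquiv.symm l).2 (finProdFinEquiv.symm l).1
  invFun v := Matrix.of fun i j => v (finProdFinEquiv (j, i))
  map_add' _ _ := rfl
  map_smul' _ _ := rfl
  left_inv M := by ext i j; simp
  right_inv v := by ext l; exact congrArg v (finProdFinEquiv.apply_symm_apply l)

lemma entries_apply (M : Matrix (Fin n) (Fin k) R) (l : Fin (k * n)) :
    entries R n k M l = M (finProdFinEquiv.symm l).2 (finProdFinEquiv.symm l).1 := rfl

/-- The matrix of the map `e_j ↦ ψ(x_j) q`. If it is invertible, then the left ideal of all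
`m ∈ M_n(R)` with `m q = 0` is a point of the chart given by `x`. -/
noncomputable def columnMatrix (q : Matrix (Fin n) (Fin k) R) :
    Matrix (Fin (k * n)) (Fin (k * n)) R :=
  Matrix.of fun j => entries R n k (splitHom ψ R (x j) * q)

lemma columnMatrix_map (f : R →ₐ[K] S) (q : Matrix (Fin n) (Fin k) R) :
    columnMatrix ψ x (q.map f) = (columnMatrix ψ x q).map f := by
  ext j l
  simp [columnMatrix, entries_apply, Matrix.mul_apply, splitHom_apply]

/-- The coordinate map of the left ideal of all `m ∈ M_n(R)` with `m q = 0` in the chart given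
by `x`. It has this meaning only if `columnMatrix ψ x q` is invertible. -/
noncomputable def columnCoord (q : Matrix (Fin n) (Fin k) R) : A →ₗ[F] (Fin (k * n) → R) where
  toFun a := Matrix.vecMul (entries R n k (splitHom ψ R a * q)) (columnMatrix ψ x q)⁻¹
  map_add' a b := by rw [map_add, Matrix.add_mul, map_add, Matrix.add_vecMul]
  map_smul' c a := by
    rw [map_smul, Matrix.smul_mul, ← algebraMap_smul R c (splitHom ψ R a * q), map_smul,
      Matrix.smul_vecMul, algebraMap_smul, RingHom.id_apply]

variable {ψ x} {q : Matrix (Fin n) (Fin k) R}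

lemma vecMul_columnMatrix (v : Fin (k * n) → R) :
    Matrix.vecMul v (columnMatrix ψ x q) = entries R n k (∑ j, v j • (splitHom ψ R (x j) * q)) := by
  ext l
  simp [Matrix.vecMul, dotProduct, columnMatrix]

lemma columnCoord_eq_iff (h : IsUnit (columnMatrix ψ x q).det) {a : A} {v : Fin (k * n) → R} :
    columnCoord ψ x q a = v ↔ splitHom ψ R a * q = ∑ j, v j • (splitHom ψ R (x j) * q) := by
  rw [← (entries R n k).injective.eq_iff, ← vecMul_columnMatrix]
  change Matrix.vecMul (entries R n k (splitHom ψ R a * q)) (columnMatrix ψ x q)⁻¹ = v ↔ _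
  constructor
  · rintro rfl
    rw [Matrix.vecMul_vecMul, Matrix.nonsing_inv_mul _ h, Matrix.vecMul_one]
  · intro e
    rw [e, Matrix.vecMul_vecMul, Matrix.mul_nonsing_inv _ h, Matrix.vecMul_one]

lemma splitHom_mul_eq (h : IsUnit (columnMatrix ψ x q).det) (a : A) :
    splitHom ψ R a * q = ∑ j, columnCoord ψ x q a j • (splitHom ψ R (x j) * q) :=
  (columnCoord_eq_iff h).1 rfl

lemma isChartPoint_columnCoord (h : IsUnit (columnMatrix ψ x q).det) :
    IsChartPoint x (columnCoord ψ x q) where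
  apply_self j := by
    rw [columnCoord_eq_iff h]
    simp [Pi.single_apply, ite_smul]
  apply_mul a b := by
    rw [columnCoord_eq_iff h, map_mul, Matrix.mul_assoc, splitHom_mul_eq h b, Matrix.mul_sum]
    simp only [Finset.sum_apply, Finset.sum_smul, Pi.smul_apply, smul_eq_mul]
    rw [Finset.sum_comm]
    refine Finset.sum_congr rfl fun j _ => ?_
    rw [Matrix.mul_smul, ← Matrix.mul_assoc, ← map_mul, splitHom_mul_eq h, Finset.smul_sum]
    simp only [mul_smul]

lemma splitHom_map (f : R →ₐ[K] S) (a : A) : splitHom ψ S a = (splitHom ψ R a).map f := by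
  ext i j
  simp [splitHom_apply]

lemma isUnit_columnMatrix_map (h : IsUnit (columnMatrix ψ x q).det) (f : R →ₐ[K] S) :
    IsUnit (columnMatrix ψ x (q.map f)).det := by
  rw [columnMatrix_map]
  exact (AlgHom.map_det f (columnMatrix ψ x q)) ▸ h.map f

lemma chartMap_columnCoord (h : IsUnit (columnMatrix ψ x q).det) (f : R →ₐ[K] S) :
    chartMap (f.restrictScalars F) (columnCoord ψ x q) = columnCoord ψ x (q.map f) := by
  ext1 a
  symm
  rw [columnCoord_eq_iff (isUnit_columnMatrix_map h f)]
  have key : ∀ a, splitHom ψ S a * q.map f = (splitHom ψ R a * q).map f := by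
    intro a
    rw [splitHom_map f]
    ext i j
    simp [Matrix.mul_apply]
  rw [key, splitHom_mul_eq h]
  ext i j
  simp only [chartMap_apply, key, Matrix.sum_apply, Matrix.map_apply, Matrix.smul_apply, map_sum,
    smul_eq_mul, map_mul, AlgHom.restrictScalars_apply]

/-- Over a local `K`-algebra, every point of a chart is the annihilator of an `n × k` matrix. -/
lemma exists_eq_columnCoord [IsLocalRing R] (hψ : Function.Bijective (splitLift ψ K)) (hn : 0 < n)
    {π : A →ₗ[F] (Fin (k * n) → R)} (h : IsChartPoint x π) :
    ∃ q : Matrix (Fin n) (Fin k) R, IsUnit (columnMatrix ψ x q).det ∧ columnCoord ψ x q = π := by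
  -- `P` is the projection of `M_n(R)` onto the quotient by the left ideal `J`.
  let P : Matrix (Fin n) (Fin n) R →ₗ[R] (Fin (k * n) → R) :=
    π.liftBaseChange R ∘ₗ (splitEquiv R hψ).symm.toLinearMap
  have hP : ∀ a, P (splitHom ψ R a) = π a := by
    intro a
    have : splitHom ψ R a = splitEquiv R hψ (1 ⊗ₜ a) :=
      ((splitLift_tmul ψ R 1 a).trans (one_smul _ _)).symm
    simp [P, this]
  have hPmul : ∀ m z, P z = 0 → P (m * z) = 0 := by
    intro m z hz
    have := h.mul_mem ((splitEquiv R hψ).symm m) (y := (splitEquiv R hψ).symm z) hz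
    rw [mem_chartKer, ← map_mul] at this
    exact this
  have hPcongr : ∀ m z z', P z = P z' → P (m * z) = P (m * z') := by
    intro m z z' e
    rw [← sub_eq_zero, ← map_sub, ← mul_sub]
    exact hPmul m _ (by rw [map_sub, e, sub_self])
  let σ : (Fin (k * n) → R) →ₗ[R] Matrix (Fin n) (Fin n) R :=
    Fintype.linearCombination R fun j => splitHom ψ R (x j)
  have hσ : ∀ z, P (σ z) = z := by
    intro z
    simp only [σ, Fintype.linearCombination_apply, map_sum, map_smul, hP, h.apply_self]
    ext l
    simp [Pi.single_apply]
  let o : Fin n := ⟨0, hn⟩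
  let E : Fin n → Fin n → Matrix (Fin n) (Fin n) R := fun i j => Matrix.single i j 1
  have hEE : ∀ i j l, E i j * E j l = E i l := by
    intro i j l
    simp [E]
  have hEsum : ∑ i, E i i = 1 := Matrix.sum_single_one
  -- The direct summand `N` of `R ^ r`: the image of the first row.
  let p : Fin n → (Fin (k * n) → R) →ₗ[R] (Fin (k * n) → R) := fun i =>
    P ∘ₗ (LinearMap.mulLeft R (E o i)) ∘ₗ σ
  have hp : ∀ i m, p i (P m) = P (E o i * m) := fun i m => hPcongr _ _ _ (hσ _)
  let N : Submodule R (Fin (k * n) → R) := LinearMap.range (p o)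
  have hpN : ∀ i z, p i z ∈ N := by
    intro i z
    refine ⟨p i z, ?_⟩
    change p o (P (E o i * σ z)) = P (E o i * σ z)
    rw [hp, ← mul_assoc, hEE]
  have hpo : ∀ z ∈ N, p o z = z := by
    rintro _ ⟨z, rfl⟩
    change p o (P (E o o * σ z)) = P (E o o * σ z)
    rw [hp, ← mul_assoc, hEE]
  have : Module.Projective R N := Module.Projective.of_split N.subtype
    ((p o).codRestrict N (hpN o)) (by ext1 z; exact Subtype.ext (hpo z z.2))
  have : Module.Finite R N := Module.Finite.range _
  have : Module.Free R N := Module.free_of_flat_of_isLocalRing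
  -- Taking rows identifies `R ^ r` with `N ^ n`.
  let g : (Fin (k * n) → R) →ₗ[R] (Fin n → N) :=
    LinearMap.pi fun i => (p i).codRestrict N (hpN i)
  have hg : ∀ z i, (g z i : Fin (k * n) → R) = p i z := fun z i => rfl
  have hginj : Function.Injective g := by
    rw [injective_iff_map_eq_zero]
    intro z hz
    have h1 : ∀ i, P (E i i * σ z) = 0 := by
      intro i
      have : P (E o i * σ z) = 0 := congrArg Subtype.val (congrFun hz i)
      rw [← hEE i o i, mul_assoc]
      exact hPmul _ _ this
    rw [← hσ z, ← one_mul (σ z), ← hEsum, Finset.sum_mul, map_sum, Finset.sum_eq_zero]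
    exact fun i _ => h1 i
  have hgsurj : Function.Surjective g := by
    intro v
    refine ⟨P (∑ i, E i o * σ (v i)), ?_⟩
    ext1 l
    ext1
    rw [hg, hp, Finset.mul_sum, Finset.sum_eq_single l]
    · rw [← mul_assoc, hEE]
      exact hpo _ (v l).2
    · intro i _ hi
      rw [← mul_assoc]
      simp [E, hi.symm]
    · simp
  let eg := LinearEquiv.ofBijective g ⟨hginj, hgsurj⟩
  have hrank : Module.finrank R N = k := by
    have h1 := eg.finrank_eq
    rw [Module.finrank_fin_fun, Module.finrank_pi_fintype, Finset.sum_const, Finset.card_univ,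
      Fintype.card_fin, smul_eq_mul] at h1
    exact (Nat.eq_of_mul_eq_mul_left hn ((mul_comm n k).trans h1)).symm
  let φ : N ≃ₗ[R] (Fin k → R) := (Module.finBasisOfFinrankEq R N hrank).equivFun
  let q : Matrix (Fin n) (Fin k) R := Matrix.of fun i => φ (g (P 1) i)
  -- Right multiplication by `q` is `P` followed by an isomorphism.
  have hmq : ∀ m i, (m * q) i = φ (g (P m) i) := by
    intro m i
    have h1 : g (P m) i = ∑ l, m i l • g (P 1) l := by
      ext1
      rw [hg, hp, Submodule.coe_sum]
      simp only [Submodule.coe_smul, hg, hp, mul_one, ← map_smul, ← map_sum]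
      congr 1
      ext a b
      by_cases ha : o = a
      · subst ha
        simp [E, Matrix.sum_apply, Matrix.single_apply]
      · simp [E, Matrix.sum_apply, Matrix.mul_apply, ha]
    rw [h1, map_sum]
    ext j
    simp [Matrix.mul_apply, q]
  let Φ : (Fin (k * n) → R) ≃ₗ[R] (Fin (k * n) → R) :=
    eg.trans ((LinearEquiv.piCongrRight fun _ => φ).trans (entries R n k))
  have hΦ : ∀ m, entries R n k (m * q) = Φ (P m) := by
    intro m
    have : m * q = Matrix.of fun i => φ (g (P m) i) := by
      ext i j
      exact congrFun (hmq m i) j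
    rw [this]
    rfl
  have hD : columnMatrix ψ x q = (LinearMap.toMatrix' Φ.toLinearMap).transpose := by
    ext j l
    rw [columnMatrix, Matrix.of_apply, hΦ, hP, h.apply_self, Matrix.transpose_apply,
      LinearMap.toMatrix'_apply]
    rfl
  have hu : IsUnit (columnMatrix ψ x q).det := by
    rw [hD, Matrix.det_transpose, LinearMap.det_toMatrix']
    exact LinearEquiv.isUnit_det' Φ
  refine ⟨q, hu, ?_⟩
  ext1 a
  rw [columnCoord_eq_iff hu]
  apply (entries R n k).injective
  rw [map_sum, hΦ, hP]
  simp only [map_smul, hΦ, hP, h.apply_self]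
  simp only [← map_smul, ← map_sum]
  congr 1
  ext l
  simp [Pi.single_apply]

end ColumnPoints

/-! ### The generic point of a chart -/

section UniversalChart

variable {F : Type u} [Field F] {A : Type v} [Ring A] [Algebra F A]

/-- The chart given by `x` is represented by the affine scheme `Spec O`, with universal coordinate
map `π`. -/
structure IsUniversalChart {r : ℕ} {O : Type u} [CommRing O] [Algebra F O] (x : Fin r → A)
    (π : A →ₗ[F] (Fin r → O)) : Prop where
  isChartPoint : IsChartPoint x π
  exists_hom : ∀ {R : Type u} [CommRing R] [Algebra F R] {π' : A →ₗ[F] (Fin r → R)},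
    IsChartPoint x π' → ∃ f : O →ₐ[F] R, chartMap f π = π'
  hom_ext : ∀ {R : Type u} [CommRing R] [Algebra F R] {f g : O →ₐ[F] R},
    chartMap f π = chartMap g π → f = g

lemma isUniversalChart_univCoord [FiniteDimensional F A] {r : ℕ} {ι : Type u} (x : ι → Fin r → A)
    (i : ι) : IsUniversalChart (x i) (univCoord F x {i} ⟨i, Finset.mem_singleton_self i⟩) where
  isChartPoint := (isMultiChartPoint_univCoord x {i}).isChartPoint ⟨i, Finset.mem_singleton_self i⟩
  exists_hom {R} _ _ π' h := by
    have h' : IsMultiChartPoint x {i} fun _ => π' := by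
      refine ⟨fun j => ?_, fun j l a => ?_⟩
      · obtain ⟨j, hj⟩ := j
        obtain rfl := Finset.mem_singleton.1 hj
        exact h
      · obtain ⟨j, hj⟩ := j
        obtain rfl := Finset.mem_singleton.1 hj
        simp only [h.apply_self]
        ext l
        simp [Pi.single_apply]
    exact ⟨chartLift h', chartMap_chartLift h' _⟩
  hom_ext {R} _ _ f g h := chartRing_hom_ext fun j => by
    obtain ⟨j, hj⟩ := j
    obtain rfl := Finset.mem_singleton.1 hj
    exact h

lemma chartMap_comp {r : ℕ} {R S T : Type*} [CommRing R] [Algebra F R] [CommRing S] [Algebra F S]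
    [CommRing T] [Algebra F T] (g : S →ₐ[F] T) (f : R →ₐ[F] S) (π : A →ₗ[F] (Fin r → R)) :
    chartMap (g.comp f) π = chartMap g (chartMap f π) := rfl

lemma awayLift_injective {R S : Type*} [CommRing R] [Algebra F R] [CommRing S] [Algebra F S] (a : R)
    (f : R →ₐ[F] S) (h : IsUnit (f a)) (hf : Function.Injective f) :
    Function.Injective (awayLift a f h) := by
  refine (injective_iff_map_eq_zero _).2 fun z hz => ?_
  obtain ⟨⟨y, s⟩, hys⟩ := IsLocalization.surj (Submonoid.powers a) z
  have h1 : f y = 0 := by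
    have h2 := congrArg (awayLift a f h) hys
    rw [map_mul, hz, zero_mul] at h2
    exact ((awayLift_apply a _ h y).symm.trans h2.symm)
  rw [map_eq_zero_iff _ hf] at h1
  rw [h1, map_zero] at hys
  exact (IsLocalization.map_units (Localization.Away a) s).mul_left_eq_zero.1 hys

variable {n k : ℕ} {K : Type u} [Field K] [Algebra F K]

/-- The function field of the space of `n × k` matrices over `K`. -/
abbrev ColumnField (K : Type u) [Field K] (n k : ℕ) : Type u :=
  FractionRing (MvPolynomial (Fin n × Fin k) K)

/-- The generic `n × k` matrix, over an algebra over the polynomial ring in its entries. -/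
noncomputable def genericColumn (K : Type u) [Field K] (n k : ℕ) (R : Type*) [CommRing R]
    [Algebra (MvPolynomial (Fin n × Fin k) K) R] : Matrix (Fin n) (Fin k) R :=
  Matrix.of fun i j => algebraMap (MvPolynomial (Fin n × Fin k) K) R (MvPolynomial.X (i, j))

/-- The coordinate ring of a nonempty chart embeds into the function field of the space of `n × k`
matrices over a splitting field: locally on the chart the universal point is the annihilator of a
matrix of size `n × k`, so an element of the coordinate ring vanishing on the generic matrix
vanishes locally. -/
lemma IsUniversalChart.injective_columnField {O : Type u} [CommRing O] [Algebra F O] [Nontrivial O]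
    {x : Fin (k * n) → A} {π : A →ₗ[F] (Fin (k * n) → O)} (h : IsUniversalChart x π)
    {ψ : A →ₐ[F] Matrix (Fin n) (Fin n) K} (hψ : Function.Bijective (splitLift ψ K)) (hn : 0 < n) :
    IsUnit (columnMatrix ψ x (genericColumn K n k (ColumnField K n k))).det ∧
    ∀ f : O →ₐ[F] ColumnField K n k,
      chartMap f π = columnCoord ψ x (genericColumn K n k (ColumnField K n k)) →
      Function.Injective f := by
  let P := MvPolynomial (Fin n × Fin k) K
  let d : P := (columnMatrix ψ x (genericColumn K n k P)).det
  let T := K ⊗[F] O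
  -- A nonzero element of `O` survives in some local `K`-algebra, to which `O` maps through `P_d`.
  have key : ∀ c : O, c ≠ 0 → d ≠ 0 ∧ ∀ g : O →ₐ[F] Localization.Away d,
      chartMap g π = columnCoord ψ x (genericColumn K n k (Localization.Away d)) → g c ≠ 0 := by
    intro c hc
    have hc' : (1 : K) ⊗ₜ[F] c ≠ 0 := by
      intro h0
      exact hc (Algebra.TensorProduct.includeRight_injective (A := K) (B := O)
        (algebraMap F K).injective (h0.trans (map_zero _).symm))
    obtain ⟨J, hJ, hcJ⟩ : ∃ (J : Ideal T) (_ : J.IsMaximal),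
        algebraMap T (Localization.AtPrime J) ((1 : K) ⊗ₜ[F] c) ≠ 0 := by
      by_contra! hcon
      exact hc' (eq_zero_of_localization _ hcon)
    let R := Localization.AtPrime J
    let j : O →ₐ[F] R := (IsScalarTower.toAlgHom F T R).comp Algebra.TensorProduct.includeRight
    obtain ⟨q, hq, hqj⟩ := exists_eq_columnCoord (R := R) hψ hn (h.isChartPoint.map j)
    let ev : P →ₐ[K] R := MvPolynomial.aeval fun t => q t.1 t.2
    have hev : (genericColumn K n k P).map ev = q := by
      ext a b
      simp [genericColumn, ev, P]
    have hd : IsUnit (ev d) := by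
      have h1 : ev d = (columnMatrix ψ x q).det := by
        rw [← hev, columnMatrix_map]
        exact AlgHom.map_det ev (columnMatrix ψ x (genericColumn K n k P))
      rw [h1]
      exact hq
    refine ⟨fun h0 => hd.ne_zero (by rw [h0, map_zero]), fun g hg h0 => hcJ ?_⟩
    let ev' : Localization.Away d →ₐ[K] R := awayLift d ev hd
    have hev' : (genericColumn K n k (Localization.Away d)).map ev' = q := by
      rw [← hev]
      ext a b
      exact awayLift_apply d ev hd _
    have hdu : IsUnit (columnMatrix ψ x (genericColumn K n k (Localization.Away d))).det := by
      have h1 := IsLocalization.Away.algebraMap_isUnit (S := Localization.Away d) d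
      have h2 : genericColumn K n k (Localization.Away d) =
        (genericColumn K n k P).map (awayHom K d) := rfl
      rw [h2, columnMatrix_map]
      exact (AlgHom.map_det (awayHom K d) (columnMatrix ψ x (genericColumn K n k P))) ▸ h1
    have h3 : (ev'.restrictScalars F).comp g = j := h.hom_ext (by
      rw [chartMap_comp, hg, chartMap_columnCoord hdu, hev', hqj])
    have h4 : j c = ev' (g c) := congr($h3 c).symm
    rw [h0, map_zero] at h4
    exact h4
  have hd := (key 1 one_ne_zero).1
  have hgen : genericColumn K n k (ColumnField K n k) =
      (genericColumn K n k P).map (IsScalarTower.toAlgHom K P (ColumnField K n k)) := rfl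
  have hmap : algebraMap P (ColumnField K n k) d =
      (columnMatrix ψ x (genericColumn K n k (ColumnField K n k))).det := by
    rw [hgen, columnMatrix_map]
    exact AlgHom.map_det (IsScalarTower.toAlgHom K P (ColumnField K n k))
      (columnMatrix ψ x (genericColumn K n k P))
  have hu : IsUnit (algebraMap P (ColumnField K n k) d) :=
    (map_ne_zero_iff _ (IsFractionRing.injective P (ColumnField K n k))).2 hd |>.isUnit
  refine ⟨hmap ▸ hu, fun f hf => (injective_iff_map_eq_zero f).2 fun c hfc => ?_⟩
  by_contra hc
  have hdu : IsUnit (columnMatrix ψ x (genericColumn K n k (Localization.Away d))).det := by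
    have h1 := IsLocalization.Away.algebraMap_isUnit (S := Localization.Away d) d
    have h2 : genericColumn K n k (Localization.Away d) =
      (genericColumn K n k P).map (awayHom K d) := rfl
    rw [h2, columnMatrix_map]
    exact (AlgHom.map_det (awayHom K d) (columnMatrix ψ x (genericColumn K n k P))) ▸ h1
  obtain ⟨g, hg⟩ := h.exists_hom (isChartPoint_columnCoord hdu)
  let l : Localization.Away d →ₐ[K] ColumnField K n k :=
    awayLift d (IsScalarTower.toAlgHom K P (ColumnField K n k)) hu
  have hl : (genericColumn K n k (Localization.Away d)).map l =
      genericColumn K n k (ColumnField K n k) := by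
    rw [hgen]
    ext a b
    exact awayLift_apply d (IsScalarTower.toAlgHom K P (ColumnField K n k)) hu _
  have hlg : (l.restrictScalars F).comp g = f := h.hom_ext (by
    rw [chartMap_comp, hg, chartMap_columnCoord hdu, hl, hf])
  have hlinj : Function.Injective l :=
    awayLift_injective d _ hu (IsFractionRing.injective P (ColumnField K n k))
  refine (key c hc).2 g hg (hlinj ?_)
  rw [map_zero]
  exact congr($hlg c).trans hfc

end UniversalChart

/-! ### Integrality of the glued scheme -/

section Integrality

variable {F : Type u} [Field F] {A : Type v} [Ring A] [Algebra F A]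
  {n k : ℕ} {K : Type u} [Field K] [Algebra F K] {ψ : A →ₐ[F] Matrix (Fin n) (Fin n) K}

/-- The left ideal attached to a matrix `q` consists of the elements annihilating `q`. -/
lemma mem_chartKer_columnCoord {R : Type*} [CommRing R] [Algebra K R] [Algebra F R]
    [IsScalarTower F K R] {x : Fin (k * n) → A} {q : Matrix (Fin n) (Fin k) R}
    (h : IsUnit (columnMatrix ψ x q).det) (y : R ⊗[F] A) :
    y ∈ chartKer (columnCoord ψ x q) ↔ splitLift ψ R y * q = 0 := by
  have key : splitLift ψ R y * q = ∑ j, (columnCoord ψ x q).liftBaseChange R y j •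
      (splitHom ψ R (x j) * q) := by
    induction y with
    | zero => simp
    | tmul c a =>
      rw [splitLift_tmul, Matrix.smul_mul, splitHom_mul_eq h a, Finset.smul_sum]
      simp [mul_smul]
    | add y z hy hz =>
      simp only [map_add, Matrix.add_mul, hy, hz, Pi.add_apply, add_smul, Finset.sum_add_distrib]
  rw [mem_chartKer]
  constructor
  · intro h0
    rw [key, h0]
    simp
  · intro h0
    have h1 := vecMul_columnMatrix (ψ := ψ) (x := x) (q := q)
      ((columnCoord ψ x q).liftBaseChange R y)
    rw [← key, h0, map_zero] at h1
    have h2 := congrArg (fun v => Matrix.vecMul v (columnMatrix ψ x q)⁻¹) h1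
    simpa only [Matrix.vecMul_vecMul, Matrix.mul_nonsing_inv _ h, Matrix.vecMul_one,
      Matrix.zero_vecMul] using h2

variable [FiniteDimensional F A] {ι : Type u} {x : ι → Fin (k * n) → A}

/-- The coordinate ring of a chart embeds into the function field of the space of matrices. -/
lemma isDomain_chartRing (hψ : Function.Bijective (splitLift ψ K)) (hn : 0 < n) (i : ι)
    [Nontrivial (ChartRing F x {i})] : IsDomain (ChartRing F x {i}) := by
  have h := isUniversalChart_univCoord (F := F) x i
  obtain ⟨hu, hinj⟩ := h.injective_columnField hψ hn
  obtain ⟨f, hf⟩ := h.exists_hom (isChartPoint_columnCoord hu)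
  exact (hinj f hf).isDomain f.toRingHom

lemma isReduced_gluedScheme (hψ : Function.Bijective (splitLift ψ K)) (hn : 0 < n) :
    IsReduced (gluedScheme F x) := by
  let 𝒰 : (gluedScheme F x).OpenCover :=
    { I₀ := ι
      X := fun i => Spec (.of (ChartRing F x {i}))
      f := fun i => chartι x ⟨{i}, Finset.singleton_nonempty i⟩
      mem₀ := by
        rw [Scheme.presieve₀_mem_precoverage_iff]
        refine ⟨fun z => ?_, fun i => inferInstance⟩
        obtain ⟨s, y, rfl⟩ := exists_chartι_eq x z
        obtain ⟨i, hi⟩ := s.2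
        have hle : (⟨{i}, Finset.singleton_nonempty i⟩ : {s : Finset ι // s.Nonempty}) ≤ s :=
          Finset.singleton_subset_iff.2 hi
        refine ⟨i, Spec.map (CommRingCat.ofHom (chartRestrict (F := F) x hle).toRingHom) y, ?_⟩
        rw [← chartRestrict_chartι x hle]
        rfl }
  have : ∀ i, IsReduced (𝒰.X i) := by
    intro i
    have : _root_.IsReduced (ChartRing F x {i}) := by
      rcases subsingleton_or_nontrivial (ChartRing F x {i}) with h | h
      · exact ⟨fun a _ => Subsingleton.elim _ _⟩
      · have := isDomain_chartRing (x := x) hψ hn i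
        infer_instance
    exact inferInstanceAs (IsReduced (Spec (.of (ChartRing F x {i}))))
  exact IsReduced.of_openCover _ 𝒰

/-- All nonempty charts have the same generic point: the annihilator of the generic matrix. -/
lemma exists_forall_specializes (hψ : Function.Bijective (splitLift ψ K)) (hn : 0 < n) (i₀ : ι)
    [Nontrivial (ChartRing F x {i₀})] : ∃ ξ : gluedScheme F x, ∀ z, ξ ⤳ z := by
  let L := ColumnField K n k
  let q := genericColumn K n k L
  let s : ι → {s : Finset ι // s.Nonempty} := fun i => ⟨{i}, Finset.singleton_nonempty i⟩
  let pt : Spec (.of L) := (⊥ : PrimeSpectrum L)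
  have h1 : ∀ i, Nontrivial (ChartRing F x {i}) → ∃ f : ChartRing F x {i} →ₐ[F] L,
      Function.Injective f ∧ ∀ y : L ⊗[F] A, y ∈ ((univPoint x (s i)).map f).ideal ↔
        splitLift ψ L y * q = 0 := by
    intro i _
    have h := isUniversalChart_univCoord (F := F) x i
    obtain ⟨hu, hinj⟩ := h.injective_columnField hψ hn
    obtain ⟨f, hf⟩ := h.exists_hom (isChartPoint_columnCoord hu)
    refine ⟨f, hinj f hf, fun y => ?_⟩
    rw [← toPoint_univCoord x (s i) ⟨i, Finset.mem_singleton_self i⟩, IsChartPoint.toPoint_map,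
      IsChartPoint.toPoint_ideal, ← mem_chartKer_columnCoord hu, ← hf]
  obtain ⟨f₀, -, hf₀⟩ := h1 i₀ inferInstance
  refine ⟨(chartSchemePoint x (s i₀) f₀).1 pt, fun z => ?_⟩
  obtain ⟨t, y, rfl⟩ := exists_chartι_eq x z
  obtain ⟨i, hi⟩ := t.2
  have hle : s i ≤ t := Finset.singleton_subset_iff.2 hi
  rw [← chartRestrict_chartι x hle]
  let p : PrimeSpectrum (ChartRing F x {i}) :=
    Spec.map (CommRingCat.ofHom (chartRestrict (F := F) x hle).toRingHom) y
  have hnt : Nontrivial (ChartRing F x {i}) := ⟨⟨1, 0, fun h => p.2.ne_top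
    ((Ideal.eq_top_iff_one _).2 (h ▸ zero_mem _))⟩⟩
  obtain ⟨f, hinj, hf⟩ := h1 i hnt
  have heq : chartSchemePoint x (s i₀) f₀ = chartSchemePoint x (s i) f := by
    refine MatchInChart.left_unique (I := (univPoint x (s i)).map f) ⟨s i₀, f₀, rfl, ?_⟩
      ⟨s i, f, rfl, rfl⟩
    ext y
    rw [hf, hf₀]
  rw [heq]
  have hsp : PrimeSpectrum.comap f.toRingHom ⊥ ⤳ p := by
    rw [← PrimeSpectrum.le_iff_specializes]
    intro c hc
    have hc' : f c = 0 := hc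
    rw [(map_eq_zero_iff f hinj).1 hc']
    exact zero_mem _
  exact hsp.map (chartι x (s i)).continuous

/-- The glued scheme is integral. -/
theorem isIntegral_gluedScheme (hψ : Function.Bijective (splitLift ψ K)) (hn : 0 < n) (i₀ : ι)
    [Nontrivial (ChartRing F x {i₀})] : IsIntegral (gluedScheme F x) := by
  have := isReduced_gluedScheme (x := x) hψ hn
  obtain ⟨ξ, hξ⟩ := exists_forall_specializes (x := x) hψ hn i₀
  have : IrreducibleSpace (gluedScheme F x) := by
    have h1 : closure {ξ} = Set.univ := Set.eq_univ_of_forall fun z => (hξ z).mem_closure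
    have h2 : IsIrreducible (closure {ξ}) := isIrreducible_singleton.closure
    rw [h1] at h2
    exact { isPreirreducible_univ := h2.2, toNonempty := ⟨ξ⟩ }
  exact isIntegral_of_irreducibleSpace_of_isReduced _

end Integrality

/-! ### Dimensions of principal one-sided ideals -/

section OneSidedIdeals

/-- In a matrix algebra over a field, the left and the right ideal generated by an element have
the same dimension. -/
lemma Matrix.finrank_range_mulLeft_eq {L : Type*} [Field L] {n : ℕ} (M : Matrix (Fin n) (Fin n) L) :
    Module.finrank L (LinearMap.range (LinearMap.mulLeft L M)) =
      Module.finrank L (LinearMap.range (LinearMap.mulRight L M)) := by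
  obtain ⟨l, l', D, hD⟩ := Matrix.Pivot.exists_list_transvec_mul_mul_list_transvec_eq_diagonal M
  set U := (l.map Matrix.TransvectionStruct.toMatrix).prod
  set V := (l'.map Matrix.TransvectionStruct.toMatrix).prod
  have hU : IsUnit U := by
    rw [Matrix.isUnit_iff_isUnit_det, Matrix.TransvectionStruct.det_toMatrix_prod]
    exact isUnit_one
  have hV : IsUnit V := by
    rw [Matrix.isUnit_iff_isUnit_det, Matrix.TransvectionStruct.det_toMatrix_prod]
    exact isUnit_one
  have bijL : ∀ {W : Matrix (Fin n) (Fin n) L}, IsUnit W →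
      Function.Bijective (LinearMap.mulLeft L W) := by
    rintro _ ⟨W, rfl⟩
    exact W.mulLeft_bijective
  have bijR : ∀ {W : Matrix (Fin n) (Fin n) L}, IsUnit W →
      Function.Bijective (LinearMap.mulRight L W) := by
    rintro _ ⟨W, rfl⟩
    exact W.mulRight_bijective
  have key : ∀ f g h : Matrix (Fin n) (Fin n) L →ₗ[L] Matrix (Fin n) (Fin n) L,
      Function.Bijective f → Function.Bijective h →
      Module.finrank L (LinearMap.range (f ∘ₗ g ∘ₗ h)) = Module.finrank L (LinearMap.range g) := by
    intro f g h hf hh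
    rw [LinearMap.range_comp, LinearMap.range_comp_of_range_eq_top _
      (LinearMap.range_eq_top.2 hh.2)]
    exact LinearEquiv.finrank_map_eq (LinearEquiv.ofBijective f hf) _
  have h1 : LinearMap.mulLeft L (Matrix.diagonal D) =
      LinearMap.mulLeft L U ∘ₗ LinearMap.mulLeft L M ∘ₗ LinearMap.mulLeft L V := by
    ext1 Z
    simp [← hD, mul_assoc]
  have h2 : LinearMap.mulRight L (Matrix.diagonal D) =
      LinearMap.mulRight L V ∘ₗ LinearMap.mulRight L M ∘ₗ LinearMap.mulRight L U := by
    ext1 Z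
    simp [← hD, mul_assoc]
  let τ := (Matrix.transposeLinearEquiv (Fin n) (Fin n) L L)
  have h3 : LinearMap.mulLeft L (Matrix.diagonal D) =
      τ.toLinearMap ∘ₗ LinearMap.mulRight L (Matrix.diagonal D) ∘ₗ τ.toLinearMap := by
    ext1 Z
    simp [τ, Matrix.transpose_mul]
  rw [← key _ (LinearMap.mulLeft L M) _ (bijL hU) (bijL hV), ← h1, h3,
    key _ _ _ τ.bijective τ.bijective, h2, key _ _ _ (bijR hV) (bijR hU)]

lemma finrank_range_mulLeft_eq {L B : Type*} [Field L] [Ring B] [Algebra L B] {n : ℕ}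
    (e : B ≃ₐ[L] Matrix (Fin n) (Fin n) L) (z : B) :
    Module.finrank L (LinearMap.range (LinearMap.mulLeft L z)) =
      Module.finrank L (LinearMap.range (LinearMap.mulRight L z)) := by
  have key : ∀ (f : B →ₗ[L] B) (g : Matrix (Fin n) (Fin n) L →ₗ[L] Matrix (Fin n) (Fin n) L),
      (∀ y, e (f y) = g (e y)) →
      Module.finrank L (LinearMap.range f) = Module.finrank L (LinearMap.range g) := by
    intro f g h
    have h1 : LinearMap.range g = (LinearMap.range f).map e.toLinearEquiv.toLinearMap := by
      rw [← LinearMap.range_comp]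
      ext y
      constructor
      · rintro ⟨y, rfl⟩
        exact ⟨e.symm y, by simp [h]⟩
      · rintro ⟨y, rfl⟩
        exact ⟨e y, (h y).symm⟩
    rw [h1]
    exact (LinearEquiv.finrank_map_eq e.toLinearEquiv _).symm
  rw [key _ (LinearMap.mulLeft L (e z)) (by simp), key _ (LinearMap.mulRight L (e z)) (by simp),
    Matrix.finrank_range_mulLeft_eq]

end OneSidedIdeals

/-! ### Coordinates with respect to families of elements -/

section Coordinates

variable {F : Type u} [Field F] {A : Type v} [Ring A] [Algebra F A] {r : ℕ} {μ : Type*} [Fintype μ]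
  [DecidableEq μ] (b : Module.Basis (Fin r ⊕ μ) F A) {R S : Type*} [CommRing R] [Algebra F R]
  [CommRing S] [Algebra F S]

/-- The determinant of a family of elements of `A_R` in a basis of `A`. -/
noncomputable def familyDet (w : Fin r ⊕ μ → R ⊗[F] A) : R := (b.baseChange R).det w

lemma map_familyDet (f : R →ₐ[F] S) (w : Fin r ⊕ μ → R ⊗[F] A) :
    f (familyDet b w) = familyDet b (baseChangeHom A f ∘ w) := by
  have key : ∀ (y : R ⊗[F] A) i, f ((b.baseChange R).repr y i) =
      (b.baseChange S).repr (baseChangeHom A f y) i := by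
    intro y i
    induction y with
    | zero => simp
    | tmul c a => simp
    | add y z hy hz => simp only [map_add, Finsupp.add_apply, hy, hz]
  rw [familyDet, familyDet, Module.Basis.det_apply, Module.Basis.det_apply]
  refine (AlgHom.map_det f _).trans ?_
  congr 1
  ext i j
  exact key _ _

variable {b}

/-- The `R`-basis of `A_R` given by a family with invertible determinant. -/
noncomputable def familyBasis {w : Fin r ⊕ μ → R ⊗[F] A} (h : IsUnit (familyDet b w)) :
    Module.Basis (Fin r ⊕ μ) R (R ⊗[F] A) :=
  Module.Basis.mk ((Module.Basis.is_basis_iff_det (b.baseChange R)).2 h).1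
    ((Module.Basis.is_basis_iff_det (b.baseChange R)).2 h).2.ge

lemma familyBasis_apply {w : Fin r ⊕ μ → R ⊗[F] A} (h : IsUnit (familyDet b w)) (i : Fin r ⊕ μ) :
    familyBasis h i = w i :=
  Module.Basis.mk_apply ..

/-- The first `r` coordinates in the basis given by a family with invertible determinant. -/
noncomputable def familyCoord {w : Fin r ⊕ μ → R ⊗[F] A} (h : IsUnit (familyDet b w)) :
    R ⊗[F] A →ₗ[R] (Fin r → R) :=
  (familyBasis h).constr R (Sum.elim (fun j => Pi.single j 1) fun _ => 0)

lemma familyCoord_inl {w : Fin r ⊕ μ → R ⊗[F] A} (h : IsUnit (familyDet b w)) (j : Fin r) :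
    familyCoord h (w (Sum.inl j)) = Pi.single j 1 := by
  rw [← familyBasis_apply h, familyCoord, Module.Basis.constr_basis, Sum.elim_inl]

lemma familyCoord_inr {w : Fin r ⊕ μ → R ⊗[F] A} (h : IsUnit (familyDet b w)) (i : μ) :
    familyCoord h (w (Sum.inr i)) = 0 := by
  rw [← familyBasis_apply h, familyCoord, Module.Basis.constr_basis, Sum.elim_inr]

lemma eq_familyCoord {w : Fin r ⊕ μ → R ⊗[F] A} (h : IsUnit (familyDet b w))
    {p : R ⊗[F] A →ₗ[R] (Fin r → R)} (h1 : ∀ j, p (w (Sum.inl j)) = Pi.single j 1)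
    (h2 : ∀ i, p (w (Sum.inr i)) = 0) : p = familyCoord h := by
  refine (familyBasis h).ext fun i => ?_
  rw [familyBasis_apply]
  cases i with
  | inl j => rw [h1, familyCoord_inl]
  | inr i => rw [h2, familyCoord_inr]

lemma exists_eq_sum {w : Fin r ⊕ μ → R ⊗[F] A} (h : IsUnit (familyDet b w)) (y : R ⊗[F] A) :
    ∃ t : μ → R, y = ∑ j, familyCoord h y j • w (Sum.inl j) + ∑ i, t i • w (Sum.inr i) := by
  let e := (familyBasis h).repr y
  have h1 : y = ∑ j, e (Sum.inl j) • w (Sum.inl j) + ∑ i, e (Sum.inr i) • w (Sum.inr i) := by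
    conv_lhs => rw [← (familyBasis h).sum_repr y, Fintype.sum_sum_type]
    simp only [familyBasis_apply, e]
  have h2 : familyCoord h y = fun j => e (Sum.inl j) := by
    conv_lhs => rw [h1]
    simp only [map_add, map_sum, map_smul, familyCoord_inl, familyCoord_inr, smul_zero,
      Finset.sum_const_zero, add_zero]
    ext l
    simp [Pi.single_apply]
  refine ⟨fun i => e (Sum.inr i), ?_⟩
  rw [h2]
  exact h1

lemma map_familyCoord {w : Fin r ⊕ μ → R ⊗[F] A} (h : IsUnit (familyDet b w)) (f : R →ₐ[F] S)
    {w' : Fin r ⊕ μ → S ⊗[F] A} (h' : IsUnit (familyDet b w'))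
    (hw : ∀ i, baseChangeHom A f (w i) = w' i) (y : R ⊗[F] A) (l : Fin r) :
    f (familyCoord h y l) = familyCoord h' (baseChangeHom A f y) l := by
  have hs : ∀ (c : R) (z : R ⊗[F] A),
      baseChangeHom A f (c • z) = f c • baseChangeHom A f z := by
    intro c z
    rw [Algebra.smul_def, map_mul, Algebra.smul_def]
    simp [Algebra.TensorProduct.algebraMap_apply]
  obtain ⟨t, ht⟩ := exists_eq_sum h y
  have h1 := congrArg (baseChangeHom A f) ht
  rw [map_add, map_sum, map_sum] at h1
  simp only [hs, hw] at h1
  rw [h1]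
  simp only [map_add, map_sum, map_smul, familyCoord_inl, familyCoord_inr, smul_zero,
    Finset.sum_const_zero, add_zero]
  simp [Pi.single_apply]

end Coordinates

/-! ### From left ideals to right ideals -/

section Reversal

variable {F : Type u} [Field F] {A : Type v} [Ring A] [Algebra F A] {r : ℕ} {μ : Type*}
  {R : Type*} [CommRing R] [Algebra F R] {S : Type*} [CommRing S] [Algebra F S]

/-- The projection of `1` to the left ideal with coordinate map `π`, along the span of the `x j`. -/
noncomputable def projOne (x : Fin r → A) (π : A →ₗ[F] (Fin r → R)) : R ⊗[F] A :=
  1 - ∑ j, π 1 j ⊗ₜ x j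

/-- The `x j`, and the left multiples `c i * projOne x π`. -/
noncomputable def leftFamily (x : Fin r → A) (c : μ → A) (π : A →ₗ[F] (Fin r → R)) :
    Fin r ⊕ μ → R ⊗[F] A :=
  Sum.elim (fun j => 1 ⊗ₜ x j) fun i => (1 ⊗ₜ c i) * projOne x π

/-- The `x j`, and the right multiples `projOne x π * c i`. -/
noncomputable def rightFamily (x : Fin r → A) (c : μ → A) (π : A →ₗ[F] (Fin r → R)) :
    Fin r ⊕ μ → R ⊗[F] A :=
  Sum.elim (fun j => 1 ⊗ₜ x j) fun i => projOne x π * (1 ⊗ₜ c i)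

variable {x : Fin r → A} {c : μ → A} {π : A →ₗ[F] (Fin r → R)}

lemma baseChangeHom_projOne (f : R →ₐ[F] S) :
    baseChangeHom A f (projOne x π) = projOne x (chartMap f π) := by
  simp [projOne]

lemma baseChangeHom_leftFamily (f : R →ₐ[F] S) (i : Fin r ⊕ μ) :
    baseChangeHom A f (leftFamily x c π i) = leftFamily x c (chartMap f π) i := by
  cases i <;> simp [leftFamily, ← baseChangeHom_projOne]

lemma baseChangeHom_rightFamily (f : R →ₐ[F] S) (i : Fin r ⊕ μ) :
    baseChangeHom A f (rightFamily x c π i) = rightFamily x c (chartMap f π) i := by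
  cases i <;> simp [rightFamily, ← baseChangeHom_projOne]

lemma IsChartPoint.lift_projOne (h : IsChartPoint x π) : π.liftBaseChange R (projOne x π) = 0 := by
  rw [projOne, map_sub, sub_eq_zero, Algebra.TensorProduct.one_def, liftBaseChange_one_tmul,
    map_sum]
  simp only [LinearMap.liftBaseChange_tmul, h.apply_self]
  ext l
  simp [Pi.single_apply]

variable [Fintype μ] [DecidableEq μ] {b : Module.Basis (Fin r ⊕ μ) F A}

/-- A chart point is the projection along the left multiples of `projOne x π`, where these are
complementary to the span of the `x j`. -/
lemma IsChartPoint.lift_eq_familyCoord (h : IsChartPoint x π)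
    (hl : IsUnit (familyDet b (leftFamily x c π))) :
    π.liftBaseChange R = familyCoord hl := by
  refine eq_familyCoord hl (fun j => ?_) fun i => ?_
  · exact (liftBaseChange_one_tmul π (x j)).trans (h.apply_self j)
  · exact h.mul_mem _ h.lift_projOne

/-- The span of the elements `projOne x π * c i` is the right ideal generated by `projOne x π`. -/
def IsRightAdapted (h : IsUnit (familyDet b (rightFamily x c π))) : Prop :=
  ∀ y, familyCoord h (projOne x π * y) = 0

/-- Over a field splitting `A`, the right ideal generated by `projOne x π` has the same dimension as
the left ideal it generates, which is contained in the kernel of `π`. -/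
lemma isRightAdapted_of_field {L : Type*} [Field L] [Algebra F L] [FiniteDimensional F A] {n : ℕ}
    (e : L ⊗[F] A ≃ₐ[L] Matrix (Fin n) (Fin n) L) {π : A →ₗ[F] (Fin r → L)}
    (h : IsChartPoint x π) (hr : IsUnit (familyDet b (rightFamily x c π))) :
    IsRightAdapted hr := by
  set X := projOne x π
  have hsurj : Function.Surjective (familyCoord hr) := by
    intro v
    refine ⟨∑ j, v j • rightFamily x c π (Sum.inl j), ?_⟩
    simp only [map_sum, map_smul, familyCoord_inl]
    ext l
    simp [Pi.single_apply]
  have h1 := LinearMap.finrank_range_add_finrank_ker (familyCoord hr)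
  have h2 := LinearMap.finrank_range_add_finrank_ker (π.liftBaseChange L)
  rw [LinearMap.range_eq_top.2 hsurj] at h1
  rw [LinearMap.range_eq_top.2 h.surjective] at h2
  have h3 : LinearMap.range (LinearMap.mulRight L X) ≤ LinearMap.ker (π.liftBaseChange L) := by
    rintro _ ⟨y, rfl⟩
    exact h.mul_mem y h.lift_projOne
  have h4 : LinearMap.ker (familyCoord hr) ≤ LinearMap.range (LinearMap.mulLeft L X) := by
    intro y hy
    obtain ⟨t, ht⟩ := exists_eq_sum hr y
    rw [LinearMap.mem_ker.1 hy] at ht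
    refine ⟨∑ i, t i • (1 ⊗ₜ c i), ?_⟩
    rw [ht]
    simp [rightFamily, X]
  have h5 := Submodule.finrank_mono h3
  rw [← finrank_range_mulLeft_eq e] at h5
  have h6 := Submodule.eq_of_le_of_finrank_le h4 (by omega)
  intro y
  exact LinearMap.mem_ker.1 (h6.symm ▸ ⟨y, rfl⟩)

lemma isUnit_rightDet_map (hr : IsUnit (familyDet b (rightFamily x c π))) (f : R →ₐ[F] S) :
    IsUnit (familyDet b (rightFamily x c (chartMap f π))) := by
  have h1 := hr.map f
  rw [map_familyDet] at h1
  rwa [show rightFamily x c (chartMap f π) = _ from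
    funext fun i => (baseChangeHom_rightFamily f i).symm]

lemma isRightAdapted_of_injective (hr : IsUnit (familyDet b (rightFamily x c π))) (f : R →ₐ[F] S)
    (hf : Function.Injective f) (h : IsRightAdapted (isUnit_rightDet_map hr f)) :
    IsRightAdapted hr := by
  intro y
  ext l
  apply hf
  rw [map_familyCoord hr f (isUnit_rightDet_map hr f) (baseChangeHom_rightFamily f), map_mul,
    baseChangeHom_projOne, h]
  exact (map_zero f).symm

section AntiIsomorphism

variable {A' : Type v} [Ring A'] [Algebra F A'] (θ : A ≃ₗ[F] A')

/-- The coordinate map of the right ideal generated by `projOne x π`, regarded as a left ideal of an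
algebra anti-isomorphic to `A`. -/
noncomputable def reverse (hr : IsUnit (familyDet b (rightFamily x c π))) :
    A' →ₗ[F] (Fin r → R) :=
  (familyCoord hr).restrictScalars F ∘ₗ TensorProduct.mk F R A 1 ∘ₗ θ.symm.toLinearMap

lemma reverse_apply (hr : IsUnit (familyDet b (rightFamily x c π))) (a : A) :
    reverse θ hr (θ a) = familyCoord hr (1 ⊗ₜ a) := by
  simp [reverse]

lemma chartMap_reverse (hr : IsUnit (familyDet b (rightFamily x c π))) (f : R →ₐ[F] S) :
    chartMap f (reverse θ hr) = reverse θ (isUnit_rightDet_map hr f) := by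
  ext a l
  obtain ⟨a, rfl⟩ := θ.surjective a
  rw [chartMap_apply, reverse_apply, reverse_apply,
    map_familyCoord hr f (isUnit_rightDet_map hr f) (baseChangeHom_rightFamily f)]
  simp

variable {θ}

lemma isChartPoint_reverse (hθ : ∀ a b, θ (a * b) = θ b * θ a)
    (hr : IsUnit (familyDet b (rightFamily x c π)))
    (h : IsRightAdapted hr) : IsChartPoint (θ ∘ x) (reverse θ hr) where
  apply_self j := (reverse_apply θ hr (x j)).trans (familyCoord_inl hr j)
  apply_mul a b := by
    obtain ⟨a, rfl⟩ := θ.surjective a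
    obtain ⟨b, rfl⟩ := θ.surjective b
    have key : ∀ y z, familyCoord hr y = 0 → familyCoord hr (y * z) = 0 := by
      intro y z hy
      obtain ⟨t, ht⟩ := exists_eq_sum hr y
      rw [hy] at ht
      have h1 : y = projOne x π * ∑ i, t i • (1 ⊗ₜ c i) := by
        rw [ht]
        simp [Finset.mul_sum, rightFamily]
      rw [h1, mul_assoc]
      exact h _
    have h1 : familyCoord hr ((1 ⊗ₜ b) - ∑ j, familyCoord hr (1 ⊗ₜ b) j • (1 ⊗ₜ x j)) = 0 := by
      have h2 : ∀ j, familyCoord hr (1 ⊗ₜ x j) = Pi.single j 1 := familyCoord_inl hr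
      rw [map_sub, sub_eq_zero, map_sum]
      simp only [map_smul, h2]
      ext l
      simp [Pi.single_apply]
    have h2 := key _ (1 ⊗ₜ a) h1
    rw [sub_mul, map_sub, sub_eq_zero, Finset.sum_mul, map_sum] at h2
    simp only [smul_mul_assoc, map_smul, Algebra.TensorProduct.tmul_mul_tmul, mul_one] at h2
    simp only [← hθ, Function.comp_apply, reverse_apply, h2]

lemma map_one_of_antihom (hθ : ∀ a b, θ (a * b) = θ b * θ a) : θ 1 = 1 := by
  obtain ⟨a, ha⟩ := θ.surjective 1
  have h1 := hθ a 1
  rwa [ha, mul_one, mul_one, ha, eq_comm] at h1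

lemma reverse_one (hθ : ∀ a b, θ (a * b) = θ b * θ a)
    (hr : IsUnit (familyDet b (rightFamily x c π))) (h : IsRightAdapted hr) :
    reverse θ hr 1 = π 1 := by
  have h1 := h 1
  have h2 : ∀ j, familyCoord hr (1 ⊗ₜ x j) = Pi.single j 1 := familyCoord_inl hr
  have h3 : ∀ j, (π 1 j ⊗ₜ x j : R ⊗[F] A) = π 1 j • (1 ⊗ₜ x j) := by
    intro j
    rw [TensorProduct.smul_tmul', smul_eq_mul, mul_one]
  rw [mul_one, projOne, map_sub, sub_eq_zero, map_sum] at h1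
  simp only [h3, map_smul, h2] at h1
  rw [← map_one_of_antihom hθ, reverse_apply, ← Algebra.TensorProduct.one_def, h1]
  ext l
  simp [Pi.single_apply]

lemma baseChange_antihom_mul (hθ : ∀ a b, θ (a * b) = θ b * θ a) (y z : R ⊗[F] A) :
    θ.baseChange F R A A' (y * z) = θ.baseChange F R A A' z * θ.baseChange F R A A' y := by
  induction y with
  | zero => simp
  | add y y' hy hy' => rw [add_mul, map_add, map_add, mul_add, hy, hy']
  | tmul s a =>
    induction z with
    | zero => simp
    | add z z' hz hz' => rw [mul_add, map_add, map_add, add_mul, hz, hz']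
    | tmul t a' => simp [hθ, mul_comm s t]

/-- Reversing a point does not change the projection of `1`: the element `projOne x π` lies in the
right ideal it generates, and `1 - projOne x π` lies in the span of the `x j`. -/
lemma projOne_reverse (hθ : ∀ a b, θ (a * b) = θ b * θ a)
    (hr : IsUnit (familyDet b (rightFamily x c π))) (h : IsRightAdapted hr) :
    projOne (θ ∘ x) (reverse θ hr) = θ.baseChange F R A A' (projOne x π) := by
  rw [projOne, reverse_one hθ hr h, projOne, map_sub, map_sum, Algebra.TensorProduct.one_def,
    Algebra.TensorProduct.one_def, LinearEquiv.baseChange_tmul, map_one_of_antihom hθ]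
  simp

lemma rightFamily_reverse (hθ : ∀ a b, θ (a * b) = θ b * θ a)
    (hr : IsUnit (familyDet b (rightFamily x c π))) (h : IsRightAdapted hr) :
    rightFamily (θ ∘ x) (θ ∘ c) (reverse θ hr) = θ.baseChange F R A A' ∘ leftFamily x c π := by
  ext1 i
  cases i with
  | inl j => simp [rightFamily, leftFamily]
  | inr i => simp [rightFamily, leftFamily, baseChange_antihom_mul hθ, projOne_reverse hθ hr h]

lemma leftFamily_reverse (hθ : ∀ a b, θ (a * b) = θ b * θ a)
    (hr : IsUnit (familyDet b (rightFamily x c π))) (h : IsRightAdapted hr) :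
    leftFamily (θ ∘ x) (θ ∘ c) (reverse θ hr) = θ.baseChange F R A A' ∘ rightFamily x c π := by
  ext1 i
  cases i with
  | inl j => simp [rightFamily, leftFamily]
  | inr i => simp [rightFamily, leftFamily, baseChange_antihom_mul hθ, projOne_reverse hθ hr h]

lemma familyDet_map (w : Fin r ⊕ μ → R ⊗[F] A) :
    familyDet (b.map θ) (θ.baseChange F R A A' ∘ w) = familyDet b w := by
  rw [familyDet, familyDet, Module.Basis.det_apply, Module.Basis.det_apply]
  congr 1
  ext i j
  have key : ∀ y : R ⊗[F] A, ((b.map θ).baseChange R).repr (θ.baseChange F R A A' y) i =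
      (b.baseChange R).repr y i := by
    intro y
    induction y with
    | zero => simp
    | tmul c a => simp
    | add y z hy hz => simp only [map_add, Finsupp.add_apply, hy, hz]
  exact key _

/-- Reversing twice gives back the original point. -/
lemma reverse_reverse (hθ : ∀ a b, θ (a * b) = θ b * θ a) {θ' : A' ≃ₗ[F] A}
    (hθ' : ∀ a, θ' (θ a) = a) (hπ : IsChartPoint x π)
    (hl : IsUnit (familyDet b (leftFamily x c π))) (hr : IsUnit (familyDet b (rightFamily x c π)))
    (h : IsRightAdapted hr)
    (hr' : IsUnit (familyDet (b.map θ) (rightFamily (θ ∘ x) (θ ∘ c) (reverse θ hr)))) :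
    reverse θ' hr' = π := by
  ext1 a
  have h1 : ((familyCoord hr') ∘ₗ (θ.baseChange F R A A').toLinearMap) = familyCoord hl := by
    refine eq_familyCoord hl (fun j => ?_) fun i => ?_
    · exact (congrArg (familyCoord hr') (congrFun (rightFamily_reverse hθ hr h)
        (Sum.inl j))).symm.trans (familyCoord_inl hr' j)
    · exact (congrArg (familyCoord hr') (congrFun (rightFamily_reverse hθ hr h)
        (Sum.inr i))).symm.trans (familyCoord_inr hr' i)
  have h2 : reverse θ' hr' a = familyCoord hr' (1 ⊗ₜ θ a) := by
    rw [← reverse_apply θ' hr' (θ a), hθ']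
  have h3 : familyCoord hr' (1 ⊗ₜ θ a) = familyCoord hl (1 ⊗ₜ a) := by
    rw [← h1]
    simp
  rw [h2, h3, ← hπ.lift_eq_familyCoord, liftBaseChange_one_tmul]

end AntiIsomorphism

end Reversal

/-! ### The birational map between charts -/

section BirationalMap

variable {F : Type u} [Field F] {A : Type v} [Ring A] [Algebra F A] {n k : ℕ} {μ : Type*}
  [Fintype μ] [DecidableEq μ] {b : Module.Basis (Fin (k * n) ⊕ μ) F A} {x : Fin (k * n) → A}
  {c : μ → A}

/-- The function on a chart which is invertible at `π` if and only if the left multiples of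
`projOne x π` by the `c i` and its right multiples by the `c i` both span complements of the span of
the `x j`. -/
noncomputable def reversalLocus (b : Module.Basis (Fin (k * n) ⊕ μ) F A) (x : Fin (k * n) → A)
    (c : μ → A) {R : Type*} [CommRing R] [Algebra F R] (π : A →ₗ[F] (Fin (k * n) → R)) : R :=
  familyDet b (leftFamily x c π) * familyDet b (rightFamily x c π)

lemma map_reversalLocus {R S : Type*} [CommRing R] [Algebra F R] [CommRing S] [Algebra F S]
    (f : R →ₐ[F] S) (π : A →ₗ[F] (Fin (k * n) → R)) :
    f (reversalLocus b x c π) = reversalLocus b x c (chartMap f π) := by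
  rw [reversalLocus, map_mul, map_familyDet, map_familyDet, reversalLocus,
    show leftFamily x c (chartMap f π) = _ from funext fun i => (baseChangeHom_leftFamily f i).symm,
    show rightFamily x c (chartMap f π) = _ from
      funext fun i => (baseChangeHom_rightFamily f i).symm]
  rfl

lemma isUnit_reversalLocus_away {R : Type*} [CommRing R] [Algebra F R]
    (π : A →ₗ[F] (Fin (k * n) → R)) :
    IsUnit (reversalLocus b x c (chartMap (awayHom F (reversalLocus b x c π)) π)) := by
  rw [← map_reversalLocus]
  exact IsLocalization.Away.algebraMap_isUnit (reversalLocus b x c π)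

variable {O : Type u} [CommRing O] [Algebra F O] {π : A →ₗ[F] (Fin (k * n) → O)}

/-- The universal point of a localized chart is right adapted, since the coordinate ring embeds
into a field splitting `A`. -/
lemma IsUniversalChart.isRightAdapted [FiniteDimensional F A] [Nontrivial O]
    (h : IsUniversalChart x π) {K : Type u} [Field K] [Algebra F K]
    {ψ : A →ₐ[F] Matrix (Fin n) (Fin n) K} (hψ : Function.Bijective (splitLift ψ K)) (hn : 0 < n)
    {D : O} (hr : IsUnit (familyDet b (rightFamily x c (chartMap (awayHom F D) π)))) :
    IsRightAdapted hr := by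
  by_cases hD : D = 0
  · have : Subsingleton (Localization.Away D) := by
      have h1 := IsLocalization.Away.algebraMap_isUnit (S := Localization.Away D) D
      have h2 : algebraMap O (Localization.Away D) D = 0 := by rw [hD, map_zero]
      rw [h2, isUnit_zero_iff] at h1
      exact subsingleton_of_zero_eq_one h1
    intro y
    ext l
    exact Subsingleton.elim _ _
  · obtain ⟨hu, hinj⟩ := h.injective_columnField hψ hn
    obtain ⟨f, hf⟩ := h.exists_hom (isChartPoint_columnCoord hu)
    have hfD : IsUnit (f D) := ((map_ne_zero_iff f (hinj f hf)).2 hD).isUnit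
    refine isRightAdapted_of_injective hr (awayLift D f hfD)
      (awayLift_injective D f hfD (hinj f hf)) ?_
    exact isRightAdapted_of_field (splitEquiv (ColumnField K n k) hψ)
      ((h.isChartPoint.map _).map _) _

variable {A' : Type v} [Ring A'] [Algebra F A'] {θ : A ≃ₗ[F] A'}
  {b' : Module.Basis (Fin (k * n) ⊕ μ) F A'} {x' : Fin (k * n) → A'} {c' : μ → A'}
  {O' : Type u} [CommRing O'] [Algebra F O'] {π' : A' →ₗ[F] (Fin (k * n) → O')}

lemma reversalLocus_reverse (hθ : ∀ a b, θ (a * b) = θ b * θ a) {R : Type*} [CommRing R]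
    [Algebra F R] {π : A →ₗ[F] (Fin (k * n) → R)}
    {hr : IsUnit (familyDet b (rightFamily x c π))} (h : IsRightAdapted hr) :
    reversalLocus (b.map θ) (θ ∘ x) (θ ∘ c) (reverse θ hr) = reversalLocus b x c π := by
  rw [reversalLocus, leftFamily_reverse hθ hr h, rightFamily_reverse hθ hr h, familyDet_map,
    familyDet_map, mul_comm]
  rfl

/-- Sending a left ideal to the right ideal generated by `projOne x π` is a morphism between the
open subschemes of the charts on which the functions `reversalLocus` are invertible. -/
lemma IsUniversalChart.exists_reversal (h' : IsUniversalChart x' π')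
    (hθ : ∀ a b, θ (a * b) = θ b * θ a) (hb : b' = b.map θ) (hx : x' = θ ∘ x) (hc : c' = θ ∘ c)
    {hr : IsUnit (familyDet b
      (rightFamily x c (chartMap (awayHom F (reversalLocus b x c π)) π)))} (h : IsRightAdapted hr) :
    ∃ g : Localization.Away (reversalLocus b' x' c' π') →ₐ[F]
        Localization.Away (reversalLocus b x c π),
      chartMap g (chartMap (awayHom F (reversalLocus b' x' c' π')) π') = reverse θ hr := by
  subst hb hx hc
  obtain ⟨g, hg⟩ := h'.exists_hom (isChartPoint_reverse hθ hr h)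
  have hu : IsUnit (g (reversalLocus (b.map θ) (θ ∘ x) (θ ∘ c) π')) := by
    rw [map_reversalLocus, hg, reversalLocus_reverse hθ h]
    exact isUnit_reversalLocus_away π
  exact ⟨awayLift _ g hu, by rw [← chartMap_comp, awayLift_comp, hg]⟩

lemma reverse_congr {R : Type*} [CommRing R] [Algebra F R] {π₁ π₂ : A →ₗ[F] (Fin (k * n) → R)}
    (h : π₁ = π₂) (h₁ : IsUnit (familyDet b (rightFamily x c π₁)))
    (h₂ : IsUnit (familyDet b (rightFamily x c π₂))) : reverse θ h₁ = reverse θ h₂ := by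
  subst h
  rfl

/-- The reversals in the two directions are inverse to each other on the localized charts. -/
lemma IsUniversalChart.reversal_comp_reversal (hO : IsUniversalChart x π) {θ' : A' ≃ₗ[F] A}
    (hθ : ∀ a b, θ (a * b) = θ b * θ a) (hθ' : ∀ a, θ' (θ a) = a)
    (hb : b' = b.map θ) (hx : x' = θ ∘ x) (hc : c' = θ ∘ c)
    {hr : IsUnit (familyDet b
      (rightFamily x c (chartMap (awayHom F (reversalLocus b x c π)) π)))} (h : IsRightAdapted hr)
    {hr' : IsUnit (familyDet b'
      (rightFamily x' c' (chartMap (awayHom F (reversalLocus b' x' c' π')) π')))}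
    {g : Localization.Away (reversalLocus b' x' c' π') →ₐ[F]
        Localization.Away (reversalLocus b x c π)}
    (hg : chartMap g (chartMap (awayHom F (reversalLocus b' x' c' π')) π') = reverse θ hr)
    {g' : Localization.Away (reversalLocus b x c π) →ₐ[F]
        Localization.Away (reversalLocus b' x' c' π')}
    (hg' : chartMap g' (chartMap (awayHom F (reversalLocus b x c π)) π) = reverse θ' hr') :
    g.comp g' = AlgHom.id F _ := by
  subst hb hx hc
  refine away_algHom_ext _ (hO.hom_ext ?_)
  rw [chartMap_comp, chartMap_comp, hg', chartMap_reverse]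
  have hr'' := isUnit_rightDet_map hr' g
  rw [hg] at hr''
  refine (reverse_congr hg _ hr'').trans
    (reverse_reverse hθ hθ' (hO.isChartPoint.map _) ?_ hr h hr'')
  exact (IsUnit.mul_iff.1 (isUnit_reversalLocus_away (b := b) (x := x) (c := c) π)).1

/-- Corresponding charts for `A` and for an anti-isomorphic algebra `A'` have isomorphic principal
open subschemes, namely those on which the functions `reversalLocus` are invertible. -/
theorem IsUniversalChart.exists_algEquiv [FiniteDimensional F A] [FiniteDimensional F A']
    [Nontrivial O] (hO : IsUniversalChart x π)
    (hO' : IsUniversalChart (θ ∘ x) π') (hθ : ∀ a b, θ (a * b) = θ b * θ a) {K : Type u} [Field K]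
    [Algebra F K] {ψ : A →ₐ[F] Matrix (Fin n) (Fin n) K}
    (hψ : Function.Bijective (splitLift ψ K)) {ψ' : A' →ₐ[F] Matrix (Fin n) (Fin n) K}
    (hψ' : Function.Bijective (splitLift ψ' K)) (hn : 0 < n) (hD : reversalLocus b x c π ≠ 0) :
    ∃ D : O, ∃ D' : O', D ≠ 0 ∧ D' ≠ 0 ∧
      Nonempty (Localization.Away D ≃ₐ[F] Localization.Away D') := by
  have hr := (IsUnit.mul_iff.1 (isUnit_reversalLocus_away (b := b) (x := x) (c := c) π)).2
  have hr' := (IsUnit.mul_iff.1 (isUnit_reversalLocus_away (b := b.map θ) (x := θ ∘ x)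
    (c := θ ∘ c) π')).2
  have had : IsRightAdapted hr := hO.isRightAdapted hψ hn hr
  obtain ⟨g, hg⟩ := hO'.exists_reversal hθ rfl rfl rfl had
  have hnt : Nontrivial (Localization.Away (reversalLocus b x c π)) := by
    obtain ⟨hu, hinj⟩ := hO.injective_columnField hψ hn
    obtain ⟨f, hf⟩ := hO.exists_hom (isChartPoint_columnCoord hu)
    have hfD := ((map_ne_zero_iff f (hinj f hf)).2 hD).isUnit
    exact (awayLift _ f hfD).toRingHom.domain_nontrivial
  have hnt' : Nontrivial (Localization.Away (reversalLocus (b.map θ) (θ ∘ x) (θ ∘ c) π')) :=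
    g.toRingHom.domain_nontrivial
  have : Nontrivial O' :=
    (awayHom F (reversalLocus (b.map θ) (θ ∘ x) (θ ∘ c) π')).toRingHom.domain_nontrivial
  have had' : IsRightAdapted hr' := hO'.isRightAdapted hψ' hn hr'
  have hθ' : ∀ a b, θ.symm (a * b) = θ.symm b * θ.symm a := by
    intro a b
    apply θ.injective
    simp [hθ]
  have hb : b = (b.map θ).map θ.symm := by ext; simp
  have hx : x = θ.symm ∘ (θ ∘ x) := by ext; simp
  have hc : c = θ.symm ∘ (θ ∘ c) := by ext; simp
  obtain ⟨g', hg'⟩ := hO.exists_reversal hθ' hb hx hc had'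
  refine ⟨_, reversalLocus (b.map θ) (θ ∘ x) (θ ∘ c) π', hD, ?_, ⟨AlgEquiv.ofAlgHom g' g
    (hO'.reversal_comp_reversal hθ' θ.apply_symm_apply hb hx hc had' hg' hg)
    (hO.reversal_comp_reversal hθ θ.symm_apply_apply rfl rfl rfl had hg hg')⟩⟩
  intro h0
  have h1 := IsLocalization.Away.algebraMap_isUnit
    (S := Localization.Away (reversalLocus (b.map θ) (θ ∘ x) (θ ∘ c) π'))
    (reversalLocus (b.map θ) (θ ∘ x) (θ ∘ c) π')
  rw [show algebraMap O' (Localization.Away (reversalLocus (b.map θ) (θ ∘ x) (θ ∘ c) π'))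
    (reversalLocus (b.map θ) (θ ∘ x) (θ ∘ c) π') = 0 from (congrArg _ h0).trans (map_zero _)] at h1
  exact not_isUnit_zero h1

end BirationalMap

/-! ### A family of matrices in general position -/

section MatrixFamilies

variable {n k : ℕ} {I : Type*} [Fintype I] [DecidableEq I] (E : I ≃ Fin n × Fin n)

/-- The determinant of a family of `n ^ 2` matrices of size `n × n`. -/
noncomputable def matrixFamilyDet {R : Type*} [CommRing R] (v : I → Matrix (Fin n) (Fin n) R) : R :=
  (Matrix.of fun i j => v i (E j).1 (E j).2).det

lemma matrixFamilyDet_ne_zero_iff {L : Type*} [Field L] (v : I → Matrix (Fin n) (Fin n) L) :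
    matrixFamilyDet E v ≠ 0 ↔ LinearIndependent L v := by
  let φ : Matrix (Fin n) (Fin n) L →ₗ[L] (I → L) :=
    { toFun := fun M j => M (E j).1 (E j).2
      map_add' := fun _ _ => rfl
      map_smul' := fun _ _ => rfl }
  have hφ : LinearMap.ker φ = ⊥ := by
    rw [LinearMap.ker_eq_bot']
    intro M hM
    ext a b
    have : M (E (E.symm (a, b))).1 (E (E.symm (a, b))).2 = 0 := congrFun hM (E.symm (a, b))
    simpa using this
  rw [← LinearMap.linearIndependent_iff φ hφ]
  have h1 : LinearIndependent L (φ ∘ v) ↔ IsUnit (Matrix.of fun i j => v i (E j).1 (E j).2) :=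
    Matrix.linearIndependent_rows_iff_isUnit
  rw [h1, Matrix.isUnit_iff_isUnit_det, isUnit_iff_ne_zero]
  rfl

lemma matrixFamilyDet_ne_zero_of_single_mem {L : Type*} [Field L]
    (v : I → Matrix (Fin n) (Fin n) L)
    (h : ∀ a b, Matrix.single a b 1 ∈ Submodule.span L (Set.range v)) :
    matrixFamilyDet E v ≠ 0 := by
  rw [matrixFamilyDet_ne_zero_iff]
  apply linearIndependent_of_top_le_span_of_card_eq_finrank
  · intro M _
    rw [Matrix.matrix_eq_sum_single M]
    refine Submodule.sum_mem _ fun a _ => Submodule.sum_mem _ fun b _ => ?_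
    have : Matrix.single a b (M a b) = M a b • Matrix.single a b (1 : L) := by simp
    rw [this]
    exact Submodule.smul_mem _ _ (h a b)
  · rw [Module.finrank_matrix, Fintype.card_congr E]
    simp

/-- The first `k` columns of the identity matrix of size `n`. -/
def standardColumn (R : Type*) [CommRing R] (n k : ℕ) : Matrix (Fin n) (Fin k) R :=
  Matrix.of fun i j => if i.val = j.val then 1 else 0

/-- The matrix `columnMatrix` of the standard columns, for a family of matrices. -/
noncomputable def frameMatrix {R : Type*} [CommRing R]
    (m : Fin (k * n) → Matrix (Fin n) (Fin n) R) : Matrix (Fin (k * n)) (Fin (k * n)) R :=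
  Matrix.of fun j => entries R n k (m j * standardColumn R n k)

/-- The element `projOne` of the annihilator of the standard columns, multiplied by the determinant
of `frameMatrix m` so that it becomes polynomial in `m`. -/
noncomputable def scaledProjOne {R : Type*} [CommRing R]
    (m : Fin (k * n) → Matrix (Fin n) (Fin n) R) : Matrix (Fin n) (Fin n) R :=
  (frameMatrix m).det • 1 - ∑ j, Matrix.vecMul (entries R n k (standardColumn R n k))
    (frameMatrix m).adjugate j • m j

variable {μ : Type*} [Fintype μ] [DecidableEq μ] (E : Fin (k * n) ⊕ μ ≃ Fin n × Fin n)

/-- A polynomial in the entries of a family of matrices. Where it does not vanish, the annihilator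
of the standard columns lies in the chart given by the first `k * n` members of the family, and
`reversalLocus`, formed with the other members, does not vanish at it. -/
noncomputable def scaledReversalLocus {R : Type*} [CommRing R]
    (m : Fin (k * n) ⊕ μ → Matrix (Fin n) (Fin n) R) : R :=
  (frameMatrix (m ∘ Sum.inl)).det *
    matrixFamilyDet E (Sum.elim (m ∘ Sum.inl) fun i =>
      m (Sum.inr i) * scaledProjOne (m ∘ Sum.inl)) *
    matrixFamilyDet E (Sum.elim (m ∘ Sum.inl) fun i =>
      scaledProjOne (m ∘ Sum.inl) * m (Sum.inr i))

lemma map_scaledReversalLocus {R S : Type*} [CommRing R] [CommRing S] (f : R →+* S)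
    (m : Fin (k * n) ⊕ μ → Matrix (Fin n) (Fin n) R) :
    f (scaledReversalLocus E m) = scaledReversalLocus E fun i => (m i).map f := by
  have h1 : ∀ v : Fin (k * n) ⊕ μ → Matrix (Fin n) (Fin n) R,
      f (matrixFamilyDet E v) = matrixFamilyDet E fun i => (v i).map f := by
    intro v
    exact f.map_det _
  have hq : ∀ i j, f (standardColumn R n k i j) = standardColumn S n k i j := by
    intro i j
    simp only [standardColumn, Matrix.of_apply]
    split_ifs
    · exact map_one f
    · exact map_zero f
  have h2 : frameMatrix ((fun i => (m i).map f) ∘ Sum.inl) =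
      f.mapMatrix (frameMatrix (m ∘ Sum.inl)) := by
    ext j l
    simp [frameMatrix, entries_apply, Matrix.mul_apply, hq]
  have h3 : scaledProjOne ((fun i => (m i).map f) ∘ Sum.inl) =
      (scaledProjOne (m ∘ Sum.inl)).map f := by
    have h4 : entries S n k (standardColumn S n k) =
        f ∘ entries R n k (standardColumn R n k) := by
      ext l
      simp [entries_apply, hq]
    rw [scaledProjOne, h2, ← RingHom.map_adjugate, ← RingHom.map_det, scaledProjOne, h4]
    ext a b
    simp [Matrix.sum_apply, Matrix.one_apply, apply_ite f, Matrix.vecMul, dotProduct]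
  have h5 : ∀ M N : Matrix (Fin n) (Fin n) R, (M * N).map f = M.map f * N.map f := by
    intro M N
    exact f.mapMatrix.map_mul M N
  rw [scaledReversalLocus, map_mul, map_mul, h1, h1, f.map_det, ← h2, scaledReversalLocus, h3]
  congr 2
  · congr 1
    ext1 i
    cases i <;> simp only [Sum.elim_inl, Sum.elim_inr, Function.comp_apply, h5]
  · ext1 i
    cases i <;> simp only [Sum.elim_inl, Sum.elim_inr, Function.comp_apply, h5]

/-- The pairs of indices whose first member is at least `k`. -/
abbrev LargeIndex (n k : ℕ) : Type := {p : Fin n × Fin n // ¬ p.1.val < k}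

/-- The pairs of indices, split according to whether the first member is less than `k`. -/
def indexEquiv (hk : k ≤ n) : Fin (k * n) ⊕ LargeIndex n k ≃ Fin n × Fin n :=
  (Equiv.sumCongr (finProdFinEquiv.symm.trans
    { toFun := fun p => ⟨(Fin.castLE hk p.1, p.2), p.1.2⟩
      invFun := fun p => (⟨p.1.1, p.2⟩, p.1.2)
      left_inv := fun _ => rfl
      right_inv := fun _ => rfl }) (Equiv.refl _)).trans
    (Equiv.sumCompl fun p : Fin n × Fin n => p.1.val < k)

lemma indexEquiv_inl (hk : k ≤ n) (l : Fin (k * n)) : indexEquiv hk (Sum.inl l) =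
    (Fin.castLE hk (finProdFinEquiv.symm l).1, (finProdFinEquiv.symm l).2) := rfl

/-- A family of matrices at which `scaledReversalLocus` does not vanish: the elementary matrices,
those in the off-diagonal blocks of sizes `k × (n - k)` and `(n - k) × k` being replaced by
symmetric matrices. -/
def standardFamily (L : Type*) [CommRing L] (n k : ℕ) (p : Fin n × Fin n) :
    Matrix (Fin n) (Fin n) L :=
  Matrix.single p.2 p.1 1 + if p.1.val < k ↔ p.2.val < k then 0 else Matrix.single p.1 p.2 1

lemma frameMatrix_standardFamily {L : Type*} [Field L] (hk : k ≤ n) :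
    frameMatrix (fun l => standardFamily L n k (indexEquiv hk (Sum.inl l))) = 1 := by
  ext l l'
  obtain ⟨⟨i, j⟩, rfl⟩ := finProdFinEquiv.surjective l
  obtain ⟨⟨i', j'⟩, rfl⟩ := finProdFinEquiv.surjective l'
  have hi := i.2
  have hi' := i'.2
  rw [frameMatrix, Matrix.of_apply, entries_apply, indexEquiv_inl]
  simp only [Equiv.symm_apply_apply, Matrix.mul_apply, standardColumn, Matrix.of_apply]
  rw [Finset.sum_eq_single (Fin.castLE hk i')]
  · simp only [standardFamily, Fin.val_castLE, if_true, mul_one, hi, true_iff, Matrix.add_apply,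
      Matrix.one_apply, finProdFinEquiv.injective.eq_iff, Prod.mk.injEq]
    have h1 : (if j.val < k then (0 : Matrix (Fin n) (Fin n) L) else
        Matrix.single (Fin.castLE hk i) j 1) j' (Fin.castLE hk i') = 0 := by
      split_ifs with h
      · rfl
      · rw [Matrix.single_apply, if_neg]
        rintro ⟨-, h2⟩
        rw [h2] at h
        exact h hi'
    rw [h1, add_zero, Matrix.single_apply]
    simp only [Fin.castLE_inj, and_comm]
  · intro a _ ha
    rw [if_neg, mul_zero]
    intro h
    exact ha (Fin.ext h)
  · simp

lemma scaledProjOne_standardFamily {L : Type*} [Field L] (hk : k ≤ n) :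
    scaledProjOne (fun l => standardFamily L n k (indexEquiv hk (Sum.inl l))) =
      Matrix.diagonal fun i : Fin n => if i.val < k then 0 else 1 := by
  rw [scaledProjOne, frameMatrix_standardFamily, Matrix.det_one, one_smul, Matrix.adjugate_one,
    Matrix.vecMul_one, ← finProdFinEquiv.sum_comp, Fintype.sum_prod_type]
  have h1 : ∀ i : Fin k, ∑ j : Fin n, entries L n k (standardColumn L n k) (finProdFinEquiv (i, j)) •
      standardFamily L n k (indexEquiv hk (Sum.inl (finProdFinEquiv (i, j)))) =
      Matrix.single (Fin.castLE hk i) (Fin.castLE hk i) 1 := by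
    intro i
    rw [Finset.sum_eq_single (Fin.castLE hk i)]
    · simp [entries_apply, standardColumn, indexEquiv_inl, standardFamily]
    · intro j _ hj
      rw [entries_apply, Equiv.symm_apply_apply, standardColumn, Matrix.of_apply, if_neg, zero_smul]
      intro h
      exact hj (Fin.ext h)
    · simp
  rw [Finset.sum_congr rfl fun i _ => h1 i]
  ext a b
  rw [Matrix.sub_apply, Matrix.sum_apply, Matrix.one_apply, Matrix.diagonal_apply]
  simp only [Matrix.single_apply]
  by_cases hab : a = b
  · subst hab
    by_cases ha : a.val < k
    · rw [Finset.sum_eq_single ⟨a.val, ha⟩]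
      · simp [ha]
      · intro i _ hi
        rw [if_neg]
        rintro ⟨h, -⟩
        exact hi (Fin.ext (show i.val = a.val from congrArg Fin.val h))
      · simp
    · rw [Finset.sum_eq_zero]
      · simp [ha]
      · intro i _
        rw [if_neg]
        rintro ⟨h, -⟩
        exact ha (h ▸ i.2)
  · rw [if_neg hab, if_neg hab, Finset.sum_eq_zero, sub_zero]
    intro i _
    rw [if_neg]
    rintro ⟨h, h'⟩
    exact hab (h.symm.trans h')

lemma scaledReversalLocus_standardFamily {L : Type*} [Field L] (hk : k ≤ n) :
    scaledReversalLocus (indexEquiv hk) (fun i => standardFamily L n k (indexEquiv hk i)) ≠ 0 := by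
  set X : Matrix (Fin n) (Fin n) L := Matrix.diagonal fun i : Fin n => if i.val < k then 0 else 1
  have hX : scaledProjOne ((fun i => standardFamily L n k (indexEquiv hk i)) ∘ Sum.inl) = X :=
    scaledProjOne_standardFamily hk
  have hD : frameMatrix ((fun i => standardFamily L n k (indexEquiv hk i)) ∘ Sum.inl) = 1 :=
    frameMatrix_standardFamily hk
  have hl : ∀ (v : Fin (k * n) ⊕ LargeIndex n k → Matrix (Fin n) (Fin n) L) (p : Fin n × Fin n)
      (_ : p.1.val < k)
      (_ : v ∘ Sum.inl = (fun i => standardFamily L n k (indexEquiv hk i)) ∘ Sum.inl),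
      standardFamily L n k p ∈ Submodule.span L (Set.range v) := by
    intro v p hp hv
    refine Submodule.subset_span ⟨Sum.inl (finProdFinEquiv (⟨p.1, hp⟩, p.2)), ?_⟩
    rw [← Function.comp_apply (f := v), hv, Function.comp_apply, indexEquiv_inl,
      Equiv.symm_apply_apply]
    rfl
  have hXl : ∀ a b, X * Matrix.single a b (1 : L) =
      if a.val < k then 0 else Matrix.single a b 1 := by
    intro a b
    ext i j
    rw [Matrix.diagonal_mul, Matrix.single_apply]
    split_ifs <;> (simp_all; try omega)
  have hXr : ∀ a b, Matrix.single a b (1 : L) * X =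
      if b.val < k then 0 else Matrix.single a b 1 := by
    intro a b
    ext i j
    rw [Matrix.mul_diagonal, Matrix.single_apply]
    split_ifs <;> (simp_all; try omega)
  rw [scaledReversalLocus, hD, Matrix.det_one, one_mul, hX]
  refine mul_ne_zero (matrixFamilyDet_ne_zero_of_single_mem _ _ ?_)
    (matrixFamilyDet_ne_zero_of_single_mem _ _ ?_)
  · set v := Sum.elim ((fun i => standardFamily L n k (indexEquiv hk i)) ∘ Sum.inl)
      fun i => standardFamily L n k (indexEquiv hk (Sum.inr i)) * X
    have h1 : ∀ a b : Fin n, ¬ b.val < k →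
        Matrix.single a b (1 : L) ∈ Submodule.span L (Set.range v) := by
      intro a b hb
      refine Submodule.subset_span ⟨Sum.inr ⟨(b, a), hb⟩, ?_⟩
      change standardFamily L n k (b, a) * X = _
      rw [standardFamily, add_mul, hXr, if_neg hb]
      split_ifs with h
      · rw [zero_mul, add_zero]
      · rw [hXr, if_pos (by tauto), add_zero]
    intro a b
    by_cases hb : b.val < k
    · have h2 := hl v (b, a) hb rfl
      rw [standardFamily] at h2
      split_ifs at h2 with h
      · simpa using h2
      · exact (Submodule.add_mem_iff_left _ (h1 b a (by simpa [hb] using h))).1 h2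
    · exact h1 a b hb
  · set v := Sum.elim ((fun i => standardFamily L n k (indexEquiv hk i)) ∘ Sum.inl)
      fun i => X * standardFamily L n k (indexEquiv hk (Sum.inr i))
    have h1 : ∀ a b : Fin n, ¬ a.val < k →
        Matrix.single a b (1 : L) ∈ Submodule.span L (Set.range v) := by
      intro a b ha
      by_cases hb : b.val < k
      · refine Submodule.subset_span ⟨Sum.inr ⟨(a, b), ha⟩, ?_⟩
        change X * standardFamily L n k (a, b) = _
        rw [standardFamily, mul_add, hXl, if_pos hb, if_neg (by tauto), hXl, if_neg ha, zero_add]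
      · refine Submodule.subset_span ⟨Sum.inr ⟨(b, a), hb⟩, ?_⟩
        change X * standardFamily L n k (b, a) = _
        rw [standardFamily, mul_add, hXl, if_neg ha, if_pos (by tauto), mul_zero, add_zero]
    intro a b
    by_cases ha : a.val < k
    · by_cases hb : b.val < k
      · have h2 := hl v (b, a) hb rfl
        rw [standardFamily, if_pos (by tauto), add_zero] at h2
        exact h2
      · have h2 := hl v (a, b) ha rfl
        rw [standardFamily, if_neg (by tauto)] at h2
        exact (Submodule.add_mem_iff_right _ (h1 b a hb)).1 h2
    · exact h1 a b ha

end MatrixFamilies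

/-! ### A family of elements in general position -/

section GenericFamily

variable {F : Type u} [Field F] {A : Type v} [Ring A] [Algebra F A] {n k : ℕ} {K : Type u} [Field K]
  [Algebra F K] {ψ : A →ₐ[F] Matrix (Fin n) (Fin n) K}

lemma familyDet_ne_zero_of_linearIndependent {r : ℕ} {μ : Type*} [Fintype μ] [DecidableEq μ]
    (b : Module.Basis (Fin r ⊕ μ) F A) {w : Fin r ⊕ μ → K ⊗[F] A} (h : LinearIndependent K w) :
    familyDet b w ≠ 0 := by
  have : Module.Finite K (K ⊗[F] A) := Module.Finite.of_basis (b.baseChange K)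
  have hcard : Fintype.card (Fin r ⊕ μ) = Module.finrank K (K ⊗[F] A) :=
    (Module.finrank_eq_card_basis (b.baseChange K)).symm
  have := (Module.Basis.is_basis_iff_det (b.baseChange K)).1
    ⟨h, h.span_eq_top_of_card_eq_finrank' hcard⟩
  exact this.ne_zero

lemma splitEquiv_one_tmul (hψ : Function.Bijective (splitLift ψ K)) (a : A) :
    splitEquiv K hψ (1 ⊗ₜ a) = splitHom ψ K a :=
  (splitLift_tmul ψ K 1 a).trans (one_smul _ _)

/-- The matrix `scaledProjOne` is a multiple of `projOne` at the annihilator of the standard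
columns. -/
lemma det_smul_splitEquiv_projOne (hψ : Function.Bijective (splitLift ψ K))
    {x : Fin (k * n) → A} (h : (columnMatrix ψ x (standardColumn K n k)).det ≠ 0) :
    (columnMatrix ψ x (standardColumn K n k)).det •
      splitEquiv K hψ (projOne x (columnCoord ψ x (standardColumn K n k))) =
      scaledProjOne fun j => splitHom ψ K (x j) := by
  set D := columnMatrix ψ x (standardColumn K n k) with hDdef
  have hD : frameMatrix (fun j => splitHom ψ K (x j)) = D := rfl
  have key : ∀ j, D.det * columnCoord ψ x (standardColumn K n k) 1 j =
      Matrix.vecMul (entries K n k (standardColumn K n k)) D.adjugate j := by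
    intro j
    have h1 : columnCoord ψ x (standardColumn K n k) 1 =
        Matrix.vecMul (entries K n k (splitHom ψ K 1 * standardColumn K n k)) D⁻¹ := rfl
    rw [h1, map_one, Matrix.one_mul, Matrix.inv_def, Matrix.vecMul_smul, Pi.smul_apply, smul_eq_mul,
      ← mul_assoc, Ring.mul_inverse_cancel _ h.isUnit, one_mul]
  have h2 : ∀ j, splitEquiv K hψ (columnCoord ψ x (standardColumn K n k) 1 j ⊗ₜ x j) =
      columnCoord ψ x (standardColumn K n k) 1 j • splitHom ψ K (x j) :=
    fun j => splitLift_tmul ψ K _ _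
  rw [projOne, map_sub, map_one, map_sum, scaledProjOne, hD, smul_sub, Finset.smul_sum]
  simp only [h2, smul_smul, key]

/-- If `scaledReversalLocus` does not vanish on a family in `A`, then the annihilator of the
standard columns is a point of the chart at which `reversalLocus` does not vanish. -/
lemma reversalLocus_ne_zero_of_scaled (hψ : Function.Bijective (splitLift ψ K)) {μ : Type*}
    [Fintype μ] [DecidableEq μ] (E : Fin (k * n) ⊕ μ ≃ Fin n × Fin n)
    (b : Module.Basis (Fin (k * n) ⊕ μ) F A) {y : Fin (k * n) ⊕ μ → A}
    (h : scaledReversalLocus E (fun i => splitHom ψ K (y i)) ≠ 0) :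
    IsUnit (columnMatrix ψ (y ∘ Sum.inl) (standardColumn K n k)).det ∧
    reversalLocus b (y ∘ Sum.inl) (y ∘ Sum.inr)
      (columnCoord ψ (y ∘ Sum.inl) (standardColumn K n k)) ≠ 0 := by
  rw [scaledReversalLocus, mul_ne_zero_iff, mul_ne_zero_iff, matrixFamilyDet_ne_zero_iff,
    matrixFamilyDet_ne_zero_iff] at h
  obtain ⟨⟨hD, hl⟩, hr⟩ := h
  have hD' : (columnMatrix ψ (y ∘ Sum.inl) (standardColumn K n k)).det ≠ 0 := hD
  set δ := (columnMatrix ψ (y ∘ Sum.inl) (standardColumn K n k)).det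
  have hs : scaledProjOne ((fun i => splitHom ψ K (y i)) ∘ Sum.inl) = _ :=
    (det_smul_splitEquiv_projOne hψ hD').symm
  set X := projOne (y ∘ Sum.inl) (columnCoord ψ (y ∘ Sum.inl) (standardColumn K n k))
  -- Passing to the scaled element multiplies members of the family by a unit.
  have key : ∀ (w : Fin (k * n) ⊕ μ → K ⊗[F] A) (w' : Fin (k * n) ⊕ μ → Matrix (Fin n) (Fin n) K),
      LinearIndependent K w' → (∀ j, splitEquiv K hψ (w (Sum.inl j)) = w' (Sum.inl j)) →
      (∀ i, δ • splitEquiv K hψ (w (Sum.inr i)) = w' (Sum.inr i)) → familyDet b w ≠ 0 := by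
    intro w w' hw' h1 h2
    apply familyDet_ne_zero_of_linearIndependent
    have h3 : LinearIndependent K ((splitEquiv K hψ).toLinearMap ∘ w) := by
      have h4 : (Sum.elim (fun _ => 1) fun _ => Units.mk0 δ hD' : Fin (k * n) ⊕ μ → Kˣ) •
          ((splitEquiv K hψ).toLinearMap ∘ w) = w' := by
        funext i
        cases i with
        | inl j => exact (one_smul Kˣ _).trans (h1 j)
        | inr i => exact h2 i
      exact (LinearIndependent.units_smul_iff ((splitEquiv K hψ).toLinearMap ∘ w)
        (Sum.elim (fun _ => 1) fun _ => Units.mk0 δ hD' : Fin (k * n) ⊕ μ → Kˣ)).1 (h4 ▸ hw')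
    exact h3.of_comp
  refine ⟨hD'.isUnit, mul_ne_zero (key _ _ hl (fun j => ?_) fun i => ?_)
    (key _ _ hr (fun j => ?_) fun i => ?_)⟩
  · exact splitEquiv_one_tmul hψ _
  · change δ • splitEquiv K hψ ((1 ⊗ₜ y (Sum.inr i)) * X) = splitHom ψ K (y (Sum.inr i)) * _
    rw [hs, map_mul, splitEquiv_one_tmul, mul_smul_comm]
  · exact splitEquiv_one_tmul hψ _
  · change δ • splitEquiv K hψ (X * (1 ⊗ₜ y (Sum.inr i))) = _ * splitHom ψ K (y (Sum.inr i))
    rw [hs, map_mul, splitEquiv_one_tmul, smul_mul_assoc]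

/-- Over an infinite field, there are a chart and elements `c i` for which `reversalLocus` is not
identically zero: the families in `A` are Zariski dense among the families of matrices over the
splitting field `K`, so some family in `A` is as good as `standardFamily`. -/
theorem exists_reversalLocus_ne_zero [Infinite F] [FiniteDimensional F A]
    (hA : Module.finrank F A = n ^ 2) (hk : k ≤ n) (hψ : Function.Bijective (splitLift ψ K)) :
    ∃ (b : Module.Basis (Fin (k * n) ⊕ LargeIndex n k) F A) (x : Fin (k * n) → A)
      (c : LargeIndex n k → A) (π : A →ₗ[F] (Fin (k * n) → K)),
      IsChartPoint x π ∧ reversalLocus b x c π ≠ 0 := by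
  let I := Fin (k * n) ⊕ LargeIndex n k
  let E : I ≃ Fin n × Fin n := indexEquiv hk
  have hcard : Module.finrank F A = Fintype.card I := by
    rw [Fintype.card_congr E, hA, Fintype.card_prod, Fintype.card_fin, sq]
  let b : Module.Basis I F A :=
    (Module.finBasisOfFinrankEq F A hcard).reindex (Fintype.equivFin I).symm
  let P := MvPolynomial (I × I) K
  -- The generic family in `A`, and the values of `scaledReversalLocus` at its specializations.
  let gen : I → Matrix (Fin n) (Fin n) P := fun i =>
    ∑ l, (MvPolynomial.X (i, l) : P) • splitHom ψ P (b l)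
  have hgen : ∀ (t : I × I → K) i, (gen i).map (MvPolynomial.eval t) =
      ∑ l, t (i, l) • splitHom ψ K (b l) := by
    intro t i
    ext p q
    simp only [gen, Matrix.map_apply, Matrix.sum_apply, Matrix.smul_apply, smul_eq_mul, map_sum,
      map_mul, MvPolynomial.eval_X, splitHom_apply]
    exact Finset.sum_congr rfl fun l _ => congrArg _ (MvPolynomial.eval_C _)
  have heval : ∀ t : I × I → K, MvPolynomial.eval t (scaledReversalLocus E gen) =
      scaledReversalLocus E fun i => ∑ l, t (i, l) • splitHom ψ K (b l) := by
    intro t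
    rw [map_scaledReversalLocus]
    simp only [hgen]
  -- The polynomial does not vanish identically, since the basis of `A` is a basis of the matrix
  -- algebra and hence the generic family specializes to `standardFamily` over `K`.
  have hne : scaledReversalLocus E gen ≠ 0 := by
    intro h0
    let β : Module.Basis I K (Matrix (Fin n) (Fin n) K) :=
      (b.baseChange K).map (splitEquiv K hψ).toLinearEquiv
    have hβ : ∀ l, β l = splitHom ψ K (b l) := by
      intro l
      rw [← splitEquiv_one_tmul hψ]
      simp [β]
    have h1 := heval fun t => β.repr (standardFamily K n k (E t.1)) t.2
    simp only [← hβ, β.sum_repr, h0, map_zero] at h1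
    exact scaledReversalLocus_standardFamily hk h1.symm
  -- A nonzero polynomial over `K` has a non-root with coordinates in the infinite subfield `F`.
  obtain ⟨s, hs⟩ : ∃ s : I × I → F,
      MvPolynomial.eval (fun t => algebraMap F K (s t)) (scaledReversalLocus E gen) ≠ 0 := by
    by_contra! hcon
    refine hne (MvPolynomial.funext_set (fun _ => Set.range (algebraMap F K))
      (fun _ => Set.infinite_range_of_injective (algebraMap F K).injective) fun t ht => ?_)
    choose s hs using fun i => ht i (Set.mem_univ i)
    rw [map_zero, ← hcon s]
    congr 2
    funext i
    exact (hs i).symm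
  let y : I → A := fun i => ∑ l, s (i, l) • b l
  have hy : scaledReversalLocus E (fun i => splitHom ψ K (y i)) ≠ 0 := by
    rw [heval] at hs
    convert hs using 3 with i
    simp only [y, map_sum, map_smul, algebraMap_smul]
  obtain ⟨hu, h⟩ := reversalLocus_ne_zero_of_scaled hψ E b hy
  exact ⟨b, _, _, _, isChartPoint_columnCoord hu, h⟩

end GenericFamily

/-! ### Splitting central simple algebras -/

section SplittingField

variable {F : Type u} [Field F] {A : Type v} [Ring A] [Algebra F A]

open TensorProduct in
lemma equivFinsuppOfBasisLeft_one_tmul_mul {K : Type w} [Ring K] [Algebra F K] {κ : Type*}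
    [DecidableEq κ] (β : Module.Basis κ F K) (a : A) (z : K ⊗[F] A) (i : κ) :
    equivFinsuppOfBasisLeft (N := A) β ((1 ⊗ₜ a) * z) i =
      a * equivFinsuppOfBasisLeft (N := A) β z i := by
  induction z with
  | zero => simp
  | tmul t c => simp
  | add y z hy hz => rw [mul_add, map_add, map_add, Finsupp.add_apply, hy, hz, ← mul_add]; rfl

open TensorProduct in
lemma equivFinsuppOfBasisLeft_mul_one_tmul {K : Type w} [Ring K] [Algebra F K] {κ : Type*}
    [DecidableEq κ] (β : Module.Basis κ F K) (a : A) (z : K ⊗[F] A) (i : κ) :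
    equivFinsuppOfBasisLeft (N := A) β (z * (1 ⊗ₜ a)) i =
      equivFinsuppOfBasisLeft (N := A) β z i * a := by
  induction z with
  | zero => simp
  | tmul t c => simp
  | add y z hy hz => rw [add_mul, map_add, map_add, Finsupp.add_apply, hy, hz, ← add_mul]; rfl

open TensorProduct in
/-- A central simple algebra stays simple under extension of scalars to a field `K`. In a nonzero
two-sided ideal, an element with the fewest nonzero coordinates in a basis of `K` can be normalized
to have a coordinate `1`; its commutators with `A` then vanish, so that it lies in `K`. -/
theorem isSimpleRing_baseChange (K : Type w) [Field K] [Algebra F K] [Algebra.IsCentral F A]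
    [IsSimpleRing A] : IsSimpleRing (K ⊗[F] A) := by
  have : Nontrivial (K ⊗[F] A) := (Algebra.TensorProduct.includeRight_injective
    (R := F) (A := K) (B := A) (algebraMap F K).injective).nontrivial
  refine IsSimpleRing.of_eq_bot_or_eq_top fun I => or_iff_not_imp_left.2 fun hI => ?_
  classical
  let β := Module.Basis.ofVectorSpace F K
  let e := equivFinsuppOfBasisLeft (N := A) β
  obtain ⟨z, ⟨hzI, hz0⟩, hmin⟩ : ∃ z, (z ∈ I ∧ z ≠ 0) ∧
      ∀ w, w ∈ I ∧ w ≠ 0 → (e z).support.card ≤ (e w).support.card := by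
    obtain ⟨z, hz⟩ : ∃ z, z ∈ I ∧ z ≠ 0 := by
      by_contra! h
      exact hI (le_bot_iff.1 fun x hx => (TwoSidedIdeal.mem_bot _).2 (h x hx))
    have := (InvImage.wf (fun z => (e z).support.card) wellFounded_lt).has_min
      {z | z ∈ I ∧ z ≠ 0} ⟨z, hz⟩
    obtain ⟨z, hz, h⟩ := this
    exact ⟨z, hz, fun w hw => not_lt.1 (h w hw)⟩
  obtain ⟨i₀, hi₀⟩ : ∃ i, e z i ≠ 0 := by
    by_contra! h
    exact hz0 (e.injective (by ext i; simpa using h i))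
  -- The coordinates at `i₀` of the elements of `I` supported in the support of `z`.
  let J : TwoSidedIdeal A := TwoSidedIdeal.mk'
    {a | ∃ w ∈ I, (e w).support ⊆ (e z).support ∧ e w i₀ = a}
    ⟨0, zero_mem I, by simp, by simp⟩
    (by
      rintro _ _ ⟨w, hw, hs, rfl⟩ ⟨w', hw', hs', rfl⟩
      refine ⟨w + w', add_mem hw hw', ?_, by simp⟩
      rw [map_add]
      exact Finsupp.support_add.trans (Finset.union_subset hs hs'))
    (by
      rintro _ ⟨w, hw, hs, rfl⟩
      refine ⟨-w, neg_mem hw, ?_, by simp⟩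
      rwa [map_neg, Finsupp.support_neg])
    (by
      rintro a _ ⟨w, hw, hs, rfl⟩
      refine ⟨(1 ⊗ₜ a) * w, I.mul_mem_left _ _ hw, fun i hi => hs ?_,
        equivFinsuppOfBasisLeft_one_tmul_mul β a w i₀⟩
      rw [Finsupp.mem_support_iff, equivFinsuppOfBasisLeft_one_tmul_mul] at hi
      exact Finsupp.mem_support_iff.2 (right_ne_zero_of_mul hi))
    (by
      rintro _ a ⟨w, hw, hs, rfl⟩
      refine ⟨w * (1 ⊗ₜ a), I.mul_mem_right _ _ hw, fun i hi => hs ?_,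
        equivFinsuppOfBasisLeft_mul_one_tmul β a w i₀⟩
      rw [Finsupp.mem_support_iff, equivFinsuppOfBasisLeft_mul_one_tmul] at hi
      exact Finsupp.mem_support_iff.2 (left_ne_zero_of_mul hi))
  have hJ : (1 : A) ∈ J := IsSimpleRing.one_mem_of_ne_zero_mem J hi₀
    ((TwoSidedIdeal.mem_mk' ..).2 ⟨z, hzI, subset_rfl, rfl⟩)
  obtain ⟨w, hw, hs, h1⟩ := (TwoSidedIdeal.mem_mk' ..).1 hJ
  have hcomm : ∀ a : A, (1 ⊗ₜ a) * w - w * (1 ⊗ₜ a) = 0 := by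
    intro a
    by_contra h0
    have hmem : (1 ⊗ₜ a) * w - w * (1 ⊗ₜ a) ∈ I :=
      sub_mem (I.mul_mem_left _ _ hw) (I.mul_mem_right _ _ hw)
    have happ : ∀ i, e ((1 ⊗ₜ a) * w - w * (1 ⊗ₜ a)) i = a * e w i - e w i * a := by
      intro i
      rw [map_sub, Finsupp.sub_apply, equivFinsuppOfBasisLeft_one_tmul_mul,
        equivFinsuppOfBasisLeft_mul_one_tmul]
    refine (hmin _ ⟨hmem, h0⟩).not_gt (Finset.card_lt_card ⟨fun i hi => hs ?_, fun h => ?_⟩)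
    · rw [Finsupp.mem_support_iff, happ] at hi
      rw [Finsupp.mem_support_iff]
      intro h
      simp [h] at hi
    · have := h (Finsupp.mem_support_iff.2 hi₀)
      rw [Finsupp.mem_support_iff, happ, h1] at this
      simp at this
  have hcentral : ∀ i, ∃ c : F, e w i = algebraMap F A c := by
    intro i
    rw [← Algebra.IsCentral.mem_center_iff, Subalgebra.mem_center_iff]
    intro a
    have := congrArg (fun t => e t i) (sub_eq_zero.1 (hcomm a))
    rwa [equivFinsuppOfBasisLeft_one_tmul_mul, equivFinsuppOfBasisLeft_mul_one_tmul] at this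
  choose c hc using hcentral
  have hwt : ∃ t : K, w = t ⊗ₜ 1 := by
    refine ⟨(e w).sum fun i _ => c i • β i, (e.symm_apply_apply w).symm.trans ?_⟩
    rw [equivFinsuppOfBasisLeft_symm_apply, Finsupp.sum, Finsupp.sum, TensorProduct.sum_tmul]
    refine Finset.sum_congr rfl fun i _ => ?_
    rw [hc, Algebra.algebraMap_eq_smul_one, TensorProduct.tmul_smul, TensorProduct.smul_tmul']
  obtain ⟨t, rfl⟩ := hwt
  have ht : t ≠ 0 := by
    rintro rfl
    rw [TensorProduct.zero_tmul, map_zero, Finsupp.zero_apply] at h1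
    exact zero_ne_one h1
  rw [← TwoSidedIdeal.one_mem_iff]
  have := I.mul_mem_left (t⁻¹ ⊗ₜ 1) _ hw
  rwa [Algebra.TensorProduct.tmul_mul_tmul, inv_mul_cancel₀ ht, one_mul] at this

/-- A central simple algebra of dimension `n ^ 2` is split by the algebraic closure. -/
theorem exists_bijective_splitLift [FiniteDimensional F A] [Algebra.IsCentral F A] [IsSimpleRing A]
    {n : ℕ} (hA : Module.finrank F A = n ^ 2) :
    ∃ ψ : A →ₐ[F] Matrix (Fin n) (Fin n) (AlgebraicClosure F),
      Function.Bijective (splitLift ψ (AlgebraicClosure F)) := by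
  have := isSimpleRing_baseChange (F := F) (A := A) (AlgebraicClosure F)
  obtain ⟨m, _, ⟨e⟩⟩ := IsSimpleRing.exists_algEquiv_matrix_of_isAlgClosed (AlgebraicClosure F)
    (AlgebraicClosure F ⊗[F] A)
  have hm : m = n := by
    have := e.toLinearEquiv.finrank_eq
    rw [Module.finrank_baseChange, hA, Module.finrank_matrix, Module.finrank_self, Fintype.card_fin,
      mul_one, ← sq] at this
    exact (Nat.pow_left_injective two_ne_zero this).symm
  subst hm
  refine ⟨(e.toAlgHom.restrictScalars F).comp Algebra.TensorProduct.includeRight, ?_⟩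
  have h : ∀ z, splitLift ((e.toAlgHom.restrictScalars F).comp
      Algebra.TensorProduct.includeRight) (AlgebraicClosure F) z = e z := by
    intro z
    induction z with
    | zero => rw [map_zero, map_zero]
    | add y z hy hz => rw [map_add, map_add, hy, hz]
    | tmul t a =>
      have h1 : (t ⊗ₜ a : AlgebraicClosure F ⊗[F] A) = t • (1 ⊗ₜ a) := by
        rw [TensorProduct.smul_tmul', smul_eq_mul, mul_one]
      rw [splitLift_tmul, h1, map_smul]
      rfl
  rw [funext h]
  exact e.bijective

end SplittingField

/-! ### Birational schemes and function fields -/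

section FunctionField

variable {F : Type u} [Field F] {U X Y : Scheme.{u}} {sU : U ⟶ Spec (.of F)}
  {sX : X ⟶ Spec (.of F)} {sY : Y ⟶ Spec (.of F)}

/-- The structure map of the function field is the structure morphism at the generic point. -/
lemma functionFieldStructureMap_spec [IsIntegral X] :
    Spec.map (CommRingCat.ofHom (functionFieldStructureMap sX)) =
      X.fromSpecStalk (genericPoint X) ≫ sX :=
  Spec.map_preimage _

/-- A nonempty open subscheme has the same function field. -/
lemma exists_functionField_ringEquiv [IsIntegral U] [IsIntegral X] (j : U ⟶ X) [IsOpenImmersion j]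
    (hj : j ≫ sX = sU) : ∃ e : X.functionField ≃+* U.functionField,
      ∀ c, e (functionFieldStructureMap sX c) = functionFieldStructureMap sU c := by
  have hgen : j (genericPoint U) = genericPoint X := genericPoint_eq_of_isOpenImmersion j
  let g : X.functionField ⟶ U.functionField :=
    X.presheaf.stalkSpecializes (specializes_of_eq hgen) ≫ j.stalkMap (genericPoint U)
  have : IsIso (X.presheaf.stalkSpecializes (specializes_of_eq hgen)) :=
    (TopCat.Presheaf.stalkCongr X.presheaf (.of_eq hgen)).isIso_inv
  have : IsIso g := inferInstanceAs (IsIso (_ ≫ _))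
  have hg : Spec.map g ≫ X.fromSpecStalk (genericPoint X) =
      U.fromSpecStalk (genericPoint U) ≫ j := by
    rw [Spec.map_comp, Category.assoc, Scheme.SpecMap_stalkSpecializes_fromSpecStalk,
      Scheme.SpecMap_stalkMap_fromSpecStalk]
  have h : CommRingCat.ofHom (functionFieldStructureMap sX) ≫ g =
      CommRingCat.ofHom (functionFieldStructureMap sU) := by
    apply Spec.map_injective
    rw [Spec.map_comp, functionFieldStructureMap_spec, functionFieldStructureMap_spec,
      reassoc_of% hg, hj]
  exact ⟨(asIso g).commRingCatIsoToRingEquiv, fun c => congrArg (fun f => f.hom c) h⟩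

/-- Two integral schemes over `F` with a common nonempty open subscheme are birational, with
isomorphic function fields. -/
theorem birationalOver_of_openImmersions [IsIntegral X] [IsIntegral Y] [Nonempty U] (j : U ⟶ X)
    [IsOpenImmersion j] (j' : U ⟶ Y) [IsOpenImmersion j'] (h : j ≫ sX = j' ≫ sY) :
    Scheme.BirationalOver sX sY ∧ FunctionFieldsIsomorphic sX sY := by
  have : IsIntegral U := isIntegral_of_isOpenImmersion j
  have : IsDominant j := ⟨j.isOpenEmbedding.isOpen_range.dense (Set.range_nonempty _)⟩
  have : IsDominant j' := ⟨j'.isOpenEmbedding.isOpen_range.dense (Set.range_nonempty _)⟩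
  refine ⟨(j.birationalOver sX _ rfl).symm.trans (j'.birationalOver sY _ h.symm), ?_⟩
  obtain ⟨e, he⟩ := exists_functionField_ringEquiv (sX := sX) j rfl
  obtain ⟨e', he'⟩ := exists_functionField_ringEquiv (sX := sY) j' h.symm
  let := (functionFieldStructureMap sX).toAlgebra
  let := (functionFieldStructureMap sY).toAlgebra
  refine ⟨AlgEquiv.ofRingEquiv (f := e.trans e'.symm) fun c => ?_⟩
  exact (congrArg e'.symm (he c)).trans ((RingEquiv.symm_apply_eq e').2 (he' c).symm)

end FunctionField

/-! ### Localized charts and the birational equivalence -/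

section OpenCharts

variable {F : Type u} [Field F] {A : Type v} [Ring A] [Algebra F A] [FiniteDimensional F A]

/-- The `r`-tuples of elements of `A`, indexed by their coordinates in a basis. -/
noncomputable def tupleFamily (F : Type u) [Field F] (A : Type v) [Ring A] [Algebra F A]
    [FiniteDimensional F A] (r : ℕ) (i : Fin r → Fin (Module.finrank F A) → F) (j : Fin r) : A :=
  (Module.finBasis F A).equivFun.symm (i j)

lemma tupleFamily_surjective (r : ℕ) : Function.Surjective (tupleFamily F A r) := fun y =>
  ⟨fun j => (Module.finBasis F A).equivFun (y j), funext fun _ => LinearEquiv.symm_apply_apply _ _⟩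

/-- The chart of the glued scheme given by the tuple `x i`, with `D` inverted. -/
noncomputable def awayι {ι : Type u} {n k : ℕ} (x : ι → Fin (k * n) → A) (i : ι)
    (D : ChartRing F x {i}) :
    Spec (.of (Localization.Away D)) ⟶ gluedScheme F x :=
  Spec.map (CommRingCat.ofHom (algebraMap (ChartRing F x {i}) (Localization.Away D))) ≫
    chartι x ⟨{i}, Finset.singleton_nonempty i⟩

instance {ι : Type u} {n k : ℕ} (x : ι → Fin (k * n) → A) (i : ι)
    (D : ChartRing F x {i}) :
    IsOpenImmersion (awayι x i D) := by
  have : IsOpenImmersion (Spec.map (CommRingCat.ofHom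
    (algebraMap (ChartRing F x {i}) (Localization.Away D)))) := IsOpenImmersion.of_isLocalization D
  unfold awayι
  infer_instance

lemma awayι_structure {ι : Type u} {n k : ℕ} (x : ι → Fin (k * n) → A) (i : ι)
    (D : ChartRing F x {i}) :
    awayι x i D ≫ gluedStructure F x =
      Spec.map (CommRingCat.ofHom (algebraMap F (Localization.Away D))) := by
  rw [awayι, Category.assoc, chartι_structure, ← Spec.map_comp, ← CommRingCat.ofHom_comp,
    ← IsScalarTower.algebraMap_eq]

end OpenCharts

theorem mainTheorem4 {F : Type u} [Field F] [Infinite F]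
    (A : Type v) [Ring A] [Algebra F A] [FiniteDimensional F A]
    [Algebra.IsCentral F A] [IsSimpleRing A]
    (n k : ℕ) (hn : Module.finrank F A = n ^ 2) (hk : k < n) :
    (∃ (X : Scheme.{u}) (sX : X ⟶ Spec (.of F)), IsGenSeveriBrauer A n k sX) ∧
    (∃ (Y : Scheme.{u}) (sY : Y ⟶ Spec (.of F)), IsGenSeveriBrauer Aᵐᵒᵖ n k sY) ∧
    ∀ (X Y : Scheme.{u}) (sX : X ⟶ Spec (.of F)) (sY : Y ⟶ Spec (.of F)),
      IsGenSeveriBrauer A n k sX → IsGenSeveriBrauer Aᵐᵒᵖ n k sY →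
      Scheme.BirationalOver sX sY ∧
      ∃ (_ : IsIntegral X) (_ : IsIntegral Y), FunctionFieldsIsomorphic sX sY := by
  let θ : A ≃ₗ[F] Aᵐᵒᵖ := MulOpposite.opLinearEquiv F
  -- All tuples are used as charts; the same index set serves for `A` and for its opposite.
  let x := tupleFamily F A (k * n)
  let x' := fun i => θ ∘ x i
  have hx : Function.Surjective x := tupleFamily_surjective _
  have hx' : Function.Surjective x' := θ.surjective.comp_left.comp hx
  have hX := isGenSeveriBrauer_gluedScheme (F := F) (A := A) (n := n) hx
  have hY := isGenSeveriBrauer_gluedScheme (F := F) (A := Aᵐᵒᵖ) (n := n) hx'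
  refine ⟨⟨_, _, hX⟩, ⟨_, _, hY⟩, fun X Y sX sY hsX hsY => ?_⟩
  have hpos : 0 < n := (Nat.zero_le k).trans_lt hk
  obtain ⟨ψ, hψ⟩ := exists_bijective_splitLift (F := F) (A := A) hn
  obtain ⟨ψ', hψ'⟩ := exists_bijective_splitLift (F := F) (A := Aᵐᵒᵖ) (n := n)
    (θ.finrank_eq.symm.trans hn)
  obtain ⟨b, y, c, π, hπ, hne⟩ := exists_reversalLocus_ne_zero hn hk.le hψ
  obtain ⟨i, rfl⟩ := hx y
  have hO := isUniversalChart_univCoord (F := F) x i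
  have hO' := isUniversalChart_univCoord (F := F) x' i
  -- The chart is nonempty and `reversalLocus` is nonzero on it, because it has the point `π`.
  obtain ⟨f, hf⟩ := hO.exists_hom hπ
  have : Nontrivial (ChartRing F x {i}) := f.toRingHom.domain_nontrivial
  have hloc : reversalLocus b (x i) c (univCoord F x {i} ⟨i, Finset.mem_singleton_self i⟩) ≠ 0 := by
    intro h0
    rw [← hf, ← map_reversalLocus, h0, map_zero] at hne
    exact hne rfl
  obtain ⟨D, D', hD, hD', ⟨e⟩⟩ := hO.exists_algEquiv (θ := θ) hO' (fun _ _ => rfl) hψ hψ' hpos hloc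
  have : Nontrivial (ChartRing F x' {i}) := ⟨D', 0, hD'⟩
  have := isDomain_chartRing (x := x) hψ hpos i
  have := isIntegral_gluedScheme (x := x) hψ hpos i
  have := isIntegral_gluedScheme (x := x') hψ' hpos i
  -- Every other representing scheme is isomorphic to the glued one.
  obtain ⟨eX, heX⟩ := hX.exists_iso hsX
  obtain ⟨eY, heY⟩ := hY.exists_iso hsY
  have hXi : IsIntegral X :=
    have : Nonempty X := Nonempty.map eX.hom inferInstance
    isIntegral_of_isOpenImmersion eX.inv
  have hYi : IsIntegral Y :=
    have : Nonempty Y := Nonempty.map eY.hom inferInstance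
    isIntegral_of_isOpenImmersion eY.inv
  have : Nontrivial (Localization.Away D) :=
    (IsLocalization.injective (Localization.Away D)
      (powers_le_nonZeroDivisors_of_noZeroDivisors hD)).nontrivial
  let eU : Spec (.of (Localization.Away D)) ≅ Spec (.of (Localization.Away D')) :=
    Scheme.Spec.mapIso e.symm.toRingEquiv.toCommRingCatIso.op
  have : Nonempty (Spec (.of (Localization.Away D))) := inferInstance
  obtain ⟨h1, h2⟩ := birationalOver_of_openImmersions (sX := sX) (sY := sY)
    (awayι x i D ≫ eX.hom) (eU.hom ≫ awayι x' i D' ≫ eY.hom) (by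
      rw [Category.assoc, heX, Category.assoc, Category.assoc, heY, awayι_structure,
        awayι_structure]
      change _ = Spec.map _ ≫ Spec.map _
      rw [← Spec.map_comp]
      congr 1
      ext c
      exact (e.symm.commutes c).symm)
  exact ⟨h1, hXi, hYi, h2⟩
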